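/- \textbf{Model.} There is a finite set of nodes with pairwise distinct identifiers $id(\cdot)$ from a linearly ordered set. A node $u$ has a channel $u.Ch$ (a finite multiset of messages), a mode (staying or leaving), finite sets of references $Left, Right, TLeft, TRight$ (the last two hold references obtained while leaving), for each stored reference $v$ a value $uv[v]\in\mathbb N\cup\{\bot\}$, a counter, finitely many non-empty batches $WaitingFor[d]$ of search requests, and numbers $seq$, $seq[d]$ (where $d$ is an identifier, not necessarily of a node). A search request records sender and destination by identifiers and carries no reference. A node is \emph{gone} after executing \textbf{exit} (its memory and channel are then cleared and it does nothing any more), otherwise \emph{present}. There is an edge $(u,v)$ if $u$ stores a reference of $v$ or a message in $u.Ch$ carries one; $PNG$ is the graph of all edges between present nodes. The oracle $\mathcal{NIDEC}$ is true for $u$ if $u.Ch=\emptyset$ and no edge $(v,u)$ with $v\ne u$ exists. The atomic steps are: $\textsc{Timeout}$ at a present node; receipt of a message from the channel of a present node (the message is removed and its action is executed); $InitiateSearch(d)$ at a present node; $leave$, by which a present staying node becomes leaving, for good. If no node is present, an idle step that changes nothing is possible. A \emph{computation} is an infinite sequence of states, each obtained from the previous one by an enabled step, in which each node that is always present executes $\textsc{Timeout}$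 infinitely often and every message in a channel is eventually received. Searches and leave steps occur at will. An \emph{initial state} is an arbitrary state in which all nodes are present. \textbf{Protocol Build-List* (with Search*).} Here $v<w$ means $id(v)<id(w)$ and \emph{self} is the executing node. ``Mirrored'' means: exchange left and right (also $T$-sets), $<$ and $>$, $\min$ and $\max$. To \emph{save} $v$ on a side means to add it to $Left$ or $Right$ if self is staying, to $TLeft$ or $TRight$ if self is leaving. Before each action a sanity check moves misplaced references between $Left$ and $Right$ and between $TLeft$ and $TRight$ to the correct side, drops references to self, discards values $uv$ of references not stored and values attached to several references, and, if self is staying, moves the content of $TLeft,TRight$ to $Left,Right$. If no case applies, nothing is done. \begin{itemize} \item $\textsc{Timeout}$, staying: for each $d$ with $WaitingFor[d]\ne\emptyset$ send $ForwardProbe(self,d,\{self\},seq)$ to self. Send $Introduce(v,self)$, for each $v\in Left$ except $\max Left$, to the next larger element of $Left$, and $Introduce(self,\bot)$ to $\max Left$. Mirrored for $Right$. \item $\textsc{Timeout}$, leaving: if $\mathcal{NIDEC}$ holds, send $Introduce(w,\bot)$ to $v$ and $Introduce(v,\bot)$ to $w$ for all stored $v,w$, and execute \textbf{exit}; otherwise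 send $RevAndLinREQ(right)$ to all of $Left\cup TLeft$ and $RevAndLinREQ(left)$ to all of $Right\cup TRight$. \item $Introduce(v,w)$: if $v=self$ and $w\neq\bot$, send $TempDelegate(w)$ to self. If $v<self$ and self is staying: if $w\ne\bot$, add $v$ to $Left$, send $Linearize(v)$ to $w$ and $TempDelegate(w)$ to self; if $w=\bot$, send $TempDelegate(v)$ to self. If $v<self$ and self is leaving: add $v$, and $w$ if $w\ne\bot$, to $TLeft$, each unless it is in $Left$. If $v>self$: mirrored. \item $Linearize(v)$: staying: send $TempDelegate(v)$ to self; if $v<self$ and some element of $Left$ is larger than $v$, let $w$ be the least such element, remove $v$ from $Left$ and send $TempDelegate(v)$ to $w$. Leaving: if $v<self$, add $v$ to $TLeft$. If $v>self$: mirrored. \item $TempDelegate(u)$: if $u<self$: if $Left=\emptyset$ or $\max Left<u$, save $u$ on the left; otherwise send $TempDelegate(u)$ to $\max Left$. If $u>self$: mirrored. \item $RevAndLinREQ(dir)$: if $dir=right$, or if self is staying: each $v$ in $Right\cup TRight$ (for $dir=left$: $Left\cup TLeft$) with $uv[v]=\bot$ gets a fresh value $uv[v]$ from the counter, different from all earlier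 and all stored ones, and $RevAndLinACK(self,uv[v])$ is sent to each $v$ in that set. Otherwise nothing is done. \item $RevAndLinACK(v,k)$, $v\ne self$: staying: send $TempDelegate(v)$ to self. Leaving: if $v<self$, add $v$ to $TLeft$ and send $RevAndLin(Right,k)$ to $v$; if $v>self$: mirrored. \item $RevAndLin(A,k)$: if $A$ has nodes smaller and nodes larger than self, or no stored $v$ has $uv[v]=k$, send $TempDelegate(u)$ to self for all $u\in A$. Otherwise let $v$ be the stored reference with $uv[v]=k$. Staying: if $v<self$, add $A$ to $Left$ and remove $v$ from $Left$ (mirrored if $v>self$), and send $Introduce(self,\bot)$ to $v$. Leaving and $v<self$: add $A$ to $TLeft$. Leaving and $v>self$: if $v\in Right$, add $A$ to and remove $v$ from $Right$, else do so with $TRight$; send $Introduce(self,\bot)$ to $v$. \item $InitiateSearch(d)$: staying: if $WaitingFor[d]=\emptyset$, increase $seq$ by one and set $seq[d]:=seq$; then add a new request $Search(self,d)$ to $WaitingFor[d]$. Leaving: nothing. \item $ForwardProbe(source,d,Next,s)$: if $d=id(self)$: send $ProbeSuccess(d,s,self)$ (staying) or $ProbeFail(d,s)$ (leaving) to $source$,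 and send $TempDelegate(u)$ for all $u\in Next$ and $TempDelegate(source)$ to self. If $d>id(self)$: set $Next:=(Next\setminus\{self\})\cup\{w\in Right: id(w)\le d\}$. If $Next=\emptyset$, send $ProbeFail(d,s)$ to $source$ and $TempDelegate(source)$ to self. Otherwise let $u=\min Next$; if $u<self$, send $TempDelegate(u)$ to self, else if $u\notin Right$, save $u$ on the right; in both cases send $ForwardProbe(source,d,Next,s)$ to $u$. If $d<id(self)$: mirrored. \item $ProbeSuccess(d,s,v)$: send $TempDelegate(v)$ to self; if self is staying and $s\ge seq[d]$, also send all requests in $WaitingFor[d]$ to $v$ and empty $WaitingFor[d]$. \item $ProbeFail(d,s)$: if self is staying and $s\ge seq[d]$, empty $WaitingFor[d]$. \item Receipt of a search request has no further effect. \end{itemize} \textbf{Theorem.} Build-List* with $\mathcal{NIDEC}$ is a self-stabilizing solution to the Finite Departure Problem: for every computation that starts in an initial state $s_0$, \begin{enumerate} \item (safety) in every state, two present nodes are in the same weakly connected component of $PNG$ if and only if they are in the same weakly connected component of the network graph of $s_0$ (in particular, if that graph is weakly connected, so is $PNG$ in every state); only leaving nodes are ever gone; \item (liveness) from some state on, in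 every state all leaving nodes are gone; \item (convergence) from some state on, every state is legitimate, i.e. every staying node is present, every leaving node is gone, and two staying nodes are in the same weakly connected component of $PNG$ if and only if they are in the same weakly connected component of the network graph of $s_0$; \item (closure) if a state is legitimate and the next step is not the decision of a node to leave, the next state is legitimate. \end{enumerate} -/

import Mathlib

noncomputable section

namespace BuildListStar

open scoped Classical

/-- The two directions of the line: towards smaller and towards larger identifiers. -/
inductive Dir where
  | left
  | right
  deriving DecidableEq

/-- The opposite direction. -/
def Dir.opp : Dir → Dir
  | .left => .right
  | .right => .left

/-- The read-only variable `mode`. -/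
inductive Mode where
  | staying
  | leaving
  deriving DecidableEq

/-- A search request `Search(v, destID)`. Its sender is recorded by identifier: no node ever uses
it as a reference, so a search request carries no edge. -/
structure SearchRequest (I : Type*) where
  sender : I
  dest : I

/-- The messages of Build-List* and Search*. The parameter `⊥` of `Introduce` is `none`. -/
inductive Message (V I : Type*) where
  | introduce (v : V) (w : Option V)
  | linearize (v : V)
  | tempDelegate (u : V)
  | revAndLinReq (dir : Dir)
  | revAndLinAck (v : V) (uniqueValue : ℕ)
  | revAndLin (nodeList : Finset V) (uniqueValue : ℕ)
  | forwardProbe (source : V) (dest : I) (next : Finset V) (seq : ℕ)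
  | probeSuccess (dest : I) (seq : ℕ) (v : V)
  | probeFail (dest : I) (seq : ℕ)
  | search (request : SearchRequest I)

/-- The node references carried by a message. -/
def Message.refs {V I : Type*} : Message V I → Set V
  | .introduce v w => {x | x = v ∨ w = some x}
  | .linearize v => {v}
  | .tempDelegate u => {u}
  | .revAndLinReq _ => ∅
  | .revAndLinAck v _ => {v}
  | .revAndLin nodeList _ => {x | x ∈ nodeList}
  | .forwardProbe source _ next _ => {x | x = source ∨ x ∈ next}
  | .probeSuccess _ _ v => {v}
  | .probeFail _ _ => ∅
  | .search _ => ∅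

/-- The protocol variables of one node. `nbr left`, `nbr right` are `Left`, `Right`;
`temp left`, `temp right` are the sets of references obtained while leaving.
`uniqueValue v` is satellite data of the stored reference `v` (`none` is `⊥`);
`counter` is the local counter behind `generateUniqueValue()`.
`waiting` is `WaitingFor`, `seqOf` is `seq[·]`. -/
structure LocalState (V I : Type*) where
  mode : Mode
  nbr : Dir → Finset V
  temp : Dir → Finset V
  uniqueValue : V → Option ℕ
  counter : ℕ
  waiting : I →₀ Multiset (SearchRequest I)
  seq : ℕ
  seqOf : I → ℕ

/-- All references stored by a node. -/
def LocalState.stored {V I : Type*} (L : LocalState V I) : Finset V :=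
  (L.nbr .left ∪ L.nbr .right) ∪ (L.temp .left ∪ L.temp .right)

/-- A system state: the variables of every node, the channel of every node, the gone nodes. -/
structure State (V I : Type*) where
  node : V → LocalState V I
  ch : V → Multiset (Message V I)
  gone : V → Prop

/-! ### Geometry of the line -/

/-- `y` lies strictly in direction `d` of `x`. -/
def Beyond {I : Type*} [LinearOrder I] (d : Dir) (x y : I) : Prop :=
  match d with
  | .left => y < x
  | .right => x < y

/-- The direction in which `y` lies from `x` (`none` if they are equal). -/
def dirOf {I : Type*} [LinearOrder I] (x y : I) : Option Dir :=
  if y < x then some .left else if x < y then some .right else none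

section Protocol

variable {V I : Type*} [LinearOrder I] (ident : V → I)

/-- The node of `S` that comes first when the line is traversed in direction `d`:
the argmin of the identifiers for `right`, the argmax for `left` (`none` if `S = ∅`). -/
def first (d : Dir) (S : Finset V) : Option V :=
  if h : ∃ m ∈ S, ∀ x ∈ S, ¬ Beyond d (ident x) (ident m) then some h.choose else none

/-- The node of `S` that directly precedes `v` when the line is traversed in direction `d`:
for `left`, the argmin of the identifiers of all `w ∈ S` with `ident v < ident w`. -/
def pred (d : Dir) (S : Finset V) (v : V) : Option V :=
  first ident d.opp (S.filter fun w => Beyond d (ident w) (ident v))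

/-- What an action returns: the new values of the variables and the messages that are sent,
each with its addressee. -/
abbrev Outcome (V I : Type*) := LocalState V I × Multiset (V × Message V I)

/-- Add the nodes of `S` to the set `nbr d`. -/
def LocalState.addNbr (L : LocalState V I) (d : Dir) (S : Finset V) : LocalState V I :=
  { L with nbr := Function.update L.nbr d (L.nbr d ∪ S) }

/-- Remove the node `v` from the set `nbr d`. -/
def LocalState.removeNbr (L : LocalState V I) (d : Dir) (v : V) : LocalState V I :=
  { L with nbr := Function.update L.nbr d ((L.nbr d).erase v) }

/-- Add the nodes of `S` to the set `temp d`. -/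
def LocalState.addTemp (L : LocalState V I) (d : Dir) (S : Finset V) : LocalState V I :=
  { L with temp := Function.update L.temp d (L.temp d ∪ S) }

/-- Remove the node `v` from the set `temp d`. -/
def LocalState.removeTemp (L : LocalState V I) (d : Dir) (v : V) : LocalState V I :=
  { L with temp := Function.update L.temp d ((L.temp d).erase v) }

/-- A staying node saves in `Left`/`Right`, a leaving node in the temporary sets. -/
def LocalState.save (L : LocalState V I) (d : Dir) (v : V) : LocalState V I :=
  match L.mode with
  | .staying => L.addNbr d {v}
  | .leaving => L.addTemp d {v}

/-- The sanity check made before each action: every stored reference is moved to the side where it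
belongs, references of a node to itself are dropped, and unique values exist only for stored references and
are unique (a value that is attached to several references is discarded). The temporary sets belong to leaving nodes: a staying node that finds references there
moves them to `Left`/`Right`. -/
def sanitize (self : V) (L : LocalState V I) : LocalState V I :=
  let onSide (d : Dir) (S : Finset V) : Finset V :=
    S.filter fun v => Beyond d (ident self) (ident v)
  { L with
    nbr := fun d =>
      match L.mode with
      | .staying => onSide d L.stored
      | .leaving => onSide d (L.nbr .left ∪ L.nbr .right)
    temp := fun d =>
      match L.mode with
      | .staying => ∅
      | .leaving => onSide d (L.temp .left ∪ L.temp .right)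
    uniqueValue := fun v =>
      if v ∈ L.stored ∧ v ≠ self ∧
          ∀ w ∈ L.stored, w ≠ self → L.uniqueValue w = L.uniqueValue v → w = v then
        L.uniqueValue v
      else none }

/-! ### Actions triggered by messages

Each function below is applied after the sanity check. -/

/-- `Introduce(v, w)`. If `v` is the node itself, the only other reference `w` is delegated. -/
def onIntroduce (self : V) (L : LocalState V I) (v : V) (w : Option V) : Outcome V I :=
  match dirOf (ident self) (ident v) with
  | none =>
    match w with
    | none => (L, 0)
    | some w => (L, {(self, .tempDelegate w)})
  | some d =>
    match L.mode with
    | .staying =>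
      match w with
      | some w => (L.addNbr d {v}, {(w, .linearize v), (self, .tempDelegate w)})
      | none => (L, {(self, .tempDelegate v)})
    | .leaving => (L.addTemp d (insert v w.toFinset \ L.nbr d), 0)

/-- `Linearize(v)`. -/
def onLinearize (self : V) (L : LocalState V I) (v : V) : Outcome V I :=
  match L.mode with
  | .staying =>
    match dirOf (ident self) (ident v) with
    | none => (L, {(self, .tempDelegate v)})
    | some d =>
      match pred ident d (L.nbr d) v with
      | none => (L, {(self, .tempDelegate v)})
      | some w => (L.removeNbr d v, {(self, .tempDelegate v), (w, .tempDelegate v)})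
  | .leaving =>
    match dirOf (ident self) (ident v) with
    | none => (L, 0)
    | some d => (L.addTemp d {v}, 0)

/-- `TempDelegate(u)`. -/
def onTempDelegate (self : V) (L : LocalState V I) (u : V) : Outcome V I :=
  match dirOf (ident self) (ident u) with
  | none => (L, 0)
  | some d =>
    match first ident d (L.nbr d) with
    | none => (L.save d u, 0)
    | some x =>
      if Beyond d (ident u) (ident x) then (L.save d u, 0)
      else (L, {(x, .tempDelegate u)})

/-- Give a unique value to each node of `T` that has none: the local counter, first raised to the
largest value in use, is incremented once for each of them, in increasing order of identifiers. -/
def assignUnique (L : LocalState V I) (T : Finset V) : LocalState V I :=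
  let base : ℕ := max L.counter (L.stored.sup fun v => (L.uniqueValue v).getD 0)
  let new : Finset V := T.filter fun v => L.uniqueValue v = none
  { L with
    uniqueValue := fun v =>
      if v ∈ new then some (base + 1 + (new.filter fun w => ident w < ident v).card)
      else L.uniqueValue v
    counter := base + new.card }

/-- `RevAndLinREQ(dir)`. -/
def onRevAndLinReq (self : V) (L : LocalState V I) (dir : Dir) : Outcome V I :=
  if dir = .right ∨ L.mode = .staying then
    let T := L.nbr dir ∪ L.temp dir
    let L' := assignUnique ident L T
    (L', T.val.map fun v => (v, .revAndLinAck self ((L'.uniqueValue v).getD 0)))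
  else (L, 0)

/-- `RevAndLinACK(v, uniqueValue)`. -/
def onRevAndLinAck (self : V) (L : LocalState V I) (v : V) (k : ℕ) : Outcome V I :=
  match dirOf (ident self) (ident v) with
  | none => (L, 0)
  | some d =>
    match L.mode with
    | .leaving => (L.addTemp d {v}, {(v, .revAndLin (L.nbr d.opp) k)})
    | .staying => (L, {(self, .tempDelegate v)})

/-- The stored reference with the given unique value. -/
def matching (L : LocalState V I) (k : ℕ) : Option V :=
  if h : ∃ v ∈ L.stored, L.uniqueValue v = some k then some h.choose else none

/-- `RevAndLin(nodeList, uniqueValue)`. A list with nodes from both sides is corrupt and is treated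
like an unmatched one. -/
def onRevAndLin (self : V) (L : LocalState V I) (nodeList : Finset V) (k : ℕ) : Outcome V I :=
  let delegateAll : Outcome V I := (L, nodeList.val.map fun u => (self, .tempDelegate u))
  if (∃ x ∈ nodeList, ident x < ident self) ∧ (∃ y ∈ nodeList, ident self < ident y) then
    delegateAll
  else
    match matching L k with
    | none => delegateAll
    | some v =>
      match dirOf (ident self) (ident v) with
      -- impossible after the sanity check
      | none => delegateAll
      | some d =>
        match L.mode, d with
        | .staying, d =>
          ((L.addNbr d nodeList).removeNbr d v, {(v, .introduce self none)})
        | .leaving, .left => (L.addTemp .left nodeList, 0)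
        | .leaving, .right =>
          (if v ∈ L.nbr .right then (L.addNbr .right nodeList).removeNbr .right v
            else (L.addTemp .right nodeList).removeTemp .right v,
            {(v, .introduce self none)})

/-- `ForwardProbe(source, destID, Next, seq)`. -/
def onForwardProbe (self : V) (L : LocalState V I) (source : V) (dest : I) (next : Finset V)
    (s : ℕ) : Outcome V I :=
  match dirOf (ident self) dest with
  | none =>
    let answer : Message V I :=
      match L.mode with
      | .staying => .probeSuccess dest s self
      | .leaving => .probeFail dest s
    (L, (next.val.map fun u => (self, .tempDelegate u)) +
      {(source, answer), (self, .tempDelegate source)})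
  | some d =>
    let next' : Finset V :=
      next.erase self ∪ (L.nbr d).filter fun w => ¬ Beyond d dest (ident w)
    match first ident d next' with
    | none => (L, {(source, .probeFail dest s), (self, .tempDelegate source)})
    | some u =>
      let forward : V × Message V I := (u, .forwardProbe source dest next' s)
      if Beyond d (ident u) (ident self) then (L, {(self, .tempDelegate u), forward})
      else if u ∉ L.nbr d then (L.save d u, {forward})
      else (L, {forward})

/-- `ProbeSuccess(destID, seq, dest)`. -/
def onProbeSuccess (self : V) (L : LocalState V I) (dest : I) (s : ℕ) (v : V) : Outcome V I :=
  if L.mode = .staying ∧ L.seqOf dest ≤ s then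
    ({ L with waiting := L.waiting.erase dest },
      ((L.waiting dest).map fun r => (v, .search r)) + {(self, .tempDelegate v)})
  else (L, {(self, .tempDelegate v)})

/-- `ProbeFail(destID, seq)`. -/
def onProbeFail (L : LocalState V I) (dest : I) (s : ℕ) : Outcome V I :=
  if L.mode = .staying ∧ L.seqOf dest ≤ s then
    ({ L with waiting := L.waiting.erase dest }, 0)
  else (L, 0)

/-- Processing a message. A delivered search request has no further effect. -/
def onMessage (self : V) (L : LocalState V I) : Message V I → Outcome V I
  | .introduce v w => onIntroduce ident self L v w
  | .linearize v => onLinearize ident self L v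
  | .tempDelegate u => onTempDelegate ident self L u
  | .revAndLinReq dir => onRevAndLinReq ident self L dir
  | .revAndLinAck v k => onRevAndLinAck ident self L v k
  | .revAndLin nodeList k => onRevAndLin ident self L nodeList k
  | .forwardProbe source dest next s => onForwardProbe ident self L source dest next s
  | .probeSuccess dest s v => onProbeSuccess self L dest s v
  | .probeFail dest s => onProbeFail L dest s
  | .search _ => (L, 0)

/-! ### Actions that are not triggered by messages -/

/-- `InitiateSearch(destID)`. -/
def onInitiateSearch (self : V) (L : LocalState V I) (dest : I) : LocalState V I :=
  match L.mode with
  | .leaving => L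
  | .staying =>
    let L' : LocalState V I :=
      if L.waiting dest = 0 then
        { L with seq := L.seq + 1, seqOf := Function.update L.seqOf dest (L.seq + 1) }
      else L
    { L' with waiting := L'.waiting.update dest (L'.waiting dest + {⟨ident self, dest⟩}) }

/-- The messages sent in direction `d` in `Timeout` of a staying node: every neighbor but the
closest one is introduced to the next closer one, and the node introduces itself to the
closest one. -/
def timeoutSide (self : V) (L : LocalState V I) (d : Dir) : Multiset (V × Message V I) :=
  ((L.nbr d).val.bind fun v =>
    match pred ident d (L.nbr d) v with
    | none => 0
    | some w => {(w, .introduce v (some self))}) +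
  (match first ident d (L.nbr d) with
    | none => 0
    | some w => {(w, .introduce self none)})

/-- The messages sent in `Timeout` of a staying node. -/
def timeoutStaying (self : V) (L : LocalState V I) : Multiset (V × Message V I) :=
  (L.waiting.support.val.map fun dest => (self, .forwardProbe self dest {self} L.seq)) +
    (timeoutSide ident self L .left + timeoutSide ident self L .right)

/-- The messages sent in `Timeout` of a leaving node if the oracle answers false. -/
def timeoutRequest (L : LocalState V I) : Multiset (V × Message V I) :=
  ((L.nbr .left ∪ L.temp .left).val.map fun v => (v, .revAndLinReq .right)) +
    ((L.nbr .right ∪ L.temp .right).val.map fun w => (w, .revAndLinReq .left))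

/-- The messages sent in `Timeout` of a leaving node directly before `exit`: all its neighbors are
introduced to each other. -/
def timeoutExit (L : LocalState V I) : Multiset (V × Message V I) :=
  L.stored.val.bind fun v => L.stored.val.bind fun w =>
    {(v, .introduce w none), (w, .introduce v none)}

/-! ### The network graph and the oracle -/

/-- There is an explicit or implicit edge `(u, v)`: `u` stores a reference of `v` or has a message
in its channel that carries one. -/
def Edge {V I : Type*} (s : State V I) (u v : V) : Prop :=
  v ∈ (s.node u).stored ∨ ∃ m ∈ s.ch u, v ∈ m.refs

/-- `u` and `v` lie in the same weakly connected component of the graph on the present nodes whose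
edges are the explicit and implicit edges between present nodes. -/
def SameComponent {V I : Type*} (s : State V I) (u v : V) : Prop :=
  Relation.EqvGen (fun x y => ¬ s.gone x ∧ ¬ s.gone y ∧ Edge s x y) u v

/-- The oracle NIDEC: no other node has a reference of `u` in its memory or in a message in its
channel, and the channel of `u` is empty. -/
def NIDEC {V I : Type*} (s : State V I) (u : V) : Prop :=
  (∀ v, v ≠ u → ¬ Edge s v u) ∧ s.ch u = 0

/-! ### Computations -/

/-- The atomic steps. `idle` is available only when no node is present, so that a system all of
whose nodes are gone still has an infinite computation. -/
inductive Event (V I : Type*) where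
  | timeout (u : V)
  | receive (u : V) (m : Message V I)
  | initiateSearch (u : V) (dest : I)
  | leave (u : V)
  | idle

/-- The enabled steps. Nothing is enabled at a gone node. -/
def Enabled {V I : Type*} (s : State V I) : Event V I → Prop
  | .timeout u => ¬ s.gone u
  | .receive u m => ¬ s.gone u ∧ m ∈ s.ch u
  | .initiateSearch u _ => ¬ s.gone u
  | .leave u => ¬ s.gone u ∧ (s.node u).mode = .staying
  | .idle => ∀ u, s.gone u

/-- Replace the variables of `u` and put the messages into the channels of their addressees. -/
def commit {V I : Type*} (s : State V I) (u : V) (o : Outcome V I) : State V I :=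
  { s with
    node := Function.update s.node u o.1
    ch := fun v => s.ch v + (o.2.filter fun p => p.1 = v).map Prod.snd }

/-- `exit`: the node is gone, its memory and its channel are cleared. -/
def exitNode {V I : Type*} (s : State V I) (u : V) : State V I :=
  { node := Function.update s.node u
      { s.node u with
        nbr := fun _ => ∅
        temp := fun _ => ∅
        uniqueValue := fun _ => none
        waiting := 0 }
    ch := Function.update s.ch u 0
    gone := fun v => v = u ∨ s.gone v }

/-- The effect of a step. Every action starts with the sanity check. -/
def exec (s : State V I) : Event V I → State V I
  | .timeout u =>
    let L := sanitize ident u (s.node u)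
    match L.mode with
    | .staying => commit s u (L, timeoutStaying ident u L)
    | .leaving =>
      if NIDEC s u then exitNode (commit s u (L, timeoutExit L)) u
      else commit s u (L, timeoutRequest L)
  | .receive u m =>
    commit { s with ch := Function.update s.ch u ((s.ch u).erase m) } u
      (onMessage ident u (sanitize ident u (s.node u)) m)
  | .initiateSearch u dest =>
    commit s u (onInitiateSearch ident u (sanitize ident u (s.node u)) dest, 0)
  | .leave u =>
    commit s u ({ sanitize ident u (s.node u) with mode := .leaving }, 0)
  | .idle => s

/-- `c` is a computation in which the step from `c i` to `c (i + 1)` is `e i`: steps are enabled,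
action execution is weakly fair for the timeout actions, and message receipt is fair. Searches and
leave actions are executed at will, so no fairness is required for them. -/
structure IsComputation (c : ℕ → State V I) (e : ℕ → Event V I) : Prop where
  enabled : ∀ i, Enabled (c i) (e i)
  step : ∀ i, c (i + 1) = exec ident (c i) (e i)
  timeout_fair : ∀ u, (∃ i₀, ∀ i ≥ i₀, ¬ (c i).gone u) → ∀ i, ∃ j ≥ i, e j = .timeout u
  receipt_fair : ∀ i u m, m ∈ (c i).ch u → ∃ j ≥ i, e j = .receive u m

end Protocol

/-! ### The Finite Departure Problem -/

/-- An initial state is an arbitrary state in which all nodes are present. -/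
def IsInitial {V I : Type*} (s : State V I) : Prop :=
  ∀ u, ¬ s.gone u

/-- The legitimate states of the Finite Departure Problem for the initial state `s₀`: staying nodes
are not gone, leaving nodes are gone, and the weakly connected components are exactly the sets of
staying nodes of the initial weakly connected components. -/
structure FDPLegitimate {V I : Type*} (s₀ s : State V I) : Prop where
  staying_present : ∀ u, (s.node u).mode = .staying → ¬ s.gone u
  leaving_gone : ∀ u, (s.node u).mode = .leaving → s.gone u
  components : ∀ u v, (s.node u).mode = .staying → (s.node v).mode = .staying →
    (SameComponent s u v ↔ SameComponent s₀ u v)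

end BuildListStar

end

/-! Safety is a statement about single steps. An executing node sends messages only to nodes it
knows (itself, a stored reference, a reference in the received message), and these messages carry
only references of nodes it knows (`Sent.known`); hence every new edge joins two nodes of one old
component. Conversely an action leaves its node connected to everything it stored or received
(`onMessage_connected`), so no component is split. At an `exit` the oracle guarantees that all edges
at the node go out from its memory, and the mutual introductions replace this star by a clique on
its neighbors. `connected_exec_iff` combines the three facts.

For liveness, modes and gone nodes only change monotonically, so from some time on they are constant
(`Regime`). It must be shown that no leaving node is then still present. No exit happens in a
regime, so it suffices to find one present leaving node for which the oracle eventually becomes true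
for good: by fairness its next `Timeout` would be an exit (`Regime.gone_of_leaving`).

The protocol breaks the symmetry between leaving neighbors: a leaving node answers only requests
with argument `right`, and it drops only references on its right. Call a node `Requested` if at some
time a leaving node on its right stores it. Such a reference is never dropped, so requests keep
coming. The largest present leaving node is not requested; let `w` be the smallest present leaving
node that is not. Eventually `w` answers no request and hence issues no reference of itself, so
nothing new about `w` reaches its right side (`shielded_right`). Every present leaving node on the
left of `w` is requested, and an induction along the line from the left end shows that each of them,
and then `w`, is forgotten by all nodes on its left (`eventually_clear_left`).

Both sides rest on `eventually_clear`, which cleans a shielded side of a leaving node `u` from its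
far end towards `u`. If everything beyond `x` is clean, references of `u` come to `x` only through
its own introductions: `x` introduces `u` to a closer neighbor, which answers with `Linearize`. A
staying `x` has two possibilities. Either it stores staying nodes between itself and `u` again and
again; then it keeps one of them forever, this one diverts every reference of `u`, and linearization
removes `u`. Or `u` is its closest neighbor whenever it is stored at a `Timeout`; then `x`
introduces itself to `u`, and the exchange `RevAndLinREQ`, `RevAndLinACK`, `RevAndLin` makes `x`
drop `u`. A leaving `x` on the left drops `u` because `x` is requested; on the right no leaving node
stores `u`.

All this is preceded by eliminating corrupt initial messages. Fairness empties the channels of every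
kind of message that is no longer produced (`eventually_good`), or that is produced only from the
same kind with higher rank (`eventually_never_of_rank`). Unique values that were really generated
stay reliable because counters never decrease (`KeyFor`). -/

set_option linter.unusedSectionVars false

noncomputable section

namespace BuildListStar

open scoped Classical
open Filter

variable {V I : Type*} [LinearOrder I] {ident : V → I}

/-! ### Geometry of the line -/

theorem beyond_opp {d : Dir} {x y : I} : Beyond d.opp x y ↔ Beyond d y x := by
  cases d <;> rfl

theorem not_beyond_self (d : Dir) (x : I) : ¬ Beyond d x x := by
  cases d <;> exact lt_irrefl x

theorem Beyond.trans {d : Dir} {x y z : I} (h : Beyond d x y) (h' : Beyond d y z) :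
    Beyond d x z := by
  cases d
  · exact lt_trans (α := I) h' h
  · exact lt_trans (α := I) h h'

theorem Beyond.asymm {d : Dir} {x y : I} (h : Beyond d x y) : ¬ Beyond d y x :=
  fun h' => not_beyond_self d x (h.trans h')

theorem Beyond.ne {d : Dir} {x y : I} (h : Beyond d x y) : x ≠ y := by
  rintro rfl; exact not_beyond_self d x h

theorem eq_or_beyond_of_not_beyond {d : Dir} {x y : I} (h : ¬ Beyond d x y) :
    x = y ∨ Beyond d y x := by
  cases d
  · exact (not_lt.mp h).eq_or_lt
  · exact (not_lt.mp h).eq_or_lt.imp Eq.symm id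

theorem beyond_of_not_beyond_of_beyond {d : Dir} {x y z : I} (h : ¬ Beyond d y x)
    (h' : Beyond d y z) : Beyond d x z := by
  rcases eq_or_beyond_of_not_beyond h with rfl | h
  · exact h'
  · exact h.trans h'

theorem exists_beyond {x y : I} (h : x ≠ y) : ∃ d, Beyond d x y :=
  h.lt_or_gt.elim (fun h => ⟨.right, h⟩) fun h => ⟨.left, h⟩

theorem Beyond.dir_eq {d d' : Dir} {x y : I} (h : Beyond d x y) (h' : Beyond d' x y) :
    d = d' := by
  cases d <;> cases d' <;> first | rfl | exact (lt_asymm (α := I) h h').elim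

theorem dir_eq_or_opp (d d' : Dir) : d = d' ∨ d = d'.opp := by
  cases d <;> cases d' <;> simp [Dir.opp]

theorem dirOf_eq_none {x y : I} : dirOf x y = none ↔ x = y := by
  unfold dirOf
  split_ifs with h₁ h₂
  · simpa using h₁.ne'
  · simpa using h₂.ne
  · simpa using le_antisymm (not_lt.mp h₁) (not_lt.mp h₂)

theorem dirOf_eq_some {d : Dir} {x y : I} : dirOf x y = some d ↔ Beyond d x y := by
  unfold dirOf
  split_ifs with h₁ h₂ <;> cases d <;> simp [Beyond, *]
  exact h₁.le

theorem first_mem {d : Dir} {S : Finset V} {m : V} (h : first ident d S = some m) : m ∈ S := by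
  unfold first at h
  split_ifs at h with h'
  cases h
  exact h'.choose_spec.1

theorem not_beyond_first {d : Dir} {S : Finset V} {m x : V} (h : first ident d S = some m)
    (hx : x ∈ S) : ¬ Beyond d (ident x) (ident m) := by
  unfold first at h
  split_ifs at h with h'
  cases h
  exact h'.choose_spec.2 x hx

theorem first_eq_none {d : Dir} {S : Finset V} (h : first ident d S = none) : S = ∅ := by
  by_contra hS
  have hS := Finset.nonempty_iff_ne_empty.mpr hS
  unfold first at h
  split_ifs at h with h'
  apply h'
  cases d
  · obtain ⟨m, hm, h⟩ := Finset.exists_max_image S ident hS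
    exact ⟨m, hm, fun x hx => not_lt.mpr (h x hx)⟩
  · obtain ⟨m, hm, h⟩ := Finset.exists_min_image S ident hS
    exact ⟨m, hm, fun x hx => not_lt.mpr (h x hx)⟩

theorem pred_mem {d : Dir} {S : Finset V} {v w : V} (h : pred ident d S v = some w) : w ∈ S :=
  (Finset.mem_filter.mp (first_mem h)).1

theorem pred_beyond {d : Dir} {S : Finset V} {v w : V} (h : pred ident d S v = some w) :
    Beyond d (ident w) (ident v) :=
  (Finset.mem_filter.mp (first_mem h)).2

theorem pred_eq_none {d : Dir} {S : Finset V} {v w : V} (h : pred ident d S v = none)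
    (hw : w ∈ S) : ¬ Beyond d (ident w) (ident v) := fun h' => by
  have := first_eq_none h
  exact Finset.notMem_empty w (this ▸ Finset.mem_filter.mpr ⟨hw, h'⟩)

/-! ### The sanitized variables of a node -/

/-- The variables of `x` as its next action sees them. -/
abbrev view (ident : V → I) (s : State V I) (x : V) : LocalState V I :=
  sanitize ident x (s.node x)

theorem mem_stored {L : LocalState V I} {v : V} :
    v ∈ L.stored ↔ ∃ d, v ∈ L.nbr d ∨ v ∈ L.temp d := by
  simp only [LocalState.stored, Finset.mem_union]
  constructor
  · rintro ((h | h) | (h | h))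
    exacts [⟨_, .inl h⟩, ⟨_, .inl h⟩, ⟨_, .inr h⟩, ⟨_, .inr h⟩]
  · rintro ⟨d, h⟩
    cases d <;> tauto

theorem mem_stored_of_nbr {L : LocalState V I} {d : Dir} {v : V} (h : v ∈ L.nbr d) :
    v ∈ L.stored := mem_stored.mpr ⟨d, .inl h⟩

@[simp] theorem sanitize_mode (x : V) (L : LocalState V I) :
    (sanitize ident x L).mode = L.mode := rfl

theorem sanitize_nbr_staying {x v : V} {L : LocalState V I} {d : Dir} (h : L.mode = .staying) :
    v ∈ (sanitize ident x L).nbr d ↔ v ∈ L.stored ∧ Beyond d (ident x) (ident v) := by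
  simp [sanitize, h]

theorem sanitize_temp_staying {x : V} {L : LocalState V I} {d : Dir} (h : L.mode = .staying) :
    (sanitize ident x L).temp d = ∅ := by
  simp [sanitize, h]

theorem sanitize_nbr_leaving {x v : V} {L : LocalState V I} {d : Dir} (h : L.mode = .leaving) :
    v ∈ (sanitize ident x L).nbr d ↔ (∃ d', v ∈ L.nbr d') ∧ Beyond d (ident x) (ident v) := by
  have : (v ∈ L.nbr .left ∨ v ∈ L.nbr .right) ↔ ∃ d', v ∈ L.nbr d' :=
    ⟨fun h => h.elim (fun h => ⟨_, h⟩) fun h => ⟨_, h⟩, fun ⟨d', h⟩ => by cases d' <;> tauto⟩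
  simp [sanitize, h, this]

theorem sanitize_temp_leaving {x v : V} {L : LocalState V I} {d : Dir} (h : L.mode = .leaving) :
    v ∈ (sanitize ident x L).temp d ↔ (∃ d', v ∈ L.temp d') ∧ Beyond d (ident x) (ident v) := by
  have : (v ∈ L.temp .left ∨ v ∈ L.temp .right) ↔ ∃ d', v ∈ L.temp d' :=
    ⟨fun h => h.elim (fun h => ⟨_, h⟩) fun h => ⟨_, h⟩, fun ⟨d', h⟩ => by cases d' <;> tauto⟩
  simp [sanitize, h, this]

theorem sanitize_nbr_beyond {x v : V} {L : LocalState V I} {d : Dir}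
    (h : v ∈ (sanitize ident x L).nbr d) : Beyond d (ident x) (ident v) := by
  cases hm : L.mode
  · exact ((sanitize_nbr_staying hm).mp h).2
  · exact ((sanitize_nbr_leaving hm).mp h).2

/-- The sanity check distributes references over `nbr` and `temp` differently in the two modes, but
it sorts them by side in the same way, so the union on each side can be treated without regard to
the mode. -/
theorem sanitize_side {x v : V} {L : LocalState V I} {d : Dir} :
    v ∈ (sanitize ident x L).nbr d ∪ (sanitize ident x L).temp d ↔
      v ∈ L.stored ∧ Beyond d (ident x) (ident v) := by
  cases hm : L.mode
  · rw [Finset.mem_union, sanitize_nbr_staying hm, sanitize_temp_staying hm]; simp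
  · rw [Finset.mem_union, sanitize_nbr_leaving hm, sanitize_temp_leaving hm, mem_stored]
    constructor
    · rintro (⟨⟨d', h⟩, h'⟩ | ⟨⟨d', h⟩, h'⟩)
      exacts [⟨⟨d', .inl h⟩, h'⟩, ⟨⟨d', .inr h⟩, h'⟩]
    · rintro ⟨⟨d', h | h⟩, h'⟩
      exacts [.inl ⟨⟨d', h⟩, h'⟩, .inr ⟨⟨d', h⟩, h'⟩]

theorem sanitize_stored (hi : Function.Injective ident) {x v : V} {L : LocalState V I} :
    v ∈ (sanitize ident x L).stored ↔ v ∈ L.stored ∧ v ≠ x := by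
  have : v ∈ (sanitize ident x L).stored ↔
      ∃ d, v ∈ (sanitize ident x L).nbr d ∪ (sanitize ident x L).temp d := by
    simp only [mem_stored, Finset.mem_union]
  rw [this]
  simp only [sanitize_side]
  constructor
  · rintro ⟨d, h, h'⟩
    exact ⟨h, fun h => h'.ne (h ▸ rfl)⟩
  · rintro ⟨h, h'⟩
    obtain ⟨d, hd⟩ := exists_beyond (hi.ne h'.symm)
    exact ⟨d, h, hd⟩

/-! ### Sent messages -/

/-- The set from which a probe with destination `dest` at `x` takes its next hop. -/
def probeNext (ident : V → I) (x : V) (L : LocalState V I) (d : Dir) (dest : I)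
    (next : Finset V) : Finset V :=
  next.erase x ∪ (L.nbr d).filter fun w => ¬ Beyond d dest (ident w)

/-- The messages that a step sends, each with its addressee. -/
def outbox (ident : V → I) (s : State V I) : Event V I → Multiset (V × Message V I)
  | .timeout x =>
    match (view ident s x).mode with
    | .staying => timeoutStaying ident x (view ident s x)
    | .leaving =>
      if NIDEC s x then timeoutExit (view ident s x) else timeoutRequest (view ident s x)
  | .receive x m => (onMessage ident x (view ident s x) m).2
  | _ => 0

/-- `Sent ident s ev y m`: the step `ev` in state `s` sends the message `m` to `y`. -/
inductive Sent (ident : V → I) (s : State V I) : Event V I → V → Message V I → Prop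
  | probeStart (x dest n) (hx : (s.node x).mode = .staying) :
    Sent ident s (.timeout x) x (.forwardProbe x dest {x} n)
  | introFar (x d v w) (hx : (s.node x).mode = .staying) (hv : v ∈ (view ident s x).nbr d)
    (hw : pred ident d ((view ident s x).nbr d) v = some w) :
    Sent ident s (.timeout x) w (.introduce v (some x))
  | introNear (x d w) (hx : (s.node x).mode = .staying)
    (hw : first ident d ((view ident s x).nbr d) = some w) :
    Sent ident s (.timeout x) w (.introduce x none)
  | exitIntro (x v w) (hx : (s.node x).mode = .leaving) (hn : NIDEC s x)
    (hv : v ∈ (view ident s x).stored) (hw : w ∈ (view ident s x).stored) :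
    Sent ident s (.timeout x) v (.introduce w none)
  | request (x d v) (hx : (s.node x).mode = .leaving) (hn : ¬ NIDEC s x)
    (hv : v ∈ (view ident s x).nbr d ∪ (view ident s x).temp d) :
    Sent ident s (.timeout x) v (.revAndLinReq d.opp)
  | introLin (x v w) (hx : (s.node x).mode = .staying) (hv : ident x ≠ ident v) :
    Sent ident s (.receive x (.introduce v (some w))) w (.linearize v)
  | introDelegate (x v w) :
    Sent ident s (.receive x (.introduce v (some w))) x (.tempDelegate w)
  | introOne (x v) (hx : (s.node x).mode = .staying) (hv : ident x ≠ ident v) :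
    Sent ident s (.receive x (.introduce v none)) x (.tempDelegate v)
  | linSelf (x v) (hx : (s.node x).mode = .staying) :
    Sent ident s (.receive x (.linearize v)) x (.tempDelegate v)
  | linPred (x v d w) (hx : (s.node x).mode = .staying) (hv : Beyond d (ident x) (ident v))
    (hw : pred ident d ((view ident s x).nbr d) v = some w) :
    Sent ident s (.receive x (.linearize v)) w (.tempDelegate v)
  | delegate (x v d w) (hv : Beyond d (ident x) (ident v))
    (hw : first ident d ((view ident s x).nbr d) = some w)
    (h : ¬ Beyond d (ident v) (ident w)) :
    Sent ident s (.receive x (.tempDelegate v)) w (.tempDelegate v)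
  | ack (x d v k) (hx : d = .right ∨ (s.node x).mode = .staying)
    (hv : v ∈ (view ident s x).nbr d ∪ (view ident s x).temp d)
    (hk : k = ((assignUnique ident (view ident s x)
      ((view ident s x).nbr d ∪ (view ident s x).temp d)).uniqueValue v).getD 0) :
    Sent ident s (.receive x (.revAndLinReq d)) v (.revAndLinAck x k)
  | rev (x v d k) (hx : (s.node x).mode = .leaving) (hv : Beyond d (ident x) (ident v)) :
    Sent ident s (.receive x (.revAndLinAck v k)) v (.revAndLin ((view ident s x).nbr d.opp) k)
  | ackDelegate (x v k) (hx : (s.node x).mode = .staying) :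
    Sent ident s (.receive x (.revAndLinAck v k)) x (.tempDelegate v)
  | revDelegate (x A k v) (hv : v ∈ A) :
    Sent ident s (.receive x (.revAndLin A k)) x (.tempDelegate v)
  | revIntro (x A k v d) (hv : matching (view ident s x) k = some v)
    (hd : Beyond d (ident x) (ident v)) (hx : (s.node x).mode = .leaving → d = .right) :
    Sent ident s (.receive x (.revAndLin A k)) v (.introduce x none)
  | probeDelegate (x source dest next n v) (hx : ident x = dest) (hv : v ∈ next) :
    Sent ident s (.receive x (.forwardProbe source dest next n)) x (.tempDelegate v)
  | probeSource (x source dest next n) :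
    Sent ident s (.receive x (.forwardProbe source dest next n)) x (.tempDelegate source)
  | probeSuccess (x source dest next n) (hx : (s.node x).mode = .staying) :
    Sent ident s (.receive x (.forwardProbe source dest next n)) source (.probeSuccess dest n x)
  | probeFail (x source dest next n) :
    Sent ident s (.receive x (.forwardProbe source dest next n)) source (.probeFail dest n)
  | probeBack (x source dest next n d z) (hd : Beyond d (ident x) dest)
    (hz : first ident d (probeNext ident x (view ident s x) d dest next) = some z)
    (h : Beyond d (ident z) (ident x)) :
    Sent ident s (.receive x (.forwardProbe source dest next n)) x (.tempDelegate z)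
  | probeForward (x source dest next n d z) (hd : Beyond d (ident x) dest)
    (hz : first ident d (probeNext ident x (view ident s x) d dest next) = some z) :
    Sent ident s (.receive x (.forwardProbe source dest next n)) z
      (.forwardProbe source dest (probeNext ident x (view ident s x) d dest next) n)
  | searchSend (x dest n v r) (hx : (s.node x).mode = .staying) :
    Sent ident s (.receive x (.probeSuccess dest n v)) v (.search r)
  | successDelegate (x dest n v) :
    Sent ident s (.receive x (.probeSuccess dest n v)) x (.tempDelegate v)

theorem sent_timeoutSide {s : State V I} {x y : V} {m : Message V I} {d : Dir}
    (hx : (s.node x).mode = .staying) (h : (y, m) ∈ timeoutSide ident x (view ident s x) d) :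
    Sent ident s (.timeout x) y m := by
  rw [timeoutSide, Multiset.mem_add, Multiset.mem_bind] at h
  rcases h with ⟨v, hv, h⟩ | h
  · split at h
    · simp at h
    · next w hw =>
      simp only [Multiset.mem_singleton, Prod.mk.injEq] at h
      obtain ⟨rfl, rfl⟩ := h
      exact .introFar x d v _ hx hv hw
  · split at h
    · simp at h
    · next w hw =>
      simp only [Multiset.mem_singleton, Prod.mk.injEq] at h
      obtain ⟨rfl, rfl⟩ := h
      exact .introNear x d _ hx hw

theorem sent_timeout {s : State V I} {x y : V} {m : Message V I}
    (h : (y, m) ∈ outbox ident s (.timeout x)) : Sent ident s (.timeout x) y m := by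
  rw [outbox] at h
  split at h
  · next hx =>
    rw [timeoutStaying, Multiset.mem_add, Multiset.mem_add, Multiset.mem_map] at h
    rcases h with ⟨dest, _, h⟩ | h | h
    · simp only [Prod.mk.injEq] at h
      obtain ⟨rfl, rfl⟩ := h
      exact .probeStart _ _ _ hx
    · exact sent_timeoutSide hx h
    · exact sent_timeoutSide hx h
  · next hx =>
    split_ifs at h with hn
    · simp only [timeoutExit, Multiset.mem_bind] at h
      obtain ⟨v, hv, w, hw, h⟩ := h
      simp only [Multiset.insert_eq_cons, Multiset.mem_cons, Multiset.mem_singleton,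
        Prod.mk.injEq] at h
      rcases h with ⟨rfl, rfl⟩ | ⟨rfl, rfl⟩
      · exact .exitIntro _ _ _ hx hn hv hw
      · exact .exitIntro _ _ _ hx hn hw hv
    · simp only [timeoutRequest, Multiset.mem_add, Multiset.mem_map, Prod.mk.injEq] at h
      rcases h with ⟨v, hv, rfl, rfl⟩ | ⟨v, hv, rfl, rfl⟩
      · exact .request x .left _ hx hn hv
      · exact .request x .right _ hx hn hv

theorem sent_receive {s : State V I} {x y : V} {m₀ m : Message V I}
    (h : (y, m) ∈ outbox ident s (.receive x m₀)) : Sent ident s (.receive x m₀) y m := by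
  rw [outbox] at h
  cases m₀ with
  | introduce v w =>
    simp only [onMessage, onIntroduce] at h
    split at h
    · next hv =>
      split at h
      · simp at h
      · simp only [Multiset.mem_singleton, Prod.mk.injEq] at h
        obtain ⟨rfl, rfl⟩ := h
        exact .introDelegate _ _ _
    · next d hd =>
      have hne := (dirOf_eq_some.mp hd).ne
      split at h
      · next hx =>
        split at h
        · simp only [Multiset.insert_eq_cons, Multiset.mem_cons, Multiset.mem_singleton,
            Prod.mk.injEq] at h
          rcases h with ⟨rfl, rfl⟩ | ⟨rfl, rfl⟩
          · exact .introLin _ _ _ hx hne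
          · exact .introDelegate _ _ _
        · simp only [Multiset.mem_singleton, Prod.mk.injEq] at h
          obtain ⟨rfl, rfl⟩ := h
          exact .introOne _ _ hx hne
      · simp at h
  | linearize v =>
    simp only [onMessage, onLinearize] at h
    split at h
    · next hx =>
      split at h
      · simp only [Multiset.mem_singleton, Prod.mk.injEq] at h
        obtain ⟨rfl, rfl⟩ := h
        exact .linSelf _ _ hx
      · next d hd =>
        split at h
        · simp only [Multiset.mem_singleton, Prod.mk.injEq] at h
          obtain ⟨rfl, rfl⟩ := h
          exact .linSelf _ _ hx
        · next w hw =>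
          simp only [Multiset.insert_eq_cons, Multiset.mem_cons, Multiset.mem_singleton,
            Prod.mk.injEq] at h
          rcases h with ⟨rfl, rfl⟩ | ⟨rfl, rfl⟩
          · exact .linSelf _ _ hx
          · exact .linPred _ _ d _ hx (dirOf_eq_some.mp hd) hw
    · split at h <;> simp at h
  | tempDelegate v =>
    simp only [onMessage, onTempDelegate] at h
    split at h
    · simp at h
    · next d hd =>
      split at h
      · simp at h
      · next w hw =>
        split_ifs at h with hb
        · simp at h
        · simp only [Multiset.mem_singleton, Prod.mk.injEq] at h
          obtain ⟨rfl, rfl⟩ := h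
          exact .delegate _ _ d _ (dirOf_eq_some.mp hd) hw hb
  | revAndLinReq d =>
    simp only [onMessage, onRevAndLinReq] at h
    split_ifs at h with hx
    · simp only [Multiset.mem_map, Prod.mk.injEq] at h
      obtain ⟨v, hv, rfl, rfl⟩ := h
      exact .ack _ d _ _ hx hv rfl
    · simp at h
  | revAndLinAck v k =>
    simp only [onMessage, onRevAndLinAck] at h
    split at h
    · simp at h
    · next d hd =>
      split at h
      · next hx =>
        simp only [Multiset.mem_singleton, Prod.mk.injEq] at h
        obtain ⟨rfl, rfl⟩ := h
        exact .rev _ _ d _ hx (dirOf_eq_some.mp hd)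
      · next hx =>
        simp only [Multiset.mem_singleton, Prod.mk.injEq] at h
        obtain ⟨rfl, rfl⟩ := h
        exact .ackDelegate _ _ _ hx
  | revAndLin A k =>
    have hdel : (y, m) ∈ A.val.map (fun u => (x, (.tempDelegate u : Message V I))) →
        Sent ident s (.receive x (.revAndLin A k)) y m := by
      intro h
      simp only [Multiset.mem_map, Prod.mk.injEq] at h
      obtain ⟨v, hv, rfl, rfl⟩ := h
      exact .revDelegate _ _ _ _ hv
    simp only [onMessage, onRevAndLin] at h
    split_ifs at h with hA
    · exact hdel h
    · split at h
      · exact hdel h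
      · next v hv =>
        split at h
        · exact hdel h
        · next d hd =>
          have hd := dirOf_eq_some.mp hd
          split at h
          · next hx =>
            simp only [Multiset.mem_singleton, Prod.mk.injEq] at h
            obtain ⟨rfl, rfl⟩ := h
            exact .revIntro _ _ _ _ _ hv hd fun h' => by simp_all
          · simp at h
          · simp only [Multiset.mem_singleton, Prod.mk.injEq] at h
            obtain ⟨rfl, rfl⟩ := h
            exact .revIntro _ _ _ _ _ hv hd fun _ => rfl
  | forwardProbe source dest next n =>
    simp only [onMessage, onForwardProbe] at h
    split at h
    · next hd =>
      simp only [Multiset.insert_eq_cons, Multiset.mem_add, Multiset.mem_map, Multiset.mem_cons,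
        Multiset.mem_singleton, Prod.mk.injEq] at h
      rcases h with ⟨v, hv, rfl, rfl⟩ | ⟨rfl, rfl⟩ | ⟨rfl, rfl⟩
      · exact .probeDelegate _ _ _ _ _ _ (dirOf_eq_none.mp hd) hv
      · split
        · next hx => exact .probeSuccess _ _ _ _ _ hx
        · exact .probeFail _ _ _ _ _
      · exact .probeSource _ _ _ _ _
    · next d hd =>
      have hd := dirOf_eq_some.mp hd
      split at h
      · simp only [Multiset.insert_eq_cons, Multiset.mem_cons, Multiset.mem_singleton,
            Prod.mk.injEq] at h
        rcases h with ⟨rfl, rfl⟩ | ⟨rfl, rfl⟩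
        · exact .probeFail _ _ _ _ _
        · exact .probeSource _ _ _ _ _
      · next z hz =>
        split_ifs at h with hb hb'
        · simp only [Multiset.insert_eq_cons, Multiset.mem_cons, Multiset.mem_singleton,
            Prod.mk.injEq] at h
          rcases h with ⟨rfl, rfl⟩ | ⟨rfl, rfl⟩
          · exact .probeBack _ _ _ _ _ d _ hd hz hb
          · exact .probeForward _ _ _ _ _ d _ hd hz
        · simp only [Multiset.mem_singleton, Prod.mk.injEq] at h
          obtain ⟨rfl, rfl⟩ := h
          exact .probeForward _ _ _ _ _ d _ hd hz
        · simp only [Multiset.mem_singleton, Prod.mk.injEq] at h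
          obtain ⟨rfl, rfl⟩ := h
          exact .probeForward _ _ _ _ _ d _ hd hz
  | probeSuccess dest n v =>
    simp only [onMessage, onProbeSuccess] at h
    split_ifs at h with hx
    · simp only [Multiset.mem_add, Multiset.mem_map, Multiset.mem_singleton, Prod.mk.injEq] at h
      rcases h with ⟨r, _, rfl, rfl⟩ | ⟨rfl, rfl⟩
      · exact .searchSend _ _ _ _ _ hx.1
      · exact .successDelegate _ _ _ _
    · simp only [Multiset.mem_singleton, Prod.mk.injEq] at h
      obtain ⟨rfl, rfl⟩ := h
      exact .successDelegate _ _ _ _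
  | probeFail dest n =>
    simp only [onMessage, onProbeFail] at h
    split_ifs at h <;> simp at h
  | search r => simp [onMessage] at h

/-- `Sent` is an upper bound only: guards that are never needed are omitted. This direction suffices
for all invariants, which are proved by cases on `Sent`. Where a message must really be sent,
membership in `outbox` is shown directly. -/
theorem sent_of_mem_outbox {s : State V I} {ev : Event V I} {y : V} {m : Message V I}
    (h : (y, m) ∈ outbox ident s ev) : Sent ident s ev y m := by
  cases ev with
  | timeout x => exact sent_timeout h
  | receive x m₀ => exact sent_receive h
  | initiateSearch => simp [outbox] at h
  | leave => simp [outbox] at h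
  | idle => simp [outbox] at h

/-! ### Changes of the stored references -/

theorem mem_stored_addNbr {L : LocalState V I} {d : Dir} {S : Finset V} {v : V} :
    v ∈ (L.addNbr d S).stored ↔ v ∈ L.stored ∨ v ∈ S := by
  cases d <;> simp [LocalState.stored, LocalState.addNbr] <;> tauto

theorem mem_stored_addTemp {L : LocalState V I} {d : Dir} {S : Finset V} {v : V} :
    v ∈ (L.addTemp d S).stored ↔ v ∈ L.stored ∨ v ∈ S := by
  cases d <;> simp [LocalState.stored, LocalState.addTemp] <;> tauto

theorem mem_stored_save {L : LocalState V I} {d : Dir} {u v : V} :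
    v ∈ (L.save d u).stored ↔ v ∈ L.stored ∨ v = u := by
  unfold LocalState.save
  split
  · simp [mem_stored_addNbr]
  · simp [mem_stored_addTemp]

theorem mem_of_mem_stored_removeNbr {L : LocalState V I} {d : Dir} {u v : V}
    (h : v ∈ (L.removeNbr d u).stored) : v ∈ L.stored := by
  cases d <;> simp [LocalState.stored, LocalState.removeNbr] at h ⊢ <;> tauto

theorem mem_stored_removeNbr {L : LocalState V I} {d : Dir} {u v : V}
    (h : v ∈ L.stored) (hv : v ≠ u) : v ∈ (L.removeNbr d u).stored := by
  cases d <;> simp [LocalState.stored, LocalState.removeNbr] at h ⊢ <;> tauto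

theorem mem_of_mem_stored_removeTemp {L : LocalState V I} {d : Dir} {u v : V}
    (h : v ∈ (L.removeTemp d u).stored) : v ∈ L.stored := by
  cases d <;> simp [LocalState.stored, LocalState.removeTemp] at h ⊢ <;> tauto

theorem mem_stored_removeTemp {L : LocalState V I} {d : Dir} {u v : V}
    (h : v ∈ L.stored) (hv : v ≠ u) : v ∈ (L.removeTemp d u).stored := by
  cases d <;> simp [LocalState.stored, LocalState.removeTemp] at h ⊢ <;> tauto

theorem matching_mem {L : LocalState V I} {k : ℕ} {v : V} (h : matching L k = some v) :
    v ∈ L.stored ∧ L.uniqueValue v = some k := by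
  unfold matching at h
  split_ifs at h with h'
  cases h
  exact h'.choose_spec

/-- `matching` picks an arbitrary witness; uniqueness of the value determines it. -/
theorem matching_eq {L : LocalState V I} {k : ℕ} {v : V} (hv : v ∈ L.stored)
    (hk : L.uniqueValue v = some k) (hu : ∀ w, L.uniqueValue w = some k → w = v) :
    matching L k = some v := by
  have h' : ∃ v ∈ L.stored, L.uniqueValue v = some k := ⟨v, hv, hk⟩
  unfold matching
  rw [dif_pos h']
  exact congrArg some (hu _ h'.choose_spec.2)

/-- `Gain ident x L m u`: processing `m` at `x` can make `x` store `u`. -/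
inductive Gain (ident : V → I) (x : V) (L : LocalState V I) : Message V I → V → Prop
  | introduce (v w) (hx : L.mode = .staying) : Gain ident x L (.introduce v (some w)) v
  | introduceLeaving (v w u) (hx : L.mode = .leaving) (hu : u = v ∨ w = some u) :
    Gain ident x L (.introduce v w) u
  | linearize (v) (hx : L.mode = .leaving) : Gain ident x L (.linearize v) v
  | tempDelegate (v d) (hd : Beyond d (ident x) (ident v))
    (h : ∀ w, first ident d (L.nbr d) = some w → Beyond d (ident v) (ident w)) :
    Gain ident x L (.tempDelegate v) v
  | ack (v k) (hx : L.mode = .leaving) : Gain ident x L (.revAndLinAck v k) v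
  | rev (A k u) (hu : u ∈ A) : Gain ident x L (.revAndLin A k) u
  | probe (source dest next n d z) (hd : Beyond d (ident x) dest)
    (hz : first ident d (probeNext ident x L d dest next) = some z) (h : z ∉ L.nbr d) :
    Gain ident x L (.forwardProbe source dest next n) z

theorem gain_of_mem_stored {x u : V} {L : LocalState V I} {m : Message V I}
    (h : u ∈ (onMessage ident x L m).1.stored) (hu : u ∉ L.stored) : Gain ident x L m u := by
  cases m with
  | introduce v w =>
    simp only [onMessage, onIntroduce] at h
    split at h
    · split at h <;> exact absurd h hu
    · split at h
      · next hx =>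
        split at h
        · rw [mem_stored_addNbr, Finset.mem_singleton] at h
          obtain rfl := h.resolve_left hu
          exact .introduce _ _ hx
        · exact absurd h hu
      · next hx =>
        rw [mem_stored_addTemp] at h
        have := (Finset.mem_sdiff.mp (h.resolve_left hu)).1
        rw [Finset.mem_insert, Option.mem_toFinset] at this
        exact .introduceLeaving _ _ _ hx this
  | linearize v =>
    simp only [onMessage, onLinearize] at h
    split at h
    · split at h
      · exact absurd h hu
      · split at h
        · exact absurd h hu
        · exact absurd (mem_of_mem_stored_removeNbr h) hu
    · next hx =>
      split at h
      · exact absurd h hu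
      · rw [mem_stored_addTemp, Finset.mem_singleton] at h
        obtain rfl := h.resolve_left hu
        exact .linearize _ hx
  | tempDelegate v =>
    simp only [onMessage, onTempDelegate] at h
    split at h
    · exact absurd h hu
    · next d hd =>
      have hd := dirOf_eq_some.mp hd
      split at h
      · next hn =>
        rw [mem_stored_save] at h
        obtain rfl := h.resolve_left hu
        exact .tempDelegate _ d hd fun w hw => by simp [hn] at hw
      · next z hz =>
        split_ifs at h with hb
        · rw [mem_stored_save] at h
          obtain rfl := h.resolve_left hu
          exact .tempDelegate _ d hd fun w hw => by rw [hz] at hw; cases hw; exact hb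
        · exact absurd h hu
  | revAndLinReq d =>
    simp only [onMessage, onRevAndLinReq] at h
    split_ifs at h
    · exact absurd h hu
    · exact absurd h hu
  | revAndLinAck v k =>
    simp only [onMessage, onRevAndLinAck] at h
    split at h
    · exact absurd h hu
    · split at h
      · next hx =>
        rw [mem_stored_addTemp, Finset.mem_singleton] at h
        obtain rfl := h.resolve_left hu
        exact .ack _ _ hx
      · exact absurd h hu
  | revAndLin A k =>
    simp only [onMessage, onRevAndLin] at h
    apply Gain.rev
    split_ifs at h
    · exact absurd h hu
    · split at h
      · exact absurd h hu
      · split at h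
        · exact absurd h hu
        · split at h
          · exact (mem_stored_addNbr.mp (mem_of_mem_stored_removeNbr h)).resolve_left hu
          · exact (mem_stored_addTemp.mp h).resolve_left hu
          · dsimp only at h
            split_ifs at h
            · exact (mem_stored_addNbr.mp (mem_of_mem_stored_removeNbr h)).resolve_left hu
            · exact (mem_stored_addTemp.mp (mem_of_mem_stored_removeTemp h)).resolve_left hu
  | forwardProbe source dest next n =>
    simp only [onMessage, onForwardProbe] at h
    split at h
    · exact absurd h hu
    · next d hd =>
      have hd := dirOf_eq_some.mp hd
      split at h
      · exact absurd h hu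
      · next z hz =>
        split_ifs at h with h₁ h₂
        · exact absurd h hu
        · exact absurd h hu
        · rw [mem_stored_save] at h
          obtain rfl := h.resolve_left hu
          exact .probe _ _ _ _ d _ hd hz h₂
  | probeSuccess dest n v =>
    simp only [onMessage, onProbeSuccess] at h
    split_ifs at h <;> exact absurd h hu
  | probeFail dest n =>
    simp only [onMessage, onProbeFail] at h
    split_ifs at h <;> exact absurd h hu
  | search r => exact absurd h hu

/-- `Lose ident x L m u`: processing `m` at `x` can make `x` drop `u`. -/
inductive Lose (ident : V → I) (x : V) (L : LocalState V I) : Message V I → V → Prop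
  | linearize (v d w) (hx : L.mode = .staying) (hv : Beyond d (ident x) (ident v))
    (hw : pred ident d (L.nbr d) v = some w) : Lose ident x L (.linearize v) v
  | rev (A k v d) (hk : matching L k = some v) (hd : Beyond d (ident x) (ident v))
    (hx : L.mode = .leaving → d = .right) : Lose ident x L (.revAndLin A k) v

theorem lose_of_notMem_stored {x u : V} {L : LocalState V I} {m : Message V I}
    (h : u ∉ (onMessage ident x L m).1.stored) (hu : u ∈ L.stored) : Lose ident x L m u := by
  cases m with
  | introduce v w =>
    simp only [onMessage, onIntroduce] at h
    split at h
    · split at h <;> exact absurd hu h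
    · split at h
      · split at h
        · exact absurd (mem_stored_addNbr.mpr (.inl hu)) h
        · exact absurd hu h
      · exact absurd (mem_stored_addTemp.mpr (.inl hu)) h
  | linearize v =>
    simp only [onMessage, onLinearize] at h
    split at h
    · next hx =>
      split at h
      · exact absurd hu h
      · next d hd =>
        split at h
        · exact absurd hu h
        · next w hw =>
          by_cases huv : u = v
          · subst huv
            exact .linearize _ d w hx (dirOf_eq_some.mp hd) hw
          · exact absurd (mem_stored_removeNbr hu huv) h
    · split at h
      · exact absurd hu h
      · exact absurd (mem_stored_addTemp.mpr (.inl hu)) h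
  | tempDelegate v =>
    simp only [onMessage, onTempDelegate] at h
    split at h
    · exact absurd hu h
    · split at h
      · exact absurd (mem_stored_save.mpr (.inl hu)) h
      · split_ifs at h
        · exact absurd (mem_stored_save.mpr (.inl hu)) h
        · exact absurd hu h
  | revAndLinReq d =>
    simp only [onMessage, onRevAndLinReq] at h
    split_ifs at h <;> exact absurd hu h
  | revAndLinAck v k =>
    simp only [onMessage, onRevAndLinAck] at h
    split at h
    · exact absurd hu h
    · split at h
      · exact absurd (mem_stored_addTemp.mpr (.inl hu)) h
      · exact absurd hu h
  | revAndLin A k =>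
    simp only [onMessage, onRevAndLin] at h
    split_ifs at h
    · exact absurd hu h
    · split at h
      · exact absurd hu h
      · next v hv =>
        split at h
        · exact absurd hu h
        · next d hd =>
          have hd := dirOf_eq_some.mp hd
          by_cases huv : u = v
          · subst huv
            refine .rev _ _ _ d hv hd fun hx => ?_
            -- A leaving node that matches a reference on its left only adds the list and removes
            -- nothing. Leaving nodes therefore keep their left references, on which the notion
            -- `Requested` is built.
            cases d
            · simp only [hx] at h
              exact absurd (mem_stored_addTemp.mpr (.inl hu)) h
            · rfl
          · exfalso
            split at h
            · exact h (mem_stored_removeNbr (mem_stored_addNbr.mpr (.inl hu)) huv)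
            · exact h (mem_stored_addTemp.mpr (.inl hu))
            · dsimp only at h
              split_ifs at h
              · exact h (mem_stored_removeNbr (mem_stored_addNbr.mpr (.inl hu)) huv)
              · exact h (mem_stored_removeTemp (mem_stored_addTemp.mpr (.inl hu)) huv)
  | forwardProbe source dest next n =>
    simp only [onMessage, onForwardProbe] at h
    split at h
    · exact absurd hu h
    · split at h
      · exact absurd hu h
      · split_ifs at h
        · exact absurd hu h
        · exact absurd hu h
        · exact absurd (mem_stored_save.mpr (.inl hu)) h
  | probeSuccess dest n v =>
    simp only [onMessage, onProbeSuccess] at h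
    split_ifs at h <;> exact absurd hu h
  | probeFail dest n =>
    simp only [onMessage, onProbeFail] at h
    split_ifs at h <;> exact absurd hu h
  | search r => exact absurd hu h

/-- Away from list-valued messages, the sets `nbr` of a leaving node do not grow. -/
theorem mem_nbr_of_leaving {x u : V} {L : LocalState V I} {m : Message V I} {d : Dir}
    (hx : L.mode = .leaving) (h : u ∈ (onMessage ident x L m).1.nbr d)
    (hm : ∀ A k, m = .revAndLin A k → u ∉ A) : u ∈ L.nbr d := by
  cases m with
  | introduce v w =>
    simp only [onMessage, onIntroduce, hx] at h
    split at h
    · split at h <;> exact h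
    · exact h
  | linearize v =>
    simp only [onMessage, onLinearize, hx] at h
    split at h <;> exact h
  | tempDelegate v =>
    simp only [onMessage, onTempDelegate, LocalState.save, hx] at h
    split at h
    · exact h
    · split at h
      · exact h
      · split_ifs at h <;> exact h
  | revAndLinReq d =>
    simp only [onMessage, onRevAndLinReq] at h
    split_ifs at h <;> exact h
  | revAndLinAck v k =>
    simp only [onMessage, onRevAndLinAck, hx] at h
    split at h <;> exact h
  | revAndLin A k =>
    have hA := hm A k rfl
    simp only [onMessage, onRevAndLin, hx] at h
    split_ifs at h
    · exact h
    · split at h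
      · exact h
      · split at h
        · exact h
        · next d' hd' =>
          cases d'
          · exact h
          · dsimp only at h
            split_ifs at h
            · cases d <;> simp_all [LocalState.addNbr, LocalState.removeNbr]
            · exact h
  | forwardProbe source dest next n =>
    simp only [onMessage, onForwardProbe, LocalState.save, hx] at h
    split at h
    · exact h
    · split at h
      · exact h
      · split_ifs at h <;> exact h
  | probeSuccess dest n v =>
    simp only [onMessage, onProbeSuccess] at h
    split_ifs at h <;> exact h
  | probeFail dest n =>
    simp only [onMessage, onProbeFail] at h
    split_ifs at h <;> exact h
  | search r => exact h

theorem onMessage_mode (x : V) (L : LocalState V I) (m : Message V I) :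
    (onMessage ident x L m).1.mode = L.mode := by
  have hs (d : Dir) (u : V) : (L.save d u).mode = L.mode := by
    unfold LocalState.save; split <;> rfl
  cases m with
  | introduce v w =>
    simp only [onMessage, onIntroduce]
    repeat' split
    all_goals rfl
  | linearize v =>
    simp only [onMessage, onLinearize]
    repeat' split
    all_goals rfl
  | tempDelegate v =>
    simp only [onMessage, onTempDelegate]
    repeat' split
    all_goals first | rfl | exact hs _ _
  | revAndLinReq d =>
    simp only [onMessage, onRevAndLinReq]
    split_ifs <;> rfl
  | revAndLinAck v k =>
    simp only [onMessage, onRevAndLinAck]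
    repeat' split
    all_goals rfl
  | revAndLin A k =>
    simp only [onMessage, onRevAndLin]
    repeat' split
    all_goals rfl
  | forwardProbe source dest next n =>
    simp only [onMessage, onForwardProbe]
    repeat' split
    all_goals first | rfl | exact hs _ _
  | probeSuccess dest n v =>
    simp only [onMessage, onProbeSuccess]
    split_ifs <;> rfl
  | probeFail dest n =>
    simp only [onMessage, onProbeFail]
    split_ifs <;> rfl
  | search r => rfl

/-! ### Unique values -/

/-- Only a request generates values. -/
theorem onMessage_values {x : V} {L : LocalState V I} {m : Message V I}
    (h : ∀ d, m ≠ .revAndLinReq d) :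
    (onMessage ident x L m).1.uniqueValue = L.uniqueValue ∧
      (onMessage ident x L m).1.counter = L.counter := by
  have hs (d : Dir) (u : V) : (L.save d u).uniqueValue = L.uniqueValue ∧
      (L.save d u).counter = L.counter := by
    unfold LocalState.save; split <;> exact ⟨rfl, rfl⟩
  cases m with
  | introduce v w =>
    simp only [onMessage, onIntroduce]
    repeat' split
    all_goals exact ⟨rfl, rfl⟩
  | linearize v =>
    simp only [onMessage, onLinearize]
    repeat' split
    all_goals exact ⟨rfl, rfl⟩
  | tempDelegate v =>
    simp only [onMessage, onTempDelegate]
    repeat' split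
    all_goals first | exact ⟨rfl, rfl⟩ | exact hs _ _
  | revAndLinReq d => exact absurd rfl (h d)
  | revAndLinAck v k =>
    simp only [onMessage, onRevAndLinAck]
    repeat' split
    all_goals exact ⟨rfl, rfl⟩
  | revAndLin A k =>
    simp only [onMessage, onRevAndLin]
    repeat' split
    all_goals exact ⟨rfl, rfl⟩
  | forwardProbe source dest next n =>
    simp only [onMessage, onForwardProbe]
    repeat' split
    all_goals first | exact ⟨rfl, rfl⟩ | exact hs _ _
  | probeSuccess dest n v =>
    simp only [onMessage, onProbeSuccess]
    split_ifs <;> exact ⟨rfl, rfl⟩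
  | probeFail dest n =>
    simp only [onMessage, onProbeFail]
    split_ifs <;> exact ⟨rfl, rfl⟩
  | search r => exact ⟨rfl, rfl⟩

/-- The value `k` was generated and can be attached to no other reference than `l`. -/
def KeyFor (L : LocalState V I) (l : V) (k : ℕ) : Prop :=
  k ≤ L.counter ∧ ∀ z, L.uniqueValue z = some k → z = l

theorem sanitize_value {x z : V} {L : LocalState V I} {k : ℕ}
    (h : (sanitize ident x L).uniqueValue z = some k) :
    L.uniqueValue z = some k ∧ z ∈ L.stored ∧ z ≠ x ∧
      ∀ w ∈ L.stored, w ≠ x → L.uniqueValue w = some k → w = z := by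
  simp only [sanitize] at h
  split_ifs at h with h'
  exact ⟨h, h'.1, h'.2.1, fun w hw hx hk => h'.2.2 w hw hx (hk.trans h.symm)⟩

theorem sanitize_value_injective {x z w : V} {L : LocalState V I} {k : ℕ}
    (hz : (sanitize ident x L).uniqueValue z = some k)
    (hw : (sanitize ident x L).uniqueValue w = some k) : w = z := by
  obtain ⟨_, h₁, h₂, _⟩ := sanitize_value hw
  exact (sanitize_value hz).2.2.2 w h₁ h₂ (sanitize_value hw).1

/-- The sanity check discards a value that several references share, and `KeyFor` excludes just
this. -/
theorem sanitize_value_keep {x l : V} {L : LocalState V I} {k : ℕ}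
    (h : KeyFor L l k) (hl : l ∈ L.stored) (hx : l ≠ x) (hk : L.uniqueValue l = some k) :
    (sanitize ident x L).uniqueValue l = some k := by
  simp only [sanitize]
  rw [if_pos ⟨hl, hx, fun w _ _ hw => h.2 w (hw.trans hk)⟩, hk]

theorem KeyFor.sanitize {x l : V} {L : LocalState V I} {k : ℕ} (h : KeyFor L l k) :
    KeyFor (sanitize ident x L) l k :=
  ⟨h.1, fun z hz => h.2 z (sanitize_value hz).1⟩

/-- The two strict bounds separate a new value from all previous ones; the explicit formula at the
end serves to separate new values from each other. -/
theorem assignUnique_value {L : LocalState V I} {T : Finset V} {z : V} {k : ℕ}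
    (h : (assignUnique ident L T).uniqueValue z = some k) :
    L.uniqueValue z = some k ∨ (z ∈ T ∧ L.uniqueValue z = none ∧ L.counter < k ∧
      (∀ v ∈ L.stored, ∀ j, L.uniqueValue v = some j → j < k) ∧
      k = max L.counter (L.stored.sup fun v => (L.uniqueValue v).getD 0) + 1 +
        ((T.filter fun v => L.uniqueValue v = none).filter fun w => ident w < ident z).card) := by
  simp only [assignUnique] at h
  split_ifs at h with h'
  · right
    rw [Finset.mem_filter] at h'
    have h := (Option.some.inj h).symm
    refine ⟨h'.1, h'.2, ?_, fun v hv j hj => ?_, h⟩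
    · have := le_max_left L.counter (L.stored.sup fun v => (L.uniqueValue v).getD 0)
      omega
    · have h₁ := Finset.le_sup (f := fun v => (L.uniqueValue v).getD 0) hv
      have h₂ := le_max_right L.counter (L.stored.sup fun v => (L.uniqueValue v).getD 0)
      simp only [hj, Option.getD_some] at h₁
      omega
  · exact .inl h

theorem counter_le_assignUnique (L : LocalState V I) (T : Finset V) :
    L.counter ≤ (assignUnique ident L T).counter :=
  (le_max_left _ _).trans (Nat.le_add_right _ _)

/-- Fresh values exceed the counter, while `k` does not, so `k` is never generated again. -/
theorem KeyFor.assignUnique {l : V} {L : LocalState V I} {k : ℕ} {T : Finset V}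
    (h : KeyFor L l k) : KeyFor (assignUnique ident L T) l k :=
  ⟨h.1.trans (counter_le_assignUnique L T), fun z hz => by
    rcases assignUnique_value hz with h' | h'
    · exact h.2 z h'
    · exact absurd h.1 (not_le.mpr h'.2.2.1)⟩

theorem assignUnique_keep {l : V} {L : LocalState V I} {k : ℕ} {T : Finset V}
    (h : L.uniqueValue l = some k) : (assignUnique ident L T).uniqueValue l = some k := by
  simp [BuildListStar.assignUnique, h]

theorem exists_assignUnique_value {l : V} {L : LocalState V I} {T : Finset V} (h : l ∈ T) :
    ∃ k, (assignUnique ident L T).uniqueValue l = some k := by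
  cases hl : L.uniqueValue l with
  | some k => exact ⟨k, assignUnique_keep hl⟩
  | none =>
    simp only [assignUnique]
    rw [if_pos (Finset.mem_filter.mpr ⟨h, hl⟩)]
    exact ⟨_, rfl⟩

/-- After the sanity check and the assignment of new values, every value in use identifies its
reference. -/
theorem keyFor_assignUnique (hi : Function.Injective ident) {x l : V} {L : LocalState V I}
    {T : Finset V} {k : ℕ}
    (h : (assignUnique ident (sanitize ident x L) T).uniqueValue l = some k) :
    KeyFor (assignUnique ident (sanitize ident x L) T) l k := by
  have hst : ∀ {z j}, (sanitize ident x L).uniqueValue z = some j →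
      z ∈ (sanitize ident x L).stored := fun hz =>
    (sanitize_stored hi).mpr ⟨(sanitize_value hz).2.1, (sanitize_value hz).2.2.1⟩
  set L' := sanitize ident x L
  constructor
  · rcases assignUnique_value h with h' | ⟨hT, hn, _, _, hk⟩
    · have h₁ := Finset.le_sup (f := fun v => (L'.uniqueValue v).getD 0) (hst h')
      simp only [h', Option.getD_some] at h₁
      exact h₁.trans ((le_max_right _ _).trans (Nat.le_add_right _ _))
    -- The rank of `l` does not count `l` itself, so `base + 1 + rank` is still at most the new
    -- counter.
    · have : ((T.filter fun v => L'.uniqueValue v = none).filter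
          fun w => ident w < ident l).card < (T.filter fun v => L'.uniqueValue v = none).card :=
        Finset.card_lt_card <| (Finset.filter_ssubset (s := _)).mpr
          ⟨l, Finset.mem_filter.mpr ⟨hT, hn⟩, lt_irrefl _⟩
      simp only [assignUnique]
      omega
  · intro z hz
    rcases assignUnique_value h with h' | ⟨hT, hn, hc, hlt, hk⟩ <;>
      rcases assignUnique_value hz with hz' | ⟨hT', hn', hc', hlt', hk'⟩
    · exact sanitize_value_injective h' hz'
    · exact absurd (hlt' _ (hst h') _ h') (lt_irrefl _)
    · exact absurd (hlt _ (hst hz') _ hz') (lt_irrefl _)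
    · by_contra hne
      -- The rank among the nodes without a value is strictly increasing in the identifier; `a` is
      -- counted for `b` but not for itself.
      have key : ∀ a b : V, L'.uniqueValue a = none → a ∈ T → ident a < ident b →
          ((T.filter fun v => L'.uniqueValue v = none).filter fun w => ident w < ident a).card <
          ((T.filter fun v => L'.uniqueValue v = none).filter fun w => ident w < ident b).card := by
        intro a b ha haT hab
        apply Finset.card_lt_card
        rw [Finset.ssubset_iff_of_subset]
        · exact ⟨a, by simp [ha, haT, hab], by simp⟩
        · intro w hw
          simp only [Finset.mem_filter] at hw ⊢
          exact ⟨hw.1, hw.2.trans hab⟩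
      rcases (hi.ne hne).lt_or_gt with hlt | hlt
      · have := key z l hn' hT' hlt
        omega
      · have := key l z hn hT hlt
        omega

theorem KeyFor.onMessage {x l : V} {L : LocalState V I} {k : ℕ} {m : Message V I}
    (h : KeyFor L l k) : KeyFor (onMessage ident x L m).1 l k := by
  by_cases hm : ∃ d, m = .revAndLinReq d
  · obtain ⟨d, rfl⟩ := hm
    simp only [BuildListStar.onMessage, onRevAndLinReq]
    split_ifs
    · exact h.assignUnique
    · exact h
  · obtain ⟨h₁, h₂⟩ := onMessage_values (ident := ident) (x := x) (L := L)
      (fun d hd => hm ⟨d, hd⟩)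
    unfold KeyFor
    rw [h₁, h₂]
    exact h

theorem onMessage_keep_value {x l : V} {L : LocalState V I} {k : ℕ} {m : Message V I}
    (h : L.uniqueValue l = some k) : (onMessage ident x L m).1.uniqueValue l = some k := by
  by_cases hm : ∃ d, m = .revAndLinReq d
  · obtain ⟨d, rfl⟩ := hm
    simp only [BuildListStar.onMessage, onRevAndLinReq]
    split_ifs
    · exact assignUnique_keep h
    · exact h
  · rw [(onMessage_values (ident := ident) (x := x) (L := L) (fun d hd => hm ⟨d, hd⟩)).1, h]

/-! ### The effect of a step -/

/-- The node that executes a step. -/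
def Event.actor : Event V I → Option V
  | .timeout x => some x
  | .receive x _ => some x
  | .initiateSearch x _ => some x
  | .leave x => some x
  | .idle => none

/-- The step executes `exit`. -/
def IsExit (s : State V I) (ev : Event V I) : Prop :=
  ∃ x, ev = .timeout x ∧ (s.node x).mode = .leaving ∧ NIDEC s x

/-- The variables of the executing node after a step that is not an `exit`. -/
def after (ident : V → I) (s : State V I) (x : V) : Event V I → LocalState V I
  | .timeout _ => view ident s x
  | .receive _ m => (onMessage ident x (view ident s x) m).1
  | .initiateSearch _ dest => onInitiateSearch ident x (view ident s x) dest
  | .leave _ => { view ident s x with mode := .leaving }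
  | .idle => s.node x

/-- The channel contents that are there before the messages of the step arrive. -/
def residue (s : State V I) : Event V I → V → Multiset (Message V I)
  | .receive x m => Function.update s.ch x ((s.ch x).erase m)
  | _ => s.ch

/-- The effect of a step that is not an `exit`. -/
theorem exec_eq {s : State V I} {ev : Event V I} (h : ¬ IsExit s ev) :
    exec ident s ev =
      { node := fun v => if ev.actor = some v then after ident s v ev else s.node v
        ch := fun v => residue s ev v +
          ((outbox ident s ev).filter fun p => p.1 = v).map Prod.snd
        gone := s.gone } := by
  have hup : ∀ (x : V) (L : LocalState V I) (L' : V → LocalState V I), L' x = L →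
      Function.update s.node x L = fun v => if some x = some v then L' v else s.node v := by
    rintro x _ L' rfl
    funext v
    by_cases hv : v = x
    · subst hv; simp
    · simp [Function.update_of_ne hv, Ne.symm hv]
  cases ev with
  | timeout x =>
    cases hx : (s.node x).mode with
    | staying =>
      simp only [exec, outbox, residue, Event.actor, sanitize_mode, hx, commit, after, State.mk.injEq,
        and_true]
      exact hup x _ _ rfl
    | leaving =>
      have hn : ¬ NIDEC s x := fun hn => h ⟨x, rfl, hx, hn⟩
      simp only [exec, outbox, residue, Event.actor, sanitize_mode, hx, commit, after, hn, if_false,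
        State.mk.injEq, and_true]
      exact hup x _ _ rfl
  | receive x m =>
    simp only [exec, outbox, residue, Event.actor, commit, after, State.mk.injEq, and_true]
    exact hup x _ _ rfl
  | initiateSearch x dest =>
    simp only [exec, outbox, residue, Event.actor, commit, after, State.mk.injEq, and_true]
    exact hup x _ _ rfl
  | leave x =>
    simp only [exec, outbox, residue, Event.actor, commit, after, State.mk.injEq, and_true]
    exact hup x _ _ rfl
  | idle => simp [exec, outbox, residue, Event.actor]

theorem exec_exit {s : State V I} {x : V} (hx : (s.node x).mode = .leaving) (hn : NIDEC s x) :
    exec ident s (.timeout x) =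
      { node := Function.update s.node x
          { view ident s x with
            nbr := fun _ => ∅, temp := fun _ => ∅, uniqueValue := fun _ => none, waiting := 0 }
        ch := Function.update (fun v => s.ch v +
          ((timeoutExit (view ident s x)).filter fun p => p.1 = v).map Prod.snd) x 0
        gone := fun v => v = x ∨ s.gone v } := by
  simp only [exec, sanitize_mode, hx, hn, if_true, exitNode, commit, Function.update_self,
    Function.update_idem]

theorem mem_filter_map_snd {M : Multiset (V × Message V I)} {y : V} {m : Message V I} :
    m ∈ (M.filter fun p => p.1 = y).map Prod.snd ↔ (y, m) ∈ M := by
  simp only [Multiset.mem_map, Multiset.mem_filter]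
  constructor
  · rintro ⟨⟨a, b⟩, ⟨h, rfl⟩, rfl⟩; exact h
  · intro h; exact ⟨_, ⟨h, rfl⟩, rfl⟩

theorem mem_ch_exec {s : State V I} {ev : Event V I} (h : ¬ IsExit s ev) {y : V}
    {m : Message V I} : m ∈ (exec ident s ev).ch y ↔
      m ∈ residue s ev y ∨ (y, m) ∈ outbox ident s ev := by
  rw [exec_eq h]
  simp only [Multiset.mem_add, mem_filter_map_snd]

theorem residue_le (s : State V I) (ev : Event V I) (y : V) : residue s ev y ≤ s.ch y := by
  cases ev with
  | receive x m =>
    by_cases hy : y = x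
    · subst hy
      simp only [residue, Function.update_self]
      exact Multiset.erase_le _ _
    · simp [residue, Function.update_of_ne hy]
  | _ => exact le_rfl

/-- A receipt removes one copy of one message only. -/
theorem mem_residue {s : State V I} {ev : Event V I} {y : V} {m : Message V I}
    (h : m ∈ s.ch y) (hne : ev ≠ .receive y m) : m ∈ residue s ev y := by
  cases ev with
  | receive x m' =>
    by_cases hy : y = x
    · subst hy
      simp only [residue, Function.update_self]
      exact (Multiset.mem_erase_of_ne (fun h => hne (by subst h; rfl))).mpr h
    · simpa [residue, Function.update_of_ne hy] using h
  | _ => exact h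

theorem exec_node_of_ne {s : State V I} {ev : Event V I} {v : V} (h : ev.actor ≠ some v) :
    (exec ident s ev).node v = s.node v := by
  by_cases hE : IsExit s ev
  · obtain ⟨x, rfl, hx, hn⟩ := hE
    rw [exec_exit hx hn]
    exact Function.update_of_ne (fun hv : v = x => h (by rw [hv]; rfl)) _ _
  · rw [exec_eq hE]; simp [h]

theorem exec_node_actor {s : State V I} {ev : Event V I} {v : V} (hE : ¬ IsExit s ev)
    (h : ev.actor = some v) : (exec ident s ev).node v = after ident s v ev := by
  rw [exec_eq hE]; simp [h]

theorem after_mode {s : State V I} {x : V} {ev : Event V I} (h : ev ≠ .leave x)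
    (ha : ev.actor = some x) : (after ident s x ev).mode = (s.node x).mode := by
  cases ev with
  | receive y m => exact onMessage_mode _ _ _
  | initiateSearch y dest =>
    simp only [after, onInitiateSearch]
    split
    · rfl
    · split_ifs <;> rfl
  | leave y => cases ha; exact absurd rfl h
  | _ => rfl

theorem exec_mode {s : State V I} {x : V} {ev : Event V I} (h : ev ≠ .leave x) :
    ((exec ident s ev).node x).mode = (s.node x).mode := by
  by_cases ha : ev.actor = some x
  · by_cases hE : IsExit s ev
    · obtain ⟨y, rfl, hx, hn⟩ := hE
      cases ha
      rw [exec_exit hx hn]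
      simp
    · rw [exec_node_actor hE ha, after_mode h ha]
  · rw [exec_node_of_ne ha]

theorem exec_mode_leaving {s : State V I} {x : V} {ev : Event V I}
    (h : (s.node x).mode = .leaving) : ((exec ident s ev).node x).mode = .leaving := by
  by_cases hl : ev = .leave x
  · subst hl
    rw [exec_node_actor (by rintro ⟨_, h, _⟩; cases h) rfl]
    rfl
  · rw [exec_mode hl, h]

/-- The references carried by the message that a step receives. -/
def Event.refs : Event V I → Set V
  | .receive _ m => m.refs
  | _ => ∅

theorem onInitiateSearch_nbr {x : V} {L : LocalState V I} {dest : I} :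
    (onInitiateSearch ident x L dest).nbr = L.nbr ∧
      (onInitiateSearch ident x L dest).temp = L.temp ∧
      (onInitiateSearch ident x L dest).uniqueValue = L.uniqueValue ∧
      (onInitiateSearch ident x L dest).counter = L.counter := by
  simp only [onInitiateSearch]
  split
  · exact ⟨rfl, rfl, rfl, rfl⟩
  · split_ifs <;> exact ⟨rfl, rfl, rfl, rfl⟩

theorem Gain.mem_refs {x u : V} {L : LocalState V I} {m : Message V I}
    (h : Gain ident x L m u) : u ∈ m.refs := by
  cases h with
  | introduce => exact .inl rfl
  | introduceLeaving v w u hx hu => exact hu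
  | linearize => rfl
  | tempDelegate => rfl
  | ack => rfl
  | rev A k u hu => exact hu
  | probe source dest next n d z hd hz h =>
    have := first_mem hz
    rw [probeNext, Finset.mem_union, Finset.mem_erase, Finset.mem_filter] at this
    exact .inr (this.resolve_right fun h' => h h'.1).2

theorem view_nbr_beyond {s : State V I} {x v : V} {d : Dir} (h : v ∈ (view ident s x).nbr d) :
    Beyond d (ident x) (ident v) := sanitize_nbr_beyond h

theorem mem_view_stored (hi : Function.Injective ident) {s : State V I} {x v : V} :
    v ∈ (view ident s x).stored ↔ v ∈ (s.node x).stored ∧ v ≠ x := sanitize_stored hi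

theorem mem_after_stored_of_ne_receive (hi : Function.Injective ident) {s : State V I} {x u : V}
    {ev : Event V I} (ha : ev.actor = some x) (hr : ∀ m, ev ≠ .receive x m) :
    u ∈ (after ident s x ev).stored ↔ u ∈ (s.node x).stored ∧ u ≠ x := by
  rw [← mem_view_stored hi]
  cases ev with
  | timeout y => rfl
  | receive y m => cases ha; exact absurd rfl (hr m)
  | initiateSearch y dest =>
    obtain ⟨h₁, h₂, _⟩ :=
      onInitiateSearch_nbr (ident := ident) (x := x) (L := view ident s x) (dest := dest)
    simp only [after, LocalState.stored, h₁, h₂]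
  | leave y => rfl
  | idle => cases ha

/-- A node that stores a new reference has just received it. -/
theorem gain_of_mem_exec (hi : Function.Injective ident) {s : State V I} {x u : V}
    {ev : Event V I} (h : u ∈ ((exec ident s ev).node x).stored) (hu : u ∉ (s.node x).stored) :
    ∃ m, ev = .receive x m ∧ Gain ident x (view ident s x) m u := by
  by_cases ha : ev.actor = some x
  · by_cases hE : IsExit s ev
    · obtain ⟨y, rfl, hx, hn⟩ := hE
      cases ha
      rw [exec_exit hx hn] at h
      simp [LocalState.stored] at h
    · rw [exec_node_actor hE ha] at h
      by_cases hr : ∃ m, ev = .receive x m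
      · obtain ⟨m, rfl⟩ := hr
        exact ⟨m, rfl, gain_of_mem_stored h fun h' => hu ((mem_view_stored hi).mp h').1⟩
      · exact absurd
          ((mem_after_stored_of_ne_receive hi ha fun m h => hr ⟨m, h⟩).mp h).1 hu
  · rw [exec_node_of_ne ha] at h
    exact absurd h hu

theorem mem_refs_of_mem_exec (hi : Function.Injective ident) {s : State V I} {x u : V}
    {ev : Event V I} (h : u ∈ ((exec ident s ev).node x).stored) :
    u ∈ (s.node x).stored ∨ (ev.actor = some x ∧ u ∈ ev.refs) := by
  by_contra hc
  push Not at hc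
  obtain ⟨m, rfl, hg⟩ := gain_of_mem_exec hi h hc.1
  exact hc.2 rfl hg.mem_refs

/-- The exclusions are needed because an exit clears the memory and the sanity check drops
self-references; apart from these, references are lost only through `Linearize` and `RevAndLin`. -/
theorem lose_of_notMem_exec (hi : Function.Injective ident) {s : State V I} {x u : V}
    {ev : Event V I} (hE : ¬ IsExit s ev) (hux : u ≠ x)
    (h : u ∉ ((exec ident s ev).node x).stored) (hu : u ∈ (s.node x).stored) :
    ∃ m, ev = .receive x m ∧ Lose ident x (view ident s x) m u := by
  by_cases ha : ev.actor = some x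
  · rw [exec_node_actor hE ha] at h
    by_cases hr : ∃ m, ev = .receive x m
    · obtain ⟨m, rfl⟩ := hr
      exact ⟨m, rfl, lose_of_notMem_stored h ((mem_view_stored hi).mpr ⟨hu, hux⟩)⟩
    · exact absurd ((mem_after_stored_of_ne_receive hi ha fun m h => hr ⟨m, h⟩).mpr ⟨hu, hux⟩) h
  · rw [exec_node_of_ne ha] at h
    exact absurd hu h

/-- This includes exits, which discard the values but do not reset the counter. -/
theorem KeyFor.exec {s : State V I} {x l : V} {k : ℕ} {ev : Event V I}
    (h : KeyFor (s.node x) l k) : KeyFor ((exec ident s ev).node x) l k := by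
  by_cases ha : ev.actor = some x
  · by_cases hE : IsExit s ev
    · obtain ⟨y, rfl, hx, hn⟩ := hE
      cases ha
      rw [exec_exit hx hn]
      simp only [Function.update_self]
      exact ⟨h.1, fun z hz => by simp at hz⟩
    · rw [exec_node_actor hE ha]
      cases ev with
      | timeout y => exact h.sanitize
      | receive y m => exact h.sanitize.onMessage
      | initiateSearch y dest =>
        obtain ⟨_, _, h₁, h₂⟩ :=
          onInitiateSearch_nbr (ident := ident) (x := x) (L := view ident s x) (dest := dest)
        have := h.sanitize (ident := ident) (x := x)
        unfold KeyFor at this ⊢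
        simp only [after, h₁, h₂]
        exact this
      | leave y => exact h.sanitize (ident := ident)
      | idle => cases ha
  · rwa [exec_node_of_ne ha]

theorem exec_keep_value {s : State V I} {x l : V} {k : ℕ} {ev : Event V I} (hE : ¬ IsExit s ev)
    (h : KeyFor (s.node x) l k) (hl : l ∈ (s.node x).stored) (hx : l ≠ x)
    (hk : (s.node x).uniqueValue l = some k) :
    ((exec ident s ev).node x).uniqueValue l = some k := by
  by_cases ha : ev.actor = some x
  · rw [exec_node_actor hE ha]
    have hv : (view ident s x).uniqueValue l = some k := sanitize_value_keep h hl hx hk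
    cases ev with
    | timeout y => exact hv
    | receive y m => exact onMessage_keep_value hv
    | initiateSearch y dest =>
      obtain ⟨_, _, h₁, h₂⟩ :=
        onInitiateSearch_nbr (ident := ident) (x := x) (L := view ident s x) (dest := dest)
      simp only [after, h₁]
      exact hv
    | leave y => exact hv
    | idle => cases ha
  · rwa [exec_node_of_ne ha]

/-! ### Safety -/

/-- The edges that the outcome `o` of an action of `x` creates or keeps. -/
def Link (x : V) (o : Outcome V I) (a b : V) : Prop :=
  (a = x ∧ b ∈ o.1.stored) ∨ ∃ m, (a, m) ∈ o.2 ∧ b ∈ m.refs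

theorem link_of_stored {x b : V} {o : Outcome V I} (h : b ∈ o.1.stored) :
    Relation.EqvGen (Link x o) x b := .rel _ _ (.inl ⟨rfl, h⟩)

theorem link_of_sent {x a b : V} {o : Outcome V I} (m : Message V I) (h : (a, m) ∈ o.2)
    (hb : b ∈ m.refs) : Relation.EqvGen (Link x o) a b := .rel _ _ (.inr ⟨m, h, hb⟩)

/-- An action keeps its node connected to every reference that it stores or receives. -/
theorem onMessage_connected (hi : Function.Injective ident) {x b : V} {L : LocalState V I}
    {m : Message V I} (hb : b ∈ L.stored ∨ b ∈ m.refs) :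
    b = x ∨ Relation.EqvGen (Link x (onMessage ident x L m)) x b := by
  have hself : ∀ {v}, dirOf (ident x) (ident v) = none → v = x := fun h =>
    (hi (dirOf_eq_none.mp h)).symm
  cases m with
  | introduce v w =>
    have hv : ∀ {u : V}, u ∈ (Message.introduce v w : Message V I).refs → u = v ∨ w = some u := id
    simp only [onMessage, onIntroduce]
    split
    · next hd =>
      split
      · rcases hb with hb | hb
        · exact .inr (link_of_stored hb)
        · obtain rfl := (hv hb).resolve_right (by simp)
          exact .inl (hself hd)
      · next w =>
        rcases hb with hb | hb
        · exact .inr (link_of_stored hb)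
        · rcases hv hb with rfl | h
          · exact .inl (hself hd)
          · cases h
            exact .inr (link_of_sent (.tempDelegate _) (by simp) rfl)
    · next d hd =>
      split
      · split
        · rcases hb with hb | hb
          · exact .inr (link_of_stored (mem_stored_addNbr.mpr (.inl hb)))
          · rcases hv hb with rfl | h
            · exact .inr (link_of_stored (mem_stored_addNbr.mpr (.inr (Finset.mem_singleton_self _))))
            · cases h
              exact .inr (link_of_sent (.tempDelegate _) (by simp) rfl)
        · rcases hb with hb | hb
          · exact .inr (link_of_stored hb)
          · obtain rfl := (hv hb).resolve_right (by simp)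
            exact .inr (link_of_sent (.tempDelegate _) (by simp) rfl)
      · refine .inr (link_of_stored (mem_stored_addTemp.mpr ?_))
        rcases hb with hb | hb
        · exact .inl hb
        · by_cases hd : b ∈ L.nbr d
          · exact .inl (mem_stored_of_nbr hd)
          · refine .inr (Finset.mem_sdiff.mpr ⟨?_, hd⟩)
            rw [Finset.mem_insert, Option.mem_toFinset]
            exact hv hb
  | linearize v =>
    have hv : ∀ {u : V}, u ∈ (Message.linearize v : Message V I).refs → u = v := id
    simp only [onMessage, onLinearize]
    split
    · split
      · rcases hb with hb | hb
        · exact .inr (link_of_stored hb)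
        · obtain rfl := hv hb
          exact .inr (link_of_sent (.tempDelegate _) (by simp) rfl)
      · split
        · rcases hb with hb | hb
          · exact .inr (link_of_stored hb)
          · obtain rfl := hv hb
            exact .inr (link_of_sent (.tempDelegate _) (by simp) rfl)
        · by_cases hbv : b = v
          · subst hbv
            exact .inr (link_of_sent (.tempDelegate _) (by simp) rfl)
          · exact .inr (link_of_stored (mem_stored_removeNbr (hb.resolve_right fun h => hbv (hv h)) hbv))
    · split
      · next hd =>
        rcases hb with hb | hb
        · exact .inr (link_of_stored hb)
        · obtain rfl := hv hb
          exact .inl (hself hd)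
      · refine .inr (link_of_stored (mem_stored_addTemp.mpr ?_))
        rw [Finset.mem_singleton]
        exact hb.imp_right hv
  | tempDelegate v =>
    have hv : ∀ {u : V}, u ∈ (Message.tempDelegate v : Message V I).refs → u = v := id
    simp only [onMessage, onTempDelegate]
    split
    · next hd =>
      rcases hb with hb | hb
      · exact .inr (link_of_stored hb)
      · obtain rfl := hv hb
        exact .inl (hself hd)
    · split
      · exact .inr (link_of_stored (mem_stored_save.mpr (hb.imp_right hv)))
      · next w hw =>
        split_ifs
        · exact .inr (link_of_stored (mem_stored_save.mpr (hb.imp_right hv)))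
        · rcases hb with hb | hb
          · exact .inr (link_of_stored hb)
          · obtain rfl := hv hb
            exact .inr (.trans _ w _ (link_of_stored (mem_stored_of_nbr (first_mem hw)))
              (link_of_sent (.tempDelegate _) (by simp) rfl))
  | revAndLinReq d =>
    have hb := hb.resolve_right id
    simp only [onMessage, onRevAndLinReq]
    split_ifs <;> exact .inr (link_of_stored hb)
  | revAndLinAck v k =>
    have hv : ∀ {u : V}, u ∈ (Message.revAndLinAck v k : Message V I).refs → u = v := id
    simp only [onMessage, onRevAndLinAck]
    split
    · next hd =>
      rcases hb with hb | hb
      · exact .inr (link_of_stored hb)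
      · obtain rfl := hv hb
        exact .inl (hself hd)
    · split
      · refine .inr (link_of_stored (mem_stored_addTemp.mpr ?_))
        rw [Finset.mem_singleton]
        exact hb.imp_right hv
      · rcases hb with hb | hb
        · exact .inr (link_of_stored hb)
        · obtain rfl := hv hb
          exact .inr (link_of_sent (.tempDelegate _) (by simp) rfl)
  | revAndLin A k =>
    have hv : ∀ {u : V}, u ∈ (Message.revAndLin A k : Message V I).refs → u ∈ A := id
    have hdel : b = x ∨ Relation.EqvGen
        (Link x (L, A.val.map fun u => (x, (.tempDelegate u : Message V I)))) x b := by
      rcases hb with hb | hb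
      · exact .inr (link_of_stored hb)
      · exact .inr (link_of_sent (.tempDelegate b) (Multiset.mem_map.mpr ⟨b, hv hb, rfl⟩) rfl)
    simp only [onMessage, onRevAndLin]
    split_ifs
    · exact hdel
    · split
      · exact hdel
      · next v _ =>
        split
        · exact hdel
        · split
          · by_cases hbv : b = v
            · subst hbv
              exact .inr (.symm _ _ (link_of_sent (.introduce x none) (by simp) (.inl rfl)))
            · exact .inr (link_of_stored (mem_stored_removeNbr
                (mem_stored_addNbr.mpr (hb.imp_right hv)) hbv))
          · exact .inr (link_of_stored (mem_stored_addTemp.mpr (hb.imp_right hv)))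
          · by_cases hbv : b = v
            · subst hbv
              exact .inr (.symm _ _ (link_of_sent (.introduce x none) (by simp) (.inl rfl)))
            · refine .inr (link_of_stored ?_)
              dsimp only
              split_ifs
              · exact mem_stored_removeNbr (mem_stored_addNbr.mpr (hb.imp_right hv)) hbv
              · exact mem_stored_removeTemp (mem_stored_addTemp.mpr (hb.imp_right hv)) hbv
  | forwardProbe source dest next n =>
    have hv : ∀ {u : V}, u ∈ (Message.forwardProbe source dest next n : Message V I).refs →
      u = source ∨ u ∈ next := id
    simp only [onMessage, onForwardProbe]
    split
    · rcases hb with hb | hb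
      · exact .inr (link_of_stored hb)
      · rcases hv hb with rfl | h
        · exact .inr (link_of_sent (.tempDelegate b) (by simp) rfl)
        · exact .inr (link_of_sent (.tempDelegate b)
            (Multiset.mem_add.mpr (.inl (Multiset.mem_map.mpr ⟨b, h, rfl⟩))) rfl)
    · next d _ =>
      split
      · next hn =>
        rcases hb with hb | hb
        · exact .inr (link_of_stored hb)
        · rcases hv hb with rfl | h
          · exact .inr (link_of_sent (.tempDelegate b) (by simp) rfl)
          · refine .inl (by_contra fun hbx => ?_)
            have := first_eq_none hn
            exact Finset.notMem_empty b
              (this ▸ Finset.mem_union_left _ (Finset.mem_erase.mpr ⟨hbx, h⟩))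
      · next z hz =>
        -- In all three forwarding cases the next hop `z` remains linked to `x`, by a self-addressed
        -- delegation, by an old reference or by a new one; the forwarded probe then links `z` to
        -- everything that the probe carries.
        have hfwd : ∀ o : Outcome V I, Relation.EqvGen (Link x o) x z → L.stored ⊆ o.1.stored →
            (z, .forwardProbe source dest (probeNext ident x L d dest next) n) ∈ o.2 →
            b = x ∨ Relation.EqvGen (Link x o) x b := by
          intro o hxz hL ho
          rcases hb with hb | hb
          · exact .inr (link_of_stored (hL hb))
          · rcases hv hb with rfl | h
            · exact .inr (.trans _ _ _ hxz (link_of_sent _ ho (.inl rfl)))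
            · by_cases hbx : b = x
              · exact .inl hbx
              · exact .inr (.trans _ _ _ hxz (link_of_sent _ ho
                  (.inr (Finset.mem_union_left _ (Finset.mem_erase.mpr ⟨hbx, h⟩)))))
        split_ifs with h₁ h₂
        · exact hfwd _ (link_of_sent (.tempDelegate z) (by simp) rfl) (Finset.Subset.refl _)
            (by simp [probeNext])
        · exact hfwd _ (link_of_stored (mem_stored_of_nbr h₂)) (Finset.Subset.refl _)
            (by simp [probeNext])
        · exact hfwd _ (link_of_stored (mem_stored_save.mpr (.inr rfl)))
            (fun v hv => mem_stored_save.mpr (.inl hv)) (by simp [probeNext])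
  | probeSuccess dest n v =>
    have hv : ∀ {u : V}, u ∈ (Message.probeSuccess dest n v : Message V I).refs → u = v := id
    simp only [onMessage, onProbeSuccess]
    split_ifs
    · rcases hb with hb | hb
      · exact .inr (link_of_stored hb)
      · obtain rfl := hv hb
        exact .inr (link_of_sent (.tempDelegate b) (by simp) rfl)
    · rcases hb with hb | hb
      · exact .inr (link_of_stored hb)
      · obtain rfl := hv hb
        exact .inr (link_of_sent (.tempDelegate b) (by simp) rfl)
  | probeFail dest n =>
    have hb := hb.resolve_right id
    simp only [onMessage, onProbeFail]
    split_ifs <;> exact .inr (link_of_stored hb)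
  | search r =>
    have hb := hb.resolve_right id
    exact .inr (link_of_stored hb)

/-- The nodes that the executing node `x` knows when it executes the step `ev`. -/
def Known (s : State V I) (ev : Event V I) (x b : V) : Prop :=
  b = x ∨ b ∈ (s.node x).stored ∨ b ∈ ev.refs

theorem known_of_nbr (hi : Function.Injective ident) {s : State V I} {ev : Event V I} {x v : V}
    {d : Dir} (h : v ∈ (view ident s x).nbr d) : Known s ev x v :=
  .inr (.inl ((mem_view_stored hi).mp (mem_stored_of_nbr h)).1)

theorem known_of_probeNext (hi : Function.Injective ident) {s : State V I} {x v source : V}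
    {dest : I} {next : Finset V} {n : ℕ} {d : Dir}
    (h : v ∈ probeNext ident x (view ident s x) d dest next) :
    Known s (.receive x (.forwardProbe source dest next n)) x v := by
  rw [probeNext, Finset.mem_union, Finset.mem_erase, Finset.mem_filter] at h
  rcases h with h | h
  · exact .inr (.inr (.inr h.2))
  · exact known_of_nbr hi h.1

/-- Messages go to known nodes and carry references of known nodes only. -/
theorem Sent.known (hi : Function.Injective ident) {s : State V I} {ev : Event V I} {y : V}
    {m : Message V I} (h : Sent ident s ev y m) :
    ∃ x, ev.actor = some x ∧ Known s ev x y ∧ ∀ b ∈ m.refs, Known s ev x b := by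
  have hst : ∀ {x v : V}, v ∈ (view ident s x).stored → Known s ev x v := fun h =>
    .inr (.inl ((mem_view_stored hi).mp h).1)
  cases h with
  | probeStart x dest n hx =>
    refine ⟨_, rfl, .inl rfl, ?_⟩
    rintro b (rfl | h)
    exacts [.inl rfl, .inl (Finset.mem_singleton.mp h)]
  | introFar x d v w hx hv hw =>
    refine ⟨_, rfl, known_of_nbr hi (pred_mem hw), ?_⟩
    rintro b (rfl | h)
    exacts [known_of_nbr hi hv, .inl (Option.some.inj h).symm]
  | introNear x d w hx hw =>
    refine ⟨_, rfl, known_of_nbr hi (first_mem hw), ?_⟩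
    rintro b (rfl | h)
    exacts [.inl rfl, by cases h]
  | exitIntro x v w hx hn hv hw =>
    refine ⟨_, rfl, hst hv, ?_⟩
    rintro b (rfl | h)
    exacts [hst hw, by cases h]
  | request x d v hx hn hv =>
    exact ⟨_, rfl, .inr (.inl (sanitize_side.mp hv).1), fun b h => h.elim⟩
  | introLin x v w hx hv =>
    exact ⟨_, rfl, .inr (.inr (.inr rfl)), fun b h => .inr (.inr (.inl h))⟩
  | introDelegate x v w => exact ⟨_, rfl, .inl rfl, fun b h => .inr (.inr (.inr (congrArg some h.symm)))⟩
  | introOne x v hx hv => exact ⟨_, rfl, .inl rfl, fun b h => .inr (.inr (.inl h))⟩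
  | linSelf x v hx => exact ⟨_, rfl, .inl rfl, fun b h => .inr (.inr h)⟩
  | linPred x v d w hx hv hw =>
    exact ⟨_, rfl, known_of_nbr hi (pred_mem hw), fun b h => .inr (.inr h)⟩
  | delegate x v d w hv hw h =>
    exact ⟨_, rfl, known_of_nbr hi (first_mem hw), fun b h => .inr (.inr h)⟩
  | ack x d v k hx hv hk =>
    exact ⟨_, rfl, .inr (.inl (sanitize_side.mp hv).1), fun b h => .inl h⟩
  | rev x v d k hx hv =>
    exact ⟨_, rfl, .inr (.inr rfl), fun b h => known_of_nbr hi h⟩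
  | ackDelegate x v k hx => exact ⟨_, rfl, .inl rfl, fun b h => .inr (.inr h)⟩
  | revDelegate x A k v hv =>
    exact ⟨_, rfl, .inl rfl, fun b h => .inr (.inr (by obtain rfl : b = v := h; exact hv))⟩
  | revIntro x A k v d hv hd hx =>
    refine ⟨_, rfl, hst (matching_mem hv).1, ?_⟩
    rintro b (rfl | h)
    exacts [.inl rfl, by cases h]
  | probeDelegate x source dest next n v hx hv =>
    exact ⟨_, rfl, .inl rfl, fun b h => .inr (.inr (.inr (by obtain rfl : b = v := h; exact hv)))⟩
  | probeSource x source dest next n =>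
    exact ⟨_, rfl, .inl rfl, fun b h => .inr (.inr (.inl h))⟩
  | probeSuccess x source dest next n hx =>
    exact ⟨_, rfl, .inr (.inr (.inl rfl)), fun b h => .inl h⟩
  | probeFail x source dest next n =>
    exact ⟨_, rfl, .inr (.inr (.inl rfl)), fun b h => h.elim⟩
  | probeBack x source dest next n d z hd hz h =>
    refine ⟨_, rfl, .inl rfl, fun b h => ?_⟩
    obtain rfl : b = z := h
    exact known_of_probeNext hi (first_mem hz)
  | probeForward x source dest next n d z hd hz =>
    refine ⟨_, rfl, known_of_probeNext hi (first_mem hz), ?_⟩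
    rintro b (rfl | h)
    exacts [.inr (.inr (.inl rfl)), known_of_probeNext hi h]
  | searchSend x dest n v r hx => exact ⟨_, rfl, .inr (.inr rfl), fun b h => h.elim⟩
  | successDelegate x dest n v => exact ⟨_, rfl, .inl rfl, fun b h => .inr (.inr h)⟩

/-- Gone nodes have no references and nobody has references of them. -/
def Live (s : State V I) : Prop := ∀ a b, Edge s a b → ¬ s.gone a ∧ ¬ s.gone b

/-- No edge touches a gone node, so the restriction to present nodes can be dropped and connectivity
studied for plain `Edge`. -/
theorem Live.sameComponent {s : State V I} (h : Live s) :
    SameComponent s = Relation.EqvGen (Edge s) := by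
  have : (fun x y => ¬ s.gone x ∧ ¬ s.gone y ∧ Edge s x y) = Edge s := by
    funext x y
    exact propext ⟨fun h => h.2.2, fun h' => ⟨(h x y h').1, (h x y h').2, h'⟩⟩
  unfold SameComponent
  rw [this]

theorem Known.eq_or_edge {s : State V I} {ev : Event V I} {x b : V} (hE : Enabled s ev)
    (ha : ev.actor = some x) (h : Known s ev x b) : b = x ∨ Edge s x b := by
  rcases h with h | h | h
  · exact .inl h
  · exact .inr (.inl h)
  · cases ev with
    | receive y m => cases ha; exact .inr (.inr ⟨m, hE.2, h⟩)
    | _ => exact h.elim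

theorem Known.connected {s : State V I} {ev : Event V I} {x b : V} (hE : Enabled s ev)
    (ha : ev.actor = some x) (h : Known s ev x b) : Relation.EqvGen (Edge s) x b := by
  rcases h.eq_or_edge hE ha with rfl | h
  · exact .refl _
  · exact .rel _ _ h

theorem Enabled.not_gone {s : State V I} {ev : Event V I} {x : V} (hE : Enabled s ev)
    (ha : ev.actor = some x) : ¬ s.gone x := by
  cases ev with
  | idle => cases ha
  | receive => cases ha; exact hE.1
  | leave => cases ha; exact hE.1
  | timeout => cases ha; exact hE
  | initiateSearch => cases ha; exact hE

/-- Every edge is old or joins nodes that the executing node knows. -/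
theorem edge_exec (hi : Function.Injective ident) {s : State V I} {ev : Event V I}
    (hx : ¬ IsExit s ev) {a b : V} (h : Edge (exec ident s ev) a b) :
    Edge s a b ∨ ∃ x, ev.actor = some x ∧ Known s ev x a ∧ Known s ev x b := by
  rcases h with h | ⟨m, hm, hb⟩
  · rcases mem_refs_of_mem_exec hi h with h | ⟨ha, hb⟩
    · exact .inl (.inl h)
    · exact .inr ⟨a, ha, .inl rfl, .inr (.inr hb)⟩
  · rcases (mem_ch_exec hx).mp hm with hm | hm
    · exact .inl (.inr ⟨m, Multiset.mem_of_le (residue_le _ _ _) hm, hb⟩)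
    · obtain ⟨x, ha, hy, hr⟩ := (sent_of_mem_outbox hm).known hi
      exact .inr ⟨x, ha, hy, hr b hb⟩

theorem exec_gone {s : State V I} {ev : Event V I} (hx : ¬ IsExit s ev) :
    (exec ident s ev).gone = s.gone := by rw [exec_eq hx]

theorem eqvGen_of_forall {α : Type*} {r p : α → α → Prop} {a b : α}
    (h : ∀ a b, r a b → Relation.EqvGen p a b) (hab : Relation.EqvGen r a b) :
    Relation.EqvGen p a b := by
  induction hab with
  | rel a b hab => exact h a b hab
  | refl => exact .refl _
  | symm _ _ _ ih => exact .symm _ _ ih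
  | trans _ _ _ _ _ ih ih' => exact .trans _ _ _ ih ih'

/-- For a receipt, the links of the outcome are edges of the new state; every other action leaves
the stored references in place, up to self-references. -/
theorem exec_actor_connected (hi : Function.Injective ident) {s : State V I} {ev : Event V I}
    (hx : ¬ IsExit s ev) {x b : V} (ha : ev.actor = some x)
    (hb : b ∈ (s.node x).stored ∨ b ∈ ev.refs) :
    Relation.EqvGen (Edge (exec ident s ev)) x b := by
  by_cases hbx : b = x
  · rw [hbx]; exact .refl _
  by_cases hr : ∃ m, ev = .receive x m
  · obtain ⟨m, rfl⟩ := hr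
    have hb' : b ∈ (view ident s x).stored ∨ b ∈ m.refs :=
      hb.imp_left fun h => (mem_view_stored hi).mpr ⟨h, hbx⟩
    refine eqvGen_of_forall ?_ ((onMessage_connected hi hb').resolve_left hbx)
    rintro a c (⟨rfl, h⟩ | ⟨m', h, hc⟩) <;> apply Relation.EqvGen.rel
    · left
      rw [exec_node_actor hx rfl]
      exact h
    · exact .inr ⟨m', (mem_ch_exec hx).mpr (.inr h), hc⟩
  · have hb := hb.resolve_right fun h => by
      cases ev with
      | receive y m => cases ha; exact hr ⟨m, rfl⟩
      | _ => exact h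
    refine .rel _ _ (.inl ?_)
    rw [exec_node_actor hx ha]
    exact (mem_after_stored_of_ne_receive hi ha fun m h => hr ⟨m, h⟩).mpr ⟨hb, hbx⟩

theorem edge_connected_exec (hi : Function.Injective ident) {s : State V I} {ev : Event V I}
    (hx : ¬ IsExit s ev) {a b : V} (h : Edge s a b) :
    Relation.EqvGen (Edge (exec ident s ev)) a b := by
  rcases h with h | ⟨m, hm, hb⟩
  · by_cases ha : ev.actor = some a
    · exact exec_actor_connected hi hx ha (.inl h)
    · refine .rel _ _ (.inl ?_)
      rwa [exec_node_of_ne ha]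
  · by_cases he : ev = .receive a m
    · subst he
      exact exec_actor_connected hi hx rfl (.inr hb)
    · exact .rel _ _ (.inr ⟨m, (mem_ch_exec hx).mpr (.inl (mem_residue hm he)), hb⟩)

theorem mem_timeoutExit {L : LocalState V I} {y : V} {m : Message V I} :
    (y, m) ∈ timeoutExit L ↔ ∃ w ∈ L.stored, y ∈ L.stored ∧ m = .introduce w none := by
  simp only [timeoutExit, Multiset.mem_bind, Multiset.insert_eq_cons, Multiset.mem_cons,
    Multiset.mem_singleton, Prod.mk.injEq]
  constructor
  · rintro ⟨v, hv, w, hw, ⟨rfl, rfl⟩ | ⟨rfl, rfl⟩⟩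
    exacts [⟨w, hw, hv, rfl⟩, ⟨v, hv, hw, rfl⟩]
  · rintro ⟨w, hw, hy, rfl⟩
    exact ⟨y, hy, w, hw, .inl ⟨rfl, rfl⟩⟩

/-- The parting introductions make the neighborhood of the exiting node a clique, and the edges
going out from that node disappear. -/
theorem edge_exec_exit (hi : Function.Injective ident) {s : State V I} {x a b : V}
    (hx : (s.node x).mode = .leaving) (hn : NIDEC s x) :
    Edge (exec ident s (.timeout x)) a b ↔ a ≠ x ∧
      (Edge s a b ∨ (a ∈ (s.node x).stored ∧ b ∈ (s.node x).stored ∧ b ≠ x)) := by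
  rw [exec_exit hx hn]
  by_cases ha : a = x
  · subst ha
    simp [Edge, LocalState.stored]
  · simp only [Edge, ne_eq, ha, not_false_eq_true, Function.update_of_ne, true_and,
      Multiset.mem_add, mem_filter_map_snd, mem_timeoutExit, mem_view_stored hi]
    constructor
    · rintro (h | ⟨m, h | ⟨w, hw, ha', rfl⟩, hb⟩)
      · exact .inl (.inl h)
      · exact .inl (.inr ⟨m, h, hb⟩)
      · rcases hb with rfl | hb
        · exact .inr ⟨ha'.1, hw⟩
        · cases hb
    · rintro ((h | ⟨m, h, hb⟩) | ⟨h, hb⟩)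
      · exact .inl h
      · exact .inr ⟨m, .inl h, hb⟩
      · exact .inr ⟨_, .inr ⟨b, hb, ⟨h, trivial⟩, rfl⟩, .inl rfl⟩

theorem Live.exec (hi : Function.Injective ident) {s : State V I} {ev : Event V I}
    (h : Live s) (hE : Enabled s ev) : Live (exec ident s ev) := by
  intro a b hab
  by_cases hx : IsExit s ev
  · obtain ⟨x, rfl, hx, hn⟩ := hx
    obtain ⟨ha, hab'⟩ := (edge_exec_exit hi hx hn).mp hab
    clear hab
    rw [exec_exit hx hn]
    have hb : b ≠ x := by
      rcases hab' with hab | hab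
      · rintro rfl; exact hn.1 a ha hab
      · exact hab.2.2
    simp only [ha, hb, false_or]
    rcases hab' with hab | hab
    · exact h a b hab
    · exact ⟨(h x a (.inl hab.1)).2, (h x b (.inl hab.2.1)).2⟩
  · rw [exec_gone hx]
    rcases edge_exec hi hx hab with hab | ⟨x, hact, ha, hb⟩
    · exact h a b hab
    · have key : ∀ {c}, Known s ev x c → ¬ s.gone c := fun hc => by
        rcases hc.eq_or_edge hE hact with rfl | hc
        · exact hE.not_gone hact
        · exact (h _ _ hc).2
      exact ⟨key ha, key hb⟩

/-- A step neither disconnects nor merges components, as far as present nodes are concerned. -/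
theorem connected_exec_iff (hi : Function.Injective ident) {s : State V I} {ev : Event V I}
    (hE : Enabled s ev) {a b : V} (ha : ¬ (exec ident s ev).gone a)
    (hb : ¬ (exec ident s ev).gone b) :
    Relation.EqvGen (Edge (exec ident s ev)) a b ↔ Relation.EqvGen (Edge s) a b := by
  by_cases hx : IsExit s ev
  · obtain ⟨x, rfl, hx, hn⟩ := hx
    have hax : a ≠ x := fun h => ha (by rw [exec_exit hx hn]; exact .inl h)
    have hbx : b ≠ x := fun h => hb (by rw [exec_exit hx hn]; exact .inl h)
    constructor
    · refine eqvGen_of_forall fun c d h => ?_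
      obtain ⟨-, h | ⟨hc, hd, -⟩⟩ := (edge_exec_exit hi hx hn).mp h
      · exact .rel _ _ h
      · exact .trans _ _ _ (.symm _ _ (.rel _ _ (.inl hc))) (.rel x d (.inl hd))
    · -- a stored reference of the exiting node takes its place
      obtain ⟨z, hz⟩ : ∃ z, ∀ y, y ∈ (s.node x).stored → y ≠ x →
          z ∈ (s.node x).stored ∧ z ≠ x := by
        by_cases h : ∃ z, z ∈ (s.node x).stored ∧ z ≠ x
        · exact ⟨h.choose, fun _ _ _ => h.choose_spec⟩
        -- Without a neighbor other than itself the exiting node has nothing to pass on, and the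
        -- value of `z` is irrelevant.
        · exact ⟨x, fun y hy hyx => absurd ⟨y, hy, hyx⟩ h⟩
      intro h
      -- Collapsing `x` onto `z` sends old edges to paths: an edge from `x` to `d` becomes a clique
      -- edge from `z` to `d`, edges into `x` from other nodes do not exist by the oracle, and the
      -- remaining ones persist.
      have key : Relation.EqvGen (Edge (BuildListStar.exec ident s (.timeout x)))
          (if a = x then z else a) (if b = x then z else b) := by
        clear ha hb hax hbx
        induction h with
        | rel c d h =>
          by_cases hc : c = x
          · subst hc
            by_cases hd : d = c
            · subst hd; simp only [if_true]; exact .refl _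
            · simp only [if_true, hd, if_false]
              have hd' : d ∈ (s.node c).stored := by
                rcases h with h | ⟨m, hm, _⟩
                · exact h
                · rw [hn.2] at hm; simp at hm
              have hz := hz d hd' hd
              exact .rel _ _ ((edge_exec_exit hi hx hn).mpr ⟨hz.2, .inr ⟨hz.1, hd', hd⟩⟩)
          · have hd : d ≠ x := fun hd => hn.1 c hc (hd ▸ h)
            simp only [hc, hd, if_false]
            exact .rel _ _ ((edge_exec_exit hi hx hn).mpr ⟨hc, .inl h⟩)
        | refl => exact .refl _
        | symm _ _ _ ih => exact .symm _ _ ih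
        | trans _ _ _ _ _ ih ih' => exact .trans _ _ _ ih ih'
      simpa only [hax, hbx, if_false] using key
  · constructor
    · refine eqvGen_of_forall fun c d h => ?_
      rcases edge_exec hi hx h with h | ⟨x, hact, hc, hd⟩
      · exact .rel _ _ h
      · exact .trans _ _ _ (.symm _ _ (hc.connected hE hact)) (hd.connected hE hact)
    · exact eqvGen_of_forall fun c d => edge_connected_exec hi hx

theorem gone_exec {s : State V I} {ev : Event V I} {u : V} (h : s.gone u) :
    (exec ident s ev).gone u := by
  by_cases hx : IsExit s ev
  · obtain ⟨x, rfl, hx, hn⟩ := hx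
    rw [exec_exit hx hn]
    exact .inr h
  · rwa [exec_gone hx]

/-! ### Safety and monotonicity along a computation. -/

section Computation

variable {c : ℕ → State V I} {e : ℕ → Event V I}

theorem IsComputation.live (hi : Function.Injective ident) (hc : IsComputation ident c e)
    (h : Live (c 0)) (t : ℕ) : Live (c t) := by
  induction t with
  | zero => exact h
  | succ t ih => rw [hc.step]; exact ih.exec hi (hc.enabled t)

theorem IsComputation.gone_mono (hc : IsComputation ident c e) {t t' : ℕ} (h : t ≤ t') {u : V}
    (hu : (c t).gone u) : (c t').gone u := by
  induction h with
  | refl => exact hu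
  | step _ ih => rw [hc.step]; exact gone_exec ih

theorem IsComputation.leaving_mono (hc : IsComputation ident c e) {t t' : ℕ} (h : t ≤ t') {u : V}
    (hu : ((c t).node u).mode = .leaving) : ((c t').node u).mode = .leaving := by
  induction h with
  | refl => exact hu
  | step _ ih => rw [hc.step]; exact exec_mode_leaving ih

theorem IsComputation.safety (hi : Function.Injective ident) (hc : IsComputation ident c e)
    (h : Live (c 0)) (t : ℕ) {u v : V} (hu : ¬ (c t).gone u) (hv : ¬ (c t).gone v) :
    SameComponent (c t) u v ↔ SameComponent (c 0) u v := by
  rw [(hc.live hi h t).sameComponent, h.sameComponent]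
  induction t with
  | zero => rfl
  | succ t ih =>
    rw [hc.step] at hu hv ⊢
    rw [connected_exec_iff hi (hc.enabled t) hu hv]
    exact ih (fun h => hu (gone_exec h)) fun h => hv (gone_exec h)

theorem IsComputation.leaving_of_gone (hc : IsComputation ident c e) (h : IsInitial (c 0)) (t : ℕ)
    {u : V} (hu : (c t).gone u) : ((c t).node u).mode = .leaving := by
  induction t with
  | zero => exact absurd hu (h u)
  | succ t ih =>
    rw [hc.step] at hu ⊢
    by_cases hx : IsExit (c t) (e t)
    · obtain ⟨x, he, hx, hn⟩ := hx
      rw [he, exec_exit hx hn] at hu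
      rcases hu with rfl | hu
      · exact exec_mode_leaving hx
      · exact exec_mode_leaving (ih hu)
    · rw [exec_gone hx] at hu
      exact exec_mode_leaving (ih hu)

end Computation

/-! ### Computations without leave steps and exits -/

/-- A computation in which modes and the set of gone nodes do not change any more. -/
structure Regime (ident : V → I) (c : ℕ → State V I) (e : ℕ → Event V I) : Prop where
  inj : Function.Injective ident
  comp : IsComputation ident c e
  mode : ∀ t u, ((c t).node u).mode = ((c 0).node u).mode
  gone : ∀ t u, (c t).gone u ↔ (c 0).gone u
  live : ∀ t, Live (c t)
  present : ∀ u, ((c 0).node u).mode = .staying → ¬ (c 0).gone u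

namespace Regime

variable {c : ℕ → State V I} {e : ℕ → Event V I}

/-- An exit would enlarge the set of gone nodes, which is constant here. -/
theorem not_exit (h : Regime ident c e) (t : ℕ) : ¬ IsExit (c t) (e t) := by
  rintro ⟨x, he, hx, hn⟩
  have h₁ : (c (t + 1)).gone x := by
    rw [h.comp.step, he, exec_exit hx hn]; exact .inl rfl
  have h₂ := h.comp.enabled t
  rw [he] at h₂
  exact h₂ ((h.gone t x).mpr ((h.gone _ x).mp h₁))

theorem mem_ch_succ (h : Regime ident c e) {t : ℕ} {y : V} {m : Message V I}
    (hm : m ∈ (c (t + 1)).ch y) : m ∈ (c t).ch y ∨ Sent ident (c t) (e t) y m := by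
  rw [h.comp.step] at hm
  rcases (mem_ch_exec (h.not_exit t)).mp hm with hm | hm
  · exact .inl (Multiset.mem_of_le (residue_le _ _ _) hm)
  · exact .inr (sent_of_mem_outbox hm)

theorem mem_ch_of_outbox (h : Regime ident c e) {t : ℕ} {y : V} {m : Message V I}
    (hm : (y, m) ∈ outbox ident (c t) (e t)) : m ∈ (c (t + 1)).ch y := by
  rw [h.comp.step]
  exact (mem_ch_exec (h.not_exit t)).mpr (.inr hm)

/-- A message that is sent at time `t` is received at some later time. -/
theorem exists_receive (h : Regime ident c e) {t : ℕ} {y : V} {m : Message V I}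
    (hm : (y, m) ∈ outbox ident (c t) (e t)) : ∃ j > t, e j = .receive y m := by
  obtain ⟨j, hj, he⟩ := h.comp.receipt_fair _ _ _ (h.mem_ch_of_outbox hm)
  exact ⟨j, hj, he⟩

theorem mem_ch (h : Regime ident c e) {t : ℕ} {y : V} {m : Message V I}
    (he : e t = .receive y m) : m ∈ (c t).ch y := by
  have := h.comp.enabled t
  rw [he] at this
  exact this.2

theorem exists_timeout (h : Regime ident c e) {x : V} (hx : ¬ (c 0).gone x) (t : ℕ) :
    ∃ j ≥ t, e j = .timeout x :=
  h.comp.timeout_fair x ⟨0, fun i _ hi => hx ((h.gone i x).mp hi)⟩ t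

theorem node_actor (h : Regime ident c e) {t : ℕ} {x : V} (ha : (e t).actor = some x) :
    (c (t + 1)).node x = after ident (c t) x (e t) := by
  rw [h.comp.step, exec_node_actor (h.not_exit t) ha]

theorem count_ch_succ (h : Regime ident c e) {t : ℕ} {y : V} {m : Message V I}
    (hm : (y, m) ∉ outbox ident (c t) (e t)) :
    ((c (t + 1)).ch y).count m = (residue (c t) (e t) y).count m := by
  rw [h.comp.step, exec_eq (h.not_exit t), Multiset.count_add]
  rw [Multiset.count_eq_zero_of_notMem (fun hm' => hm (mem_filter_map_snd.mp hm')), add_zero]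

/-- A message that is no longer sent disappears. -/
theorem eventually_notMem (h : Regime ident c e) {t₀ : ℕ} {y : V} {m : Message V I}
    (hm : ∀ t ≥ t₀, (y, m) ∉ outbox ident (c t) (e t)) : ∀ᶠ t in atTop, m ∉ (c t).ch y := by
  have hle : ∀ t ≥ t₀, ((c (t + 1)).ch y).count m ≤ ((c t).ch y).count m := fun t ht => by
    rw [h.count_ch_succ (hm t ht)]
    exact Multiset.count_le_of_le _ (residue_le _ _ _)
  -- Channels are multisets, so one receipt need not exhaust `m`. The induction is on the number of
  -- copies, which never grows after `t₀` and drops at each receipt of `m`.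
  have key : ∀ n t, t₀ ≤ t → ((c t).ch y).count m = n → ∃ t', t₀ ≤ t' ∧ m ∉ (c t').ch y := by
    intro n
    induction n using Nat.strong_induction_on with
    | _ n ih =>
      intro t ht hn
      by_cases hmem : m ∈ (c t).ch y
      · obtain ⟨j, hj, he⟩ := h.comp.receipt_fair t y m hmem
        have hanti : ∀ t' ≥ t, ((c t').ch y).count m ≤ n := fun t' ht' => by
          induction t', ht' using Nat.le_induction with
          | base => exact hn.le
          | succ t' ht' ih' => exact (hle t' (ht.trans ht')).trans ih'
        have hlt : ((c (j + 1)).ch y).count m < n := by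
          rw [h.count_ch_succ (hm j (ht.trans hj)), he]
          simp only [residue, Function.update_self, Multiset.count_erase_self]
          have h₁ := Multiset.count_pos.mpr (h.mem_ch he)
          have h₂ := hanti j hj
          omega
        exact ih _ hlt (j + 1) (by omega) rfl
      · exact ⟨t, ht, hmem⟩
  obtain ⟨t', ht', hmem⟩ := key _ t₀ le_rfl rfl
  filter_upwards [eventually_ge_atTop t'] with t ht
  induction t, ht using Nat.le_induction with
  | base => exact hmem
  | succ t ht ih =>
    have := hle t (ht'.trans ht)
    rw [Multiset.count_eq_zero_of_notMem ih] at this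
    exact Multiset.count_eq_zero.mp (Nat.le_zero.mp this)

/-- If from some time on only good messages are sent, and good messages stay good, then from some
time on all messages in channels are good. -/
theorem eventually_good [Finite V] (h : Regime ident c e) (G : ℕ → V → Message V I → Prop)
    (hsend : ∀ᶠ t in atTop, ∀ y m, Sent ident (c t) (e t) y m → m ∈ (c (t + 1)).ch y →
      G (t + 1) y m)
    (hG : ∀ t y m, G t y m → G (t + 1) y m) :
    ∀ᶠ t in atTop, ∀ y, ∀ m ∈ (c t).ch y, G t y m := by
  obtain ⟨t₀, ht₀⟩ := eventually_atTop.mp hsend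
  have hG' : ∀ y m t t', t ≤ t' → G t y m → G t' y m := fun y m t t' ht hg => by
    induction t', ht using Nat.le_induction with
    | base => exact hg
    | succ t' _ ih => exact hG _ _ _ ih
  have hpair : ∀ y m, ∀ᶠ t in atTop, m ∈ (c t).ch y → G t y m := by
    intro y m
    -- A single later sending certifies `m` as good forever, older copies included; if there is
    -- none, `m` dies out.
    by_cases hs : ∃ t ≥ t₀, (y, m) ∈ outbox ident (c t) (e t)
    · obtain ⟨t, ht, hs⟩ := hs
      filter_upwards [eventually_ge_atTop (t + 1)] with t' ht' _
      exact hG' _ _ _ _ ht' (ht₀ t ht y m (sent_of_mem_outbox hs) (h.mem_ch_of_outbox hs))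
    · push Not at hs
      filter_upwards [h.eventually_notMem hs] with t ht hm
      exact absurd hm ht
  -- Infinitely many messages are possible, so the times for individual messages cannot simply be
  -- combined. Only the finitely many in channels at `t₀` need it; all others are sent after `t₀`
  -- and are good on arrival.
  have hfin : ∀ᶠ t in atTop, ∀ y, ∀ m ∈ ((c t₀).ch y).toFinset, m ∈ (c t).ch y → G t y m :=
    eventually_all.mpr fun y => (eventually_all_finset _).mpr fun m _ => hpair y m
  filter_upwards [hfin, eventually_ge_atTop t₀] with t ht ht' y m hm
  have key : m ∈ (c t₀).ch y ∨ G t y m := by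
    clear ht
    induction t, ht' using Nat.le_induction with
    | base => exact .inl hm
    | succ t ht' ih =>
      rcases h.mem_ch_succ hm with hm' | hm'
      · exact (ih hm').imp_right (hG _ _ _)
      · exact .inr (ht₀ t ht' y m hm' hm)
  exact key.elim (fun hk => ht y m (Multiset.mem_toFinset.mpr hk) hm) id

/-- Messages of a kind that is no longer sent disappear. -/
theorem eventually_never [Finite V] (h : Regime ident c e) (Q : V → Message V I → Prop)
    (hQ : ∀ᶠ t in atTop, ∀ y m, Sent ident (c t) (e t) y m → m ∈ (c (t + 1)).ch y → ¬ Q y m) :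
    ∀ᶠ t in atTop, ∀ y, ∀ m ∈ (c t).ch y, ¬ Q y m :=
  h.eventually_good (fun _ y m => ¬ Q y m) hQ fun _ _ _ => id

/-- Messages of a kind that is sent only upon receipt of such a message of higher rank
disappear. -/
theorem eventually_never_of_rank [Finite V] (h : Regime ident c e) (Q : V → Message V I → Prop)
    (rank : V → Message V I → ℕ) (B : ℕ) (hB : ∀ y m, rank y m < B)
    (hQ : ∀ᶠ t in atTop, ∀ y m, Sent ident (c t) (e t) y m → Q y m →
      ∃ x m', e t = .receive x m' ∧ Q x m' ∧ rank y m < rank x m') :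
    ∀ᶠ t in atTop, ∀ y, ∀ m ∈ (c t).ch y, ¬ Q y m := by
  -- The highest ranks die out first, since nothing produces them; then each rank below loses its
  -- producers.
  have key : ∀ k, ∀ᶠ t in atTop, ∀ y, ∀ m ∈ (c t).ch y, ¬ (Q y m ∧ B ≤ rank y m + k) := by
    intro k
    induction k with
    | zero => exact .of_forall fun t y m _ hq => absurd hq.2 (by have := hB y m; omega)
    | succ k ih =>
      refine h.eventually_never _ ?_
      filter_upwards [ih, hQ] with t ih hQ y m hs _ ⟨hq, hr⟩
      obtain ⟨x, m', he, hq', hlt⟩ := hQ y m hs hq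
      exact ih x m' (h.mem_ch he) ⟨hq', by omega⟩
  filter_upwards [key B] with t ht y m hm hq
  exact ht y m hm ⟨hq, by omega⟩

/-- What is eventually stable and frequently true is eventually true. -/
theorem eventually_of_frequently {p : ℕ → Prop} (hs : ∀ᶠ t in atTop, p t → p (t + 1))
    (hf : ∃ᶠ t in atTop, p t) : ∀ᶠ t in atTop, p t := by
  obtain ⟨t₀, ht₀⟩ := eventually_atTop.mp hs
  obtain ⟨t₁, h₁, hp⟩ := frequently_atTop.mp hf t₀
  filter_upwards [eventually_ge_atTop t₁] with t ht
  induction t, ht using Nat.le_induction with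
  | base => exact hp
  | succ t ht ih => exact ht₀ t (h₁.trans ht) ih

/-! ### What the messages in channels eventually look like -/

theorem staying_of (h : Regime ident c e) {t : ℕ} {x : V}
    (hx : ((c t).node x).mode = .staying) : ((c 0).node x).mode = .staying :=
  (h.mode t x).symm.trans hx

theorem mode_ne (h : Regime ident c e) {t : ℕ} {x : V}
    (hx : ((c t).node x).mode = .staying) (hx' : ((c 0).node x).mode = .leaving) : False := by
  have := h.staying_of hx
  simp [hx'] at this

theorem mode_ne' (h : Regime ident c e) {t : ℕ} {x : V}
    (hx : ((c t).node x).mode = .leaving) (hx' : ((c 0).node x).mode = .staying) : False := by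
  rw [h.mode t x, hx'] at hx
  cases hx

/-- Only the `Timeout` of a staying node `w` creates such a message. It names `w` as second
parameter and goes to a node strictly between `w` and `v`. -/
theorem eventually_introduce [Finite V] (h : Regime ident c e) :
    ∀ᶠ t in atTop, ∀ y v w, .introduce v (some w) ∈ (c t).ch y →
      ((c 0).node w).mode = .staying ∧
        ∃ d, Beyond d (ident y) (ident v) ∧ Beyond d (ident w) (ident y) := by
  have := h.eventually_never (fun y m => ∃ v w, m = .introduce v (some w) ∧
      ¬ (((c 0).node w).mode = .staying ∧
        ∃ d, Beyond d (ident y) (ident v) ∧ Beyond d (ident w) (ident y))) <| by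
    refine .of_forall fun t y m hs _ => ?_
    rintro ⟨v, w, rfl, hn⟩
    generalize e t = ev at hs
    cases hs with
    | introFar x d v w hx hv hw =>
      exact hn ⟨h.staying_of hx, d, pred_beyond hw, view_nbr_beyond (pred_mem hw)⟩
  filter_upwards [this] with t ht y v w hm
  by_contra hn
  exact ht y _ hm ⟨v, w, rfl, hn⟩

theorem eventually_probeSuccess [Finite V] (h : Regime ident c e) :
    ∀ᶠ t in atTop, ∀ y dest n v, .probeSuccess dest n v ∈ (c t).ch y →
      ((c 0).node v).mode = .staying := by
  have := h.eventually_never (fun _ m => ∃ dest n v, m = .probeSuccess dest n v ∧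
      ¬ ((c 0).node v).mode = .staying) <| by
    refine .of_forall fun t y m hs _ => ?_
    rintro ⟨dest, n, v, rfl, hn⟩
    generalize e t = ev at hs
    cases hs with
    | probeSuccess x source dest next n hx => exact hn (h.staying_of hx)
  filter_upwards [this] with t ht y dest n v hm
  by_contra hn
  exact ht y _ hm ⟨dest, n, v, rfl, hn⟩

theorem keyFor_mono (h : Regime ident c e) {t t' : ℕ} (ht : t ≤ t') {x l : V} {k : ℕ}
    (hk : KeyFor ((c t).node x) l k) : KeyFor ((c t').node x) l k := by
  induction t', ht using Nat.le_induction with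
  | base => exact hk
  | succ t' _ ih => rw [h.comp.step]; exact ih.exec

/-- When `x` acknowledges a request, the value it sends identifies the addressee. -/
theorem ack_key (h : Regime ident c e) {t : ℕ} {x v : V} {d : Dir}
    (he : e t = .receive x (.revAndLinReq d)) (hx : d = .right ∨ ((c t).node x).mode = .staying)
    (hv : v ∈ (view ident (c t) x).nbr d ∪ (view ident (c t) x).temp d) :
    ∃ k, (assignUnique ident (view ident (c t) x)
        ((view ident (c t) x).nbr d ∪ (view ident (c t) x).temp d)).uniqueValue v = some k ∧
      ((c (t + 1)).node x).uniqueValue v = some k ∧ KeyFor ((c (t + 1)).node x) v k := by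
  have hn : (c (t + 1)).node x = assignUnique ident (view ident (c t) x)
      ((view ident (c t) x).nbr d ∪ (view ident (c t) x).temp d) := by
    rw [h.node_actor (x := x) (by rw [he]; rfl), he]
    simp only [after, onMessage, onRevAndLinReq]
    rw [if_pos (by exact hx)]
  obtain ⟨k, hk⟩ := exists_assignUnique_value (ident := ident) (L := view ident (c t) x) hv
  rw [hn]
  exact ⟨k, hk, hk, keyFor_assignUnique h.inj hk⟩

/-- Acknowledgements with corrupt values are among the initial messages only. The predicate depends
on time, but it persists because `KeyFor` does. -/
theorem eventually_ack [Finite V] (h : Regime ident c e) :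
    ∀ᶠ t in atTop, ∀ y v k, .revAndLinAck v k ∈ (c t).ch y →
      KeyFor ((c t).node v) y k := by
  have := h.eventually_good (fun t y m => ∀ v k, m = .revAndLinAck v k →
      KeyFor ((c t).node v) y k) ?_ ?_
  · filter_upwards [this] with t ht y v k hm
    exact ht y _ hm v k rfl
  · refine .of_forall fun t y m hs _ => ?_
    rintro v k rfl
    generalize he : e t = ev at hs
    cases hs with
    | ack x d v k hx hv hk =>
      obtain ⟨j, hj, _, hj'⟩ := h.ack_key he hx hv
      rw [hk, hj]
      exact hj'
  · exact fun t y m hg v k hm => h.keyFor_mono t.le_succ (hg v k hm)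

/-- Only a leaving node sends a `RevAndLin`, and it returns the key that the addressee assigned to
it. Hence a match can never make a node drop a staying reference. -/
theorem eventually_rev [Finite V] (h : Regime ident c e) :
    ∀ᶠ t in atTop, ∀ y A k, .revAndLin A k ∈ (c t).ch y →
      ∃ l, ((c 0).node l).mode = .leaving ∧ KeyFor ((c t).node y) l k := by
  have := h.eventually_good (fun t y m => ∀ A k, m = .revAndLin A k →
      ∃ l, ((c 0).node l).mode = .leaving ∧ KeyFor ((c t).node y) l k) ?_ ?_
  · filter_upwards [this] with t ht y A k hm
    exact ht y _ hm A k rfl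
  · filter_upwards [h.eventually_ack] with t ht y m hs _
    rintro A k rfl
    generalize he : e t = ev at hs
    cases hs with
    | rev x v d k hx hv =>
      exact ⟨x, (h.mode t x).symm.trans hx, h.keyFor_mono t.le_succ (ht _ _ _ (h.mem_ch he))⟩
  · intro t y m hg A k hm
    obtain ⟨l, hl, hk⟩ := hg A k hm
    exact ⟨l, hl, h.keyFor_mono t.le_succ hk⟩

end Regime

/-! ### Probes -/

/-- All of `next` lies between the current position `y` and the destination of the probe. -/
def Between (ident : V → I) (y : V) (dest : I) (next : Finset V) : Prop :=
  ∀ z ∈ next, z = y ∨ ∃ d, Beyond d (ident y) (ident z) ∧ ¬ Beyond d dest (ident z)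

/-- All of `next` lies on one side of the current position `y` of the probe. -/
def OnSide (ident : V → I) (d : Dir) (y : V) (next : Finset V) : Prop :=
  ∀ z ∈ next, z = y ∨ Beyond d (ident y) (ident z)

theorem mem_probeNext {s : State V I} {x z : V} {d : Dir} {dest : I} {next : Finset V}
    (h : z ∈ probeNext ident x (view ident s x) d dest next) :
    (z ≠ x ∧ z ∈ next) ∨ (Beyond d (ident x) (ident z) ∧ ¬ Beyond d dest (ident z)) := by
  rw [probeNext, Finset.mem_union, Finset.mem_erase, Finset.mem_filter] at h
  exact h.imp_right fun h => ⟨view_nbr_beyond h.1, h.2⟩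

/-- The next hop is the first element in the direction of travel, so the rest lies beyond it. -/
theorem onSide_probeNext (hi : Function.Injective ident) {d : Dir} {S : Finset V} {u : V}
    (h : first ident d S = some u) : OnSide ident d u S := fun z hz => by
  rcases eq_or_beyond_of_not_beyond (not_beyond_first h hz) with h | h
  · exact .inl (hi h)
  · exact .inr h

/-- A reference behind `x` would be even farther behind the destination, which `Between` forbids; so
a sound probe moves strictly forward and does not overshoot. -/
theorem Between.probeNext {s : State V I} {x z : V} {d : Dir} {dest : I} {next : Finset V}
    (h : Between ident x dest next) (hd : Beyond d (ident x) dest)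
    (hz : z ∈ probeNext ident x (view ident s x) d dest next) :
    Beyond d (ident x) (ident z) ∧ ¬ Beyond d dest (ident z) := by
  rcases mem_probeNext hz with ⟨hx, hz⟩ | hz
  · obtain ⟨d', h₁, h₂⟩ := (h z hz).resolve_left hx
    rcases dir_eq_or_opp d' d with rfl | rfl
    · exact ⟨h₁, h₂⟩
    · exact absurd ((beyond_opp.mpr hd).trans h₁) h₂
  · exact hz

theorem Between.hop (hi : Function.Injective ident) {s : State V I} {x u : V} {d : Dir} {dest : I}
    {next : Finset V} (h : Between ident x dest next) (hd : Beyond d (ident x) dest)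
    (hu : first ident d (BuildListStar.probeNext ident x (view ident s x) d dest next) = some u) :
    Between ident u dest (BuildListStar.probeNext ident x (view ident s x) d dest next) :=
  fun z hz => (onSide_probeNext hi hu z hz).imp_right fun h' => ⟨d, h', (h.probeNext hd hz).2⟩

/-- If all carried references lie behind `x`, they cannot overshoot the destination, and the hop to
the rearmost one repairs the probe at once. -/
theorem OnSide.hop_opp (hi : Function.Injective ident) {s : State V I} {x u : V} {d : Dir}
    {dest : I} {next : Finset V} (h : OnSide ident d.opp x next) (hd : Beyond d (ident x) dest)
    (hu : first ident d (probeNext ident x (view ident s x) d dest next) = some u) :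
    Between ident u dest (probeNext ident x (view ident s x) d dest next) := fun z hz => by
  refine (onSide_probeNext hi hu z hz).imp_right fun h' => ⟨d, h', ?_⟩
  rcases mem_probeNext hz with ⟨hx, hz⟩ | hz
  · exact ((beyond_opp.mp ((h z hz).resolve_left hx)).trans hd).asymm
  · exact hz.2

/-! ### Corrupt probes die out. -/

namespace Regime

variable {c : ℕ → State V I} {e : ℕ → Event V I}

theorem eventually_probe_onSide [Finite V] (h : Regime ident c e) :
    ∀ᶠ t in atTop, ∀ y source dest next n, .forwardProbe source dest next n ∈ (c t).ch y →
      ∃ d, OnSide ident d y next := by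
  have := h.eventually_never (fun y m => ∃ source dest next n,
      m = .forwardProbe source dest next n ∧ ¬ ∃ d, OnSide ident d y next) <| by
    refine .of_forall fun t y m hs _ => ?_
    rintro ⟨source, dest, next, n, rfl, hn⟩
    generalize e t = ev at hs
    cases hs with
    | probeStart x dest n hx => exact hn ⟨.left, fun z hz => .inl (Finset.mem_singleton.mp hz)⟩
    | probeForward x source dest next n d z hd hz => exact hn ⟨d, onSide_probeNext h.inj hz⟩
  filter_upwards [this] with t ht y source dest next n hm
  by_contra hn
  exact ht y _ hm ⟨_, _, _, _, rfl, hn⟩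

/-- A probe that is sent and has references outside its range is the continuation of another
such probe, which moves away from all of them. -/
theorem sent_not_between (h : Regime ident c e) {t : ℕ} {y source : V} {dest : I}
    {next : Finset V} {n : ℕ}
    (hside : ∀ y source dest next n, .forwardProbe source dest next n ∈ (c t).ch y →
      ∃ d, OnSide ident d y next)
    (hs : Sent ident (c t) (e t) y (.forwardProbe source dest next n))
    (hn : ¬ Between ident y dest next) :
    ∃ x next' d, e t = .receive x (.forwardProbe source dest next' n) ∧
      ¬ Between ident x dest next' ∧ Beyond d (ident x) dest ∧ OnSide ident d x next' ∧
      OnSide ident d y next ∧ Beyond d (ident x) (ident y) := by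
  generalize he : e t = ev at hs
  cases hs with
  | probeStart x dest n hx => exact absurd (fun z hz => .inl (Finset.mem_singleton.mp hz)) hn
  | probeForward x source dest next n d z hd hz =>
    obtain ⟨d', hd'⟩ := hside _ _ _ _ _ (h.mem_ch he)
    have hb : ¬ Between ident x dest next := fun hb => hn (hb.hop h.inj hd hz)
    rcases dir_eq_or_opp d' d with rfl | rfl
    · refine ⟨x, next, d', rfl, hb, hd, hd', onSide_probeNext h.inj hz, ?_⟩
      rcases mem_probeNext (first_mem hz) with ⟨hx, hz⟩ | hz
      · exact (hd' _ hz).resolve_left hx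
      · exact hz.1
    · exact absurd (hd'.hop_opp h.inj hd hz) hn

theorem eventually_probe_between [Finite V] (h : Regime ident c e) :
    ∀ᶠ t in atTop, ∀ y source dest next n, .forwardProbe source dest next n ∈ (c t).ch y →
      Between ident y dest next := by
  have := Fintype.ofFinite V
  -- probes that move away from all their references come to an end
  have h₁ := h.eventually_never_of_rank (fun y m => ∃ source dest next n d,
      m = .forwardProbe source dest next n ∧ ¬ Between ident y dest next ∧
        Beyond d (ident y) dest ∧ OnSide ident d y next)
    (fun y m => match m with
      | .forwardProbe _ dest _ _ =>
        (Finset.univ.filter fun z => ∃ d, Beyond d (ident y) dest ∧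
          Beyond d (ident y) (ident z)).card
      | _ => 0) (Fintype.card V + 1)
    (fun y m => by
      split
      · exact Nat.lt_succ_of_le (Finset.card_le_univ _)
      · exact Nat.succ_pos _) <| by
    filter_upwards [h.eventually_probe_onSide] with t ht y m hs
    rintro ⟨source, dest, next, n, d, rfl, hn, hd, hside⟩
    obtain ⟨x, next', d', he, hn', hd', hside', hsy, hxy⟩ := h.sent_not_between ht hs hn
    -- With opposite directions the two one-sidedness conditions would leave at most `y` itself in
    -- `next`, and `Between` would hold.
    obtain rfl : d = d' := by
      rcases dir_eq_or_opp d d' with rfl | rfl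
      · rfl
      · refine absurd (fun z hz => ?_) hn
        rcases hside z hz with hz' | hz'
        · exact .inl hz'
        · rcases hsy z hz with hz'' | hz''
          · exact .inl hz''
          · exact absurd (beyond_opp.mp hz') hz''.asymm
    refine ⟨x, _, he, ⟨source, dest, next', n, d, rfl, hn', hd', hside'⟩, ?_⟩
    apply Finset.card_lt_card
    rw [Finset.ssubset_iff_of_subset]
    · exact ⟨y, by simpa using ⟨d, hd', hxy⟩, by
        simp only [Finset.mem_filter, not_and, not_exists]
        exact fun _ d' _ => not_beyond_self _ _⟩
    · intro z hz
      obtain ⟨d'', hz₁, hz₂⟩ := (Finset.mem_filter.mp hz).2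
      obtain rfl := hz₁.dir_eq hd
      exact Finset.mem_filter.mpr ⟨Finset.mem_univ _, d'', hd', hxy.trans hz₂⟩
  have h₂ := h.eventually_never (fun y m => ∃ source dest next n,
      m = .forwardProbe source dest next n ∧ ¬ Between ident y dest next) <| by
    -- Any other corrupt probe that is sent continues one of the kind excluded by `h₁`, so it is not
    -- produced any more.
    filter_upwards [h₁, h.eventually_probe_onSide] with t ht hside y m hs _
    rintro ⟨source, dest, next, n, rfl, hn⟩
    obtain ⟨x, next', d', he, hn', hd', hside', -⟩ := h.sent_not_between hside hs hn
    exact ht x _ (h.mem_ch he) ⟨source, dest, next', n, d', rfl, hn', hd', hside'⟩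
  filter_upwards [h₂] with t ht y source dest next n hm
  by_contra hn
  exact ht y _ hm ⟨_, _, _, _, rfl, hn⟩

/-- New probes start at staying nodes and forwarding keeps the source, so a bad probe can only be
the continuation of a bad one. Its rank, the number of nodes after the current position up to the
destination, drops with each hop. -/
theorem eventually_probe_source [Finite V] (h : Regime ident c e) :
    ∀ᶠ t in atTop, ∀ y source dest next n, .forwardProbe source dest next n ∈ (c t).ch y →
      ((c 0).node source).mode = .staying := by
  have := Fintype.ofFinite V
  have h₁ := h.eventually_never_of_rank (fun y m => ∃ source dest next n,
      m = .forwardProbe source dest next n ∧ ¬ ((c 0).node source).mode = .staying)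
    (fun y m => match m with
      | .forwardProbe _ dest _ _ =>
        (Finset.univ.filter fun z => ∃ d, Beyond d (ident y) (ident z) ∧
          ¬ Beyond d dest (ident z)).card
      | _ => 0) (Fintype.card V + 1)
    (fun y m => by
      split
      · exact Nat.lt_succ_of_le (Finset.card_le_univ _)
      · exact Nat.succ_pos _) <| by
    filter_upwards [h.eventually_probe_between] with t ht y m hs
    rintro ⟨source, dest, next, n, rfl, hn⟩
    generalize he : e t = ev at hs
    cases hs with
    | probeStart x dest n hx => exact absurd (h.staying_of hx) hn
    | probeForward x source dest next n d z hd hz =>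
      refine ⟨x, _, rfl, ⟨source, dest, next, n, rfl, hn⟩, ?_⟩
      obtain ⟨h₁, h₂⟩ := (ht _ _ _ _ _ (h.mem_ch he)).probeNext hd (first_mem hz)
      apply Finset.card_lt_card
      rw [Finset.ssubset_iff_of_subset]
      · exact ⟨y, by simpa using ⟨d, h₁, h₂⟩, by
          simp only [Finset.mem_filter, not_and, not_exists]
          exact fun _ d' h => absurd h (not_beyond_self _ _)⟩
      · intro w hw
        obtain ⟨d', hw₁, hw₂⟩ := (Finset.mem_filter.mp hw).2
        refine Finset.mem_filter.mpr ⟨Finset.mem_univ _, d, ?_⟩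
        rcases dir_eq_or_opp d' d with rfl | rfl
        · exact ⟨h₁.trans hw₁, hw₂⟩
        · exact absurd (beyond_of_not_beyond_of_beyond (fun h => h₂ (beyond_opp.mp h)) hw₁) hw₂
  filter_upwards [h₁] with t ht y source dest next n hm
  by_contra hn
  exact ht y _ hm ⟨_, _, _, _, rfl, hn⟩

end Regime

/-! ### Messages that certain steps send -/

theorem mem_outbox_introFar {s : State V I} {x v w : V} {d : Dir}
    (hx : (s.node x).mode = .staying) (hv : v ∈ (view ident s x).nbr d)
    (hw : pred ident d ((view ident s x).nbr d) v = some w) :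
    (w, .introduce v (some x)) ∈ outbox ident s (.timeout x) := by
  have : (w, .introduce v (some x)) ∈ timeoutSide ident x (view ident s x) d := by
    refine Multiset.mem_add.mpr (.inl (Multiset.mem_bind.mpr ⟨v, hv, ?_⟩))
    rw [hw]
    exact Multiset.mem_singleton_self _
  simp only [outbox, sanitize_mode, hx, timeoutStaying, Multiset.mem_add]
  cases d
  exacts [.inr (.inl this), .inr (.inr this)]

theorem mem_outbox_introNear {s : State V I} {x w : V} {d : Dir}
    (hx : (s.node x).mode = .staying)
    (hw : first ident d ((view ident s x).nbr d) = some w) :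
    (w, .introduce x none) ∈ outbox ident s (.timeout x) := by
  have : (w, .introduce x none) ∈ timeoutSide ident x (view ident s x) d := by
    refine Multiset.mem_add.mpr (.inr ?_)
    rw [hw]
    exact Multiset.mem_singleton_self _
  simp only [outbox, sanitize_mode, hx, timeoutStaying, Multiset.mem_add]
  cases d
  exacts [.inr (.inl this), .inr (.inr this)]

theorem mem_outbox_request {s : State V I} {x v : V} {d : Dir}
    (hx : (s.node x).mode = .leaving) (hn : ¬ NIDEC s x) (hv : v ∈ (s.node x).stored)
    (hd : Beyond d (ident x) (ident v)) :
    (v, .revAndLinReq d.opp) ∈ outbox ident s (.timeout x) := by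
  have hv := (sanitize_side (ident := ident)).mpr ⟨hv, hd⟩
  simp only [outbox, sanitize_mode, hx, hn, if_false, timeoutRequest, Multiset.mem_add,
    Multiset.mem_map, Prod.mk.injEq]
  cases d
  exacts [.inl ⟨v, hv, rfl, rfl⟩, .inr ⟨v, hv, rfl, rfl⟩]

theorem mem_outbox_introLin {s : State V I} {y v w : V} {d : Dir}
    (hy : (s.node y).mode = .staying) (hd : Beyond d (ident y) (ident v)) :
    (w, .linearize v) ∈ outbox ident s (.receive y (.introduce v (some w))) := by
  simp [outbox, onMessage, onIntroduce, dirOf_eq_some.mpr hd, hy]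

theorem mem_outbox_rev {s : State V I} {y v : V} {k : ℕ} {d : Dir}
    (hy : (s.node y).mode = .leaving) (hd : Beyond d (ident y) (ident v)) :
    (v, .revAndLin ((view ident s y).nbr d.opp) k) ∈
      outbox ident s (.receive y (.revAndLinAck v k)) := by
  simp [outbox, onMessage, onRevAndLinAck, dirOf_eq_some.mpr hd, hy]

theorem mem_outbox_ack {s : State V I} {x v : V} {d : Dir} {k : ℕ}
    (hx : d = .right ∨ (s.node x).mode = .staying)
    (hv : v ∈ (view ident s x).nbr d ∪ (view ident s x).temp d)
    (hk : (assignUnique ident (view ident s x)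
      ((view ident s x).nbr d ∪ (view ident s x).temp d)).uniqueValue v = some k) :
    (v, .revAndLinAck x k) ∈ outbox ident s (.receive x (.revAndLinReq d)) := by
  simp only [outbox, onMessage, onRevAndLinReq]
  rw [if_pos (by exact hx)]
  refine Multiset.mem_map.mpr ⟨v, hv, ?_⟩
  rw [hk]
  rfl

/-! ### References that certain steps remove -/

/-- After the sanity check a staying node can hold `u` in one set only, so deleting it there removes
it altogether. -/
theorem notMem_stored_removeNbr_staying {x u : V} {L : LocalState V I} {A : Finset V} {d : Dir}
    (hx : L.mode = .staying) (hu : Beyond d (ident x) (ident u)) :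
    u ∉ (((sanitize ident x L).addNbr d A).removeNbr d u).stored := by
  have hn : u ∉ (sanitize ident x L).nbr d.opp := fun h =>
    (beyond_opp.mp (sanitize_nbr_beyond h)).asymm hu
  have ht : ∀ d', u ∉ (sanitize ident x L).temp d' := fun d' => by
    rw [sanitize_temp_staying hx]; exact Finset.notMem_empty u
  intro h
  obtain ⟨d', h | h⟩ := mem_stored.mp h
  · rcases dir_eq_or_opp d' d with rfl | rfl
    · simp [LocalState.removeNbr] at h
    · cases d <;> simp_all [LocalState.removeNbr, LocalState.addNbr, Dir.opp]
  · exact ht d' h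

theorem addNbr_empty (L : LocalState V I) (d : Dir) : L.addNbr d ∅ = L := by
  simp [LocalState.addNbr]

theorem notMem_onLinearize {x u w : V} {L : LocalState V I} {d : Dir}
    (hx : L.mode = .staying) (hu : Beyond d (ident x) (ident u))
    (hw : pred ident d ((sanitize ident x L).nbr d) u = some w) :
    u ∉ (onMessage ident x (sanitize ident x L) (.linearize u)).1.stored := by
  simp only [onMessage, onLinearize, sanitize_mode, hx, dirOf_eq_some.mpr hu, hw]
  have := notMem_stored_removeNbr_staying (A := ∅) hx hu
  rwa [addNbr_empty] at this

/-- A list that `u` sends to `x` lies on the far side of `u` and hence on one side of `x`; it passes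
the test for corrupt lists. -/
theorem not_two_sided {x u : V} {A : Finset V} {d : Dir} (hu : Beyond d (ident x) (ident u))
    (hA : ∀ a ∈ A, Beyond d (ident u) (ident a)) :
    ¬ ((∃ a ∈ A, ident a < ident x) ∧ ∃ b ∈ A, ident x < ident b) := by
  rintro ⟨⟨a, ha, hax⟩, b, hb, hbx⟩
  have h₁ := hu.trans (hA a ha)
  have h₂ := hu.trans (hA b hb)
  cases d
  · exact lt_asymm (α := I) h₂ hbx
  · exact lt_asymm (α := I) h₁ hax

theorem notMem_onRevAndLin_staying {x u : V} {L : LocalState V I} {A : Finset V} {k : ℕ} {d : Dir}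
    (hx : L.mode = .staying) (hu : Beyond d (ident x) (ident u))
    (hA : ∀ a ∈ A, Beyond d (ident u) (ident a))
    (hk : matching (sanitize ident x L) k = some u) :
    u ∉ (onMessage ident x (sanitize ident x L) (.revAndLin A k)).1.stored := by
  simp only [onMessage, onRevAndLin]
  rw [if_neg (not_two_sided hu hA)]
  simp only [hk, dirOf_eq_some.mpr hu, sanitize_mode, hx]
  exact notMem_stored_removeNbr_staying hx hu

/-- A leaving node may hold `u` both in `nbr` and in `temp`, and one match deletes only one copy,
the one in `nbr` first. -/
theorem notMem_nbr_onRevAndLin_leaving {x u : V} {L : LocalState V I} {A : Finset V} {k : ℕ}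
    (hx : L.mode = .leaving) (hu : Beyond .right (ident x) (ident u))
    (hA : ∀ a ∈ A, Beyond .right (ident u) (ident a))
    (hk : matching (sanitize ident x L) k = some u) (d : Dir) :
    u ∉ (onMessage ident x (sanitize ident x L) (.revAndLin A k)).1.nbr d := by
  have hn : u ∉ (sanitize ident x L).nbr .left := fun h => (sanitize_nbr_beyond h).asymm hu
  simp only [onMessage, onRevAndLin]
  rw [if_neg (not_two_sided hu hA)]
  simp only [hk, dirOf_eq_some.mpr hu, sanitize_mode, hx]
  split_ifs with h
  · cases d <;> simp [LocalState.removeNbr, LocalState.addNbr, hn]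
  · cases d
    · exact hn
    · exact h

/-- The second stage: once `u` is absent from `nbr`, the next match deletes the copy in `temp`. -/
theorem notMem_onRevAndLin_leaving {x u : V} {L : LocalState V I} {A : Finset V} {k : ℕ}
    (hx : L.mode = .leaving) (hu : Beyond .right (ident x) (ident u))
    (hA : ∀ a ∈ A, Beyond .right (ident u) (ident a))
    (hk : matching (sanitize ident x L) k = some u) (hn : ∀ d, u ∉ L.nbr d) :
    u ∉ (onMessage ident x (sanitize ident x L) (.revAndLin A k)).1.stored := by
  have hnr : ∀ d, u ∉ (sanitize ident x L).nbr d := fun d h => by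
    obtain ⟨⟨d', h⟩, -⟩ := (sanitize_nbr_leaving hx).mp h
    exact hn d' h
  have ht : u ∉ (sanitize ident x L).temp .left := fun h =>
    ((sanitize_temp_leaving hx).mp h).2.asymm hu
  intro h
  obtain ⟨d, h | h⟩ := mem_stored.mp h
  · exact notMem_nbr_onRevAndLin_leaving hx hu hA hk d h
  · simp only [onMessage, onRevAndLin] at h
    rw [if_neg (not_two_sided hu hA)] at h
    simp only [hk, dirOf_eq_some.mpr hu, sanitize_mode, hx, hnr .right, if_false] at h
    cases d
    · simp [LocalState.removeTemp, LocalState.addTemp, ht] at h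
    · simp [LocalState.removeTemp, LocalState.addTemp] at h

/-! ### References of a leaving node on one side of it -/

/-- The messages with references of `u` that can eventually be in the channel of a node `y` in
direction `d` of `u`. -/
inductive Tame (ident : V → I) (d : Dir) (u y : V) : Message V I → Prop
  | introduce (w) (hw : Beyond d (ident y) (ident w)) : Tame ident d u y (.introduce u (some w))
  | linearize : Tame ident d u y (.linearize u)
  | tempDelegate : Tame ident d u y (.tempDelegate u)
  | probe (source dest next n) (hs : source ≠ u) (hu : u ∈ next)
    (hd : ¬ Beyond d (ident u) dest) : Tame ident d u y (.forwardProbe source dest next n)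

/-- In state `s` all messages with references of `u` in direction `d` of `u` are tame. -/
structure Calm (ident : V → I) (d : Dir) (u : V) (s : State V I) : Prop where
  between : ∀ y source dest next n, .forwardProbe source dest next n ∈ s.ch y →
    Between ident y dest next
  tame : ∀ y, Beyond d (ident u) (ident y) → ∀ m ∈ s.ch y, u ∈ m.refs → Tame ident d u y m

/-- In state `s` the node `x` has no reference of `u` and none is on its way back to `x`. -/
structure Clear (u : V) (s : State V I) (x : V) : Prop where
  stored : u ∉ (s.node x).stored
  ch : ∀ m ∈ s.ch x, u ∉ m.refs
  intro : ∀ y, .introduce u (some x) ∉ s.ch y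

/-- No new references of the leaving node `u` reach its side `d`. -/
structure Shielded (ident : V → I) (c : ℕ → State V I) (d : Dir) (u : V) : Prop where
  leaving : ((c 0).node u).mode = .leaving
  present : ¬ (c 0).gone u
  ack : ∀ᶠ t in atTop, ∀ y, Beyond d (ident u) (ident y) → ∀ k, .revAndLinAck u k ∉ (c t).ch y
  intro : ∀ᶠ t in atTop, ∀ y, Beyond d (ident u) (ident y) → .introduce u none ∉ (c t).ch y
  rev : ∀ᶠ t in atTop, ∀ y, Beyond d (ident u) (ident y) → ∀ A k,
    .revAndLin A k ∈ (c t).ch y → u ∉ A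

namespace Regime

variable {c : ℕ → State V I} {e : ℕ → Event V I} {d : Dir} {u x : V}

theorem eventually_calm [Finite V] (h : Regime ident c e) (hS : Shielded ident c d u) :
    ∀ᶠ t in atTop, Calm ident d u (c t) ∧ Calm ident d u (c (t + 1)) := by
  have key : ∀ᶠ t in atTop, Calm ident d u (c t) := by
    filter_upwards [h.eventually_introduce, h.eventually_probeSuccess, h.eventually_probe_between,
      h.eventually_probe_source, hS.ack, hS.intro, hS.rev] with t h₁ h₂ h₃ h₄ h₅ h₆ h₇
    have hu : ¬ ((c 0).node u).mode = .staying := by simp [hS.leaving]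
    refine ⟨h₃, fun y hy m hm hr => ?_⟩
    cases m with
    | introduce v w =>
      rcases hr with rfl | rfl
      · cases w with
        | none => exact absurd hm (h₆ y hy)
        | some w =>
          obtain ⟨-, d', h', h''⟩ := h₁ _ _ _ hm
          obtain rfl := (beyond_opp.mpr hy).dir_eq h'
          exact .introduce _ (beyond_opp.mp h'')
      · exact absurd (h₁ _ _ _ hm).1 hu
    | linearize v => obtain rfl : u = v := hr; exact .linearize
    | tempDelegate v => obtain rfl : u = v := hr; exact .tempDelegate
    | revAndLinReq => exact hr.elim
    | revAndLinAck v k => obtain rfl : u = v := hr; exact absurd hm (h₅ y hy k)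
    | revAndLin A k => exact absurd hr (h₇ y hy A k hm)
    | forwardProbe source dest next n =>
      have hs : source ≠ u := fun hs => hu (hs ▸ h₄ _ _ _ _ _ hm)
      have hr : u ∈ next := hr.resolve_left hs.symm
      obtain ⟨d', h', h''⟩ := (h₃ _ _ _ _ _ hm u hr).resolve_left (fun h => hy.ne (by rw [h]))
      obtain rfl := (beyond_opp.mpr hy).dir_eq h'
      exact .probe _ _ _ _ hs hr fun h => h'' (beyond_opp.mpr h)
    | probeSuccess dest n v => obtain rfl : u = v := hr; exact absurd (h₂ _ _ _ _ hm) hu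
    | probeFail => exact hr.elim
    | search => exact hr.elim
  exact key.and ((tendsto_add_atTop_nat 1).eventually key)

/-- The ways in which a step sends a reference of `u` to `x`, or a message that will come back to
`x`, if there are no references of `u` beyond `x`. -/
theorem sent_reference (h : Regime ident c e) {t : ℕ} {y : V} {m : Message V I}
    (hu : ((c 0).node u).mode = .leaving) (hux : Beyond d (ident u) (ident x))
    (hc : Calm ident d u (c t)) (hc' : Calm ident d u (c (t + 1)))
    (hfar : ∀ z, Beyond d (ident x) (ident z) → Clear u (c t) z)
    (hs : Sent ident (c t) (e t) y m) (hm : m ∈ (c (t + 1)).ch y)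
    (htok : (y = x ∧ u ∈ m.refs) ∨ m = .introduce u (some x)) :
    (m = .introduce u (some x) ∧ e t = .timeout x ∧ ((c t).node x).mode = .staying ∧
      u ∈ (view ident (c t) x).nbr d.opp ∧
      pred ident d.opp ((view ident (c t) x).nbr d.opp) u = some y) ∨
    (m = .linearize u ∧ ∃ z, e t = .receive z (.introduce u (some x)) ∧
      ((c t).node z).mode = .staying) ∨
    (m = .tempDelegate u ∧ e t = .receive x (.linearize u)) := by
  have hst : ∀ {z d'}, u ∈ (view ident (c t) z).nbr d' → ¬ Beyond d (ident x) (ident z) :=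
    fun hz hxz => (hfar _ hxz).stored ((mem_view_stored h.inj).mp (mem_stored_of_nbr hz)).1
  generalize he : e t = ev at hs
  have hch : ∀ {z m}, ev = .receive z m → m ∈ (c t).ch z := fun hz => h.mem_ch (he.trans hz)
  rcases htok with ⟨rfl, hr⟩ | rfl
  · have ht' := hc'.tame _ hux _ hm hr
    cases hs with
    | probeStart z dest n hx =>
      rcases hr with rfl | hr
      · exact absurd rfl hux.ne
      · exact absurd (congrArg ident (Finset.mem_singleton.mp hr)) hux.ne
    | introFar z d' v w hx hv hw =>
      rcases hr with rfl | hr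
      · obtain rfl := (beyond_opp.mpr hux).dir_eq (pred_beyond hw)
        exact absurd (beyond_opp.mp (view_nbr_beyond (pred_mem hw))) (hst hv)
      · obtain rfl := Option.some.inj hr
        exact (h.mode_ne hx hu).elim
    | introNear => cases ht'
    | exitIntro => cases ht'
    | request => exact hr.elim
    | introLin z v w hx hv =>
      obtain rfl : u = v := hr
      exact .inr (.inl ⟨rfl, z, rfl, hx⟩)
    | introDelegate z v w =>
      obtain rfl : u = w := hr
      cases hc.tame _ hux _ (hch rfl) (.inr rfl) with
      | introduce w hw => exact absurd hux hw.asymm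
    | introOne z v hx hv =>
      obtain rfl : u = v := hr
      cases hc.tame _ hux _ (hch rfl) (.inl rfl)
    | linSelf z v hx =>
      obtain rfl : u = v := hr
      exact .inr (.inr ⟨rfl, rfl⟩)
    | linPred z v d' w hx hv hw =>
      obtain rfl : u = v := hr
      obtain rfl := (beyond_opp.mpr hux).dir_eq (pred_beyond hw)
      exact absurd rfl ((hfar _ (beyond_opp.mp (view_nbr_beyond (pred_mem hw)))).ch _ (hch rfl))
    | delegate z v d' w hv hw hb =>
      obtain rfl : u = v := hr
      -- `x` is the closest neighbor of the sender towards `u`, and `u` lies behind `x`; so the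
      -- sender is beyond `x`, where no message carries `u`.
      obtain rfl := (beyond_opp.mpr hux).dir_eq
        ((eq_or_beyond_of_not_beyond hb).resolve_left hux.ne)
      exact absurd rfl ((hfar _ (beyond_opp.mp (view_nbr_beyond (first_mem hw)))).ch _ (hch rfl))
    | ack => cases ht'
    | rev => cases ht'
    | ackDelegate z v k hx =>
      obtain rfl : u = v := hr
      cases hc.tame _ hux _ (hch rfl) rfl
    | revDelegate z A k v hv =>
      obtain rfl : u = v := hr
      cases hc.tame _ hux _ (hch rfl) hv
    | revIntro => cases ht'
    | probeDelegate z source dest next n v hx hv =>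
      obtain rfl : u = v := hr
      cases hc.tame _ hux _ (hch rfl) (.inr hv) with
      | probe _ _ _ _ _ _ hd => exact absurd (hx ▸ hux) hd
    | probeSource z source dest next n =>
      obtain rfl : u = source := hr
      cases hc.tame _ hux _ (hch rfl) (.inl rfl) with
      | probe _ _ _ _ hs => exact absurd rfl hs
    | probeSuccess => cases ht'
    | probeFail => exact hr.elim
    | probeBack z source dest next n d' w hd hz hb =>
      obtain rfl : u = w := hr
      exact absurd hb
        ((hc.between _ _ _ _ _ (hch rfl)).probeNext hd (first_mem hz)).1.asymm
    | probeForward z source dest next n d' w hd hz =>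
      cases ht' with
      | probe _ _ _ _ hs hun _ =>
        have hzx := ((hc.between _ _ _ _ _ (hch rfl)).probeNext hd (first_mem hz)).1
        obtain rfl := (beyond_opp.mpr hux).dir_eq
          ((eq_or_beyond_of_not_beyond (not_beyond_first hz hun)).resolve_left hux.ne)
        have hxz := beyond_opp.mp hzx
        rw [probeNext, Finset.mem_union, Finset.mem_erase, Finset.mem_filter] at hun
        rcases hun with hun | hun
        · exact absurd (.inr hun.2) ((hfar _ hxz).ch _ (hch rfl))
        · exact absurd hxz (hst hun.1)
    | searchSend => exact hr.elim
    | successDelegate z dest n v =>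
      obtain rfl : u = v := hr
      cases hc.tame _ hux _ (hch rfl) rfl
  · cases hs with
    | introFar z d' v w hx hv hw =>
      obtain rfl := (beyond_opp.mpr hux).dir_eq (view_nbr_beyond hv)
      exact .inl ⟨rfl, rfl, hx, hv, hw⟩

/-- If `x` no longer introduces `u` to other nodes, all messages with references of `u`
disappear from the channel of `x`. -/
theorem eventually_ch_clear [Finite V] (h : Regime ident c e) (hS : Shielded ident c d u)
    (hux : Beyond d (ident u) (ident x))
    (hfar : ∀ᶠ t in atTop, ∀ z, Beyond d (ident x) (ident z) → Clear u (c t) z)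
    (hno : ∀ᶠ t in atTop, ∀ w, e t = .timeout x → ((c t).node x).mode = .staying →
      u ∈ (view ident (c t) x).nbr d.opp →
      pred ident d.opp ((view ident (c t) x).nbr d.opp) u ≠ some w) :
    ∀ᶠ t in atTop, (∀ m ∈ (c t).ch x, u ∉ m.refs) ∧ ∀ y, .introduce u (some x) ∉ (c t).ch y := by
  have hcalm := h.eventually_calm hS
  -- The possible sources form a chain: `x` introduces `u`, the addressee answers with `Linearize`,
  -- and `x` delegates `u` to itself. With the first link cut, the later ones dry up in turn.
  have h₁ := h.eventually_never (fun _ m => m = .introduce u (some x)) <| by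
    filter_upwards [hcalm, hfar, hno] with t hc hfar hno y m hs hm hq
    rcases h.sent_reference hS.leaving hux hc.1 hc.2 hfar hs hm (.inr hq) with
      ⟨-, h₁, h₂, h₃, h₄⟩ | ⟨h₁, -⟩ | ⟨h₁, -⟩
    · exact hno y h₁ h₂ h₃ h₄
    · rw [hq] at h₁; cases h₁
    · rw [hq] at h₁; cases h₁
  have h₂ := h.eventually_never (fun y m => y = x ∧ m = .linearize u) <| by
    filter_upwards [hcalm, hfar, h₁] with t hc hfar h₁ y m hs hm ⟨hy, hq⟩
    rcases h.sent_reference hS.leaving hux hc.1 hc.2 hfar hs hm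
      (.inl ⟨hy, by rw [hq]; rfl⟩) with ⟨h', -⟩ | ⟨-, z, he, -⟩ | ⟨h', -⟩
    · rw [hq] at h'; cases h'
    · exact h₁ z _ (h.mem_ch he) rfl
    · rw [hq] at h'; cases h'
  have h₃ := h.eventually_never (fun y m => y = x ∧ u ∈ m.refs) <| by
    filter_upwards [hcalm, hfar, hno, h₁, h₂] with t hc hfar hno h₁ h₂ y m hs hm ⟨hy, hq⟩
    rcases h.sent_reference hS.leaving hux hc.1 hc.2 hfar hs hm
      (.inl ⟨hy, hq⟩) with ⟨-, h₁, h₂, h₃, h₄⟩ | ⟨-, z, he, -⟩ | ⟨-, he⟩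
    · exact hno y h₁ h₂ h₃ h₄
    · exact h₁ z _ (h.mem_ch he) rfl
    · exact h₂ x _ (h.mem_ch he) ⟨rfl, rfl⟩
  filter_upwards [h₁, h₃] with t h₁ h₃
  exact ⟨fun m hm hr => h₃ x m hm ⟨rfl, hr⟩, fun y hm => h₁ y _ hm rfl⟩

/-- A node that receives no reference of `u` any more stores `u` for good or not at all. -/
theorem stored_dichotomy (hs : ∀ᶠ t in atTop, u ∉ ((c t).node x).stored →
      u ∉ ((c (t + 1)).node x).stored) :
    (∀ᶠ t in atTop, u ∉ ((c t).node x).stored) ∨ ∀ᶠ t in atTop, u ∈ ((c t).node x).stored := by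
  by_cases hf : ∃ᶠ t in atTop, u ∉ ((c t).node x).stored
  · exact .inl (eventually_of_frequently hs hf)
  · exact .inr (by simpa [Filter.not_frequently] using hf)

theorem notMem_stored_succ (h : Regime ident c e) {t : ℕ}
    (hch : ∀ m ∈ (c t).ch x, u ∉ m.refs) (hu : u ∉ ((c t).node x).stored) :
    u ∉ ((c (t + 1)).node x).stored := by
  intro hu'
  rw [h.comp.step] at hu'
  obtain ⟨m, he, hg⟩ := gain_of_mem_exec h.inj hu' hu
  exact hch m (h.mem_ch he) hg.mem_refs

/-- If `x` stores the leaving node `u` for good and `u` keeps requesting, then `x` keeps being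
asked to drop `u`. -/
theorem frequently_matching (h : Regime ident c e) (hS : Shielded ident c d u)
    (hux : Beyond d (ident u) (ident x)) (hu : ∀ᶠ t in atTop, u ∈ ((c t).node x).stored)
    (hx : d.opp = .right ∨ ((c 0).node x).mode = .staying)
    (hreq : ∃ᶠ t in atTop, e t = .receive x (.revAndLinReq d.opp)) :
    ∃ᶠ t in atTop, ∃ A k, e t = .receive x (.revAndLin A k) ∧
      matching (view ident (c t) x) k = some u ∧
      ∀ a ∈ A, Beyond d.opp (ident u) (ident a) := by
  obtain ⟨T, hT⟩ := eventually_atTop.mp hu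
  rw [frequently_atTop]
  intro T'
  -- The exchange takes three receipts: the request by `x` at `t`, the acknowledgement by `u` at
  -- `j`, the list by `x` at `j'`. Since `u` stays stored, the key assigned at `t` is still attached
  -- to it at `j'`.
  obtain ⟨t, ht, he⟩ := frequently_atTop.mp hreq (max T T')
  have hv := (sanitize_side (ident := ident)).mpr
    ⟨hT t ((le_max_left _ _).trans ht), beyond_opp.mpr hux⟩
  have hx' : d.opp = .right ∨ ((c t).node x).mode = .staying := by rwa [h.mode t x]
  obtain ⟨k, hk, hk', hkey⟩ := h.ack_key he hx' hv
  have hm := mem_outbox_ack hx' hv hk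
  rw [← he] at hm
  obtain ⟨j, hj, hej⟩ := h.exists_receive hm
  have hm := mem_outbox_rev (s := c j) (k := k) ((h.mode j u).trans hS.leaving) hux
  rw [← hej] at hm
  obtain ⟨j', hj', hej'⟩ := h.exists_receive hm
  refine ⟨j', by have := le_max_right T T'; omega, _, k, hej', ?_, fun a ha => view_nbr_beyond ha⟩
  have hne : u ≠ x := fun hux' => hux.ne (by rw [hux'])
  have hval : ((c j').node x).uniqueValue u = some k := by
    have : t + 1 ≤ j' := by omega
    clear hej' hj'
    induction j', this using Nat.le_induction with
    | base => exact hk'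
    | succ i hi ih =>
      rw [h.comp.step]
      exact exec_keep_value (h.not_exit i) (h.keyFor_mono hi hkey)
        (hT i (by have := le_max_left T T'; omega)) hne ih
  have hkey' := h.keyFor_mono (by omega : t + 1 ≤ j') hkey
  have hst := hT j' (by have := le_max_left T T'; omega)
  exact matching_eq ((mem_view_stored h.inj).mpr ⟨hst, hne⟩)
    (sanitize_value_keep hkey' hst hne hval) hkey'.sanitize.2

theorem not_stored_of_matching_staying (h : Regime ident c e) {t : ℕ} {A : Finset V} {k : ℕ}
    (hx : ((c 0).node x).mode = .staying) (hux : Beyond d (ident u) (ident x))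
    (he : e t = .receive x (.revAndLin A k)) (hk : matching (view ident (c t) x) k = some u)
    (hA : ∀ a ∈ A, Beyond d.opp (ident u) (ident a)) : u ∉ ((c (t + 1)).node x).stored := by
  rw [h.node_actor (x := x) (by rw [he]; rfl), he]
  exact notMem_onRevAndLin_staying ((h.mode t x).trans hx) (beyond_opp.mpr hux) hA hk

/-- A leaving node on the left of `u` that keeps receiving requests drops `u`. -/
theorem clear_of_leaving [Finite V] (h : Regime ident c e) (hS : Shielded ident c .left u)
    (hux : Beyond .left (ident u) (ident x)) (hx : ((c 0).node x).mode = .leaving)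
    (hch : ∀ᶠ t in atTop, ∀ m ∈ (c t).ch x, u ∉ m.refs)
    (hreq : ∃ᶠ t in atTop, e t = .receive x (.revAndLinReq .right)) :
    ∀ᶠ t in atTop, u ∉ ((c t).node x).stored := by
  refine (stored_dichotomy (c := c) ?_).resolve_right fun hu => ?_
  · filter_upwards [hch] with t ht hu
    exact h.notMem_stored_succ ht hu
  have hfreq := h.frequently_matching hS hux hu (.inl rfl) hreq
  have hxu : Beyond .right (ident x) (ident u) := beyond_opp.mpr hux
  have hmode : ∀ t, ((c t).node x).mode = .leaving := fun t => (h.mode t x).trans hx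
  -- One match expels `u` from the sets `nbr`. As no incoming message carries `u` any more, it does
  -- not return there, and only a copy in `temp` can be left for the second match below.
  have hnbr : ∀ᶠ t in atTop, ∀ d, u ∉ ((c t).node x).nbr d := by
    refine eventually_of_frequently ?_ ?_
    · filter_upwards [hch] with t ht hn d hd
      by_cases ha : (e t).actor = some x
      · rw [h.node_actor ha] at hd
        have hv : ∀ d, u ∉ (view ident (c t) x).nbr d := fun d h' => by
          obtain ⟨⟨d', h'⟩, -⟩ := (sanitize_nbr_leaving (hmode t)).mp h'
          exact hn d' h'
        generalize he : e t = ev at ha hd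
        cases ev with
        | timeout z => exact hv d hd
        | receive z m =>
          cases ha
          refine hv d (mem_nbr_of_leaving (hmode t) hd ?_)
          rintro A k rfl hA
          exact ht _ (h.mem_ch he) hA
        | initiateSearch z dest =>
          simp only [after, onInitiateSearch_nbr.1] at hd
          exact hv d hd
        | leave z => exact hv d hd
        | idle => cases ha
      · rw [h.comp.step, exec_node_of_ne ha] at hd
        exact hn d hd
    · rw [frequently_atTop] at hfreq ⊢
      intro T
      obtain ⟨t, ht, A, k, he, hk, hA⟩ := hfreq T
      refine ⟨t + 1, by omega, fun d => ?_⟩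
      rw [h.node_actor (x := x) (by rw [he]; rfl), he]
      exact notMem_nbr_onRevAndLin_leaving (hmode t) hxu hA hk d
  obtain ⟨t, ⟨A, k, he, hk, hA⟩, hn, hst⟩ :=
    (hfreq.and_eventually (hnbr.and ((tendsto_add_atTop_nat 1).eventually hu))).exists
  rw [h.node_actor (x := x) (by rw [he]; rfl), he] at hst
  exact notMem_onRevAndLin_leaving (hmode t) hxu hA hk hn hst

/-- If a staying node `x` stores, again and again, staying nodes between itself and `u`, it
eventually keeps one of them for good. -/
theorem exists_permanent [Finite V] (h : Regime ident c e) (hx : ((c 0).node x).mode = .staying)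
    (hf : ∃ᶠ t in atTop, ∃ w, ((c 0).node w).mode = .staying ∧ Beyond d (ident x) (ident w) ∧
      Beyond d (ident w) (ident u) ∧ w ∈ ((c t).node x).stored) :
    ∃ w, Beyond d (ident x) (ident w) ∧ Beyond d (ident w) (ident u) ∧
      ∀ᶠ t in atTop, w ∈ ((c t).node x).stored := by
  have := Fintype.ofFinite V
  let W : Finset V := Finset.univ.filter fun w => ((c 0).node w).mode = .staying ∧
    Beyond d (ident x) (ident w) ∧ Beyond d (ident w) (ident u) ∧
    ∃ᶠ t in atTop, w ∈ ((c t).node x).stored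
  have hW : ∀ {w}, w ∈ W ↔ ((c 0).node w).mode = .staying ∧
    Beyond d (ident x) (ident w) ∧ Beyond d (ident w) (ident u) ∧
    ∃ᶠ t in atTop, w ∈ ((c t).node x).stored := by simp [W]
  -- The permanent node is the one closest to `x` among those stored infinitely often; `W` is not
  -- empty because there are only finitely many nodes.
  cases hw : first ident d W with
  | none =>
    exfalso
    refine hf ?_
    have : ∀ᶠ t in atTop, ∀ w, ¬ (((c 0).node w).mode = .staying ∧
        Beyond d (ident x) (ident w) ∧ Beyond d (ident w) (ident u) ∧
        w ∈ ((c t).node x).stored) := by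
      refine eventually_all.mpr fun w => ?_
      by_contra hc
      have hc : ∃ᶠ t in atTop, _ := fun h' => hc h'
      have hmem : w ∈ W := by
        obtain ⟨t, h₁, h₂, h₃, -⟩ := hc.exists
        exact hW.mpr ⟨h₁, h₂, h₃, hc.mono fun t ht => ht.2.2.2⟩
      rw [first_eq_none hw] at hmem
      exact Finset.notMem_empty w hmem
    filter_upwards [this] with t ht
    rintro ⟨w, hw⟩
    exact ht w hw
  | some w =>
    obtain ⟨hws, hxw, hwu, hfw⟩ := hW.mp (first_mem hw)
    refine ⟨w, hxw, hwu, ?_⟩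
    have hnear : ∀ᶠ t in atTop, ∀ y, ((c 0).node y).mode = .staying →
        Beyond d (ident x) (ident y) → Beyond d (ident y) (ident w) →
        y ∉ ((c t).node x).stored := by
      refine eventually_all.mpr fun y => ?_
      by_cases hy : ((c 0).node y).mode = .staying ∧ Beyond d (ident x) (ident y) ∧
        Beyond d (ident y) (ident w)
      · have : y ∉ W := fun hyW => not_beyond_first hw hyW hy.2.2
        have : ¬ ∃ᶠ t in atTop, y ∈ ((c t).node x).stored := fun hfy =>
          this (hW.mpr ⟨hy.1, hy.2.1, hy.2.2.trans hwu, hfy⟩)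
        filter_upwards [Filter.not_frequently.mp this] with t ht _ _ _
        exact ht
      · exact .of_forall fun t h₁ h₂ h₃ => absurd ⟨h₁, h₂, h₃⟩ hy
    -- Introducing `w` to a staying node would need a stored staying node between `x` and `w`,
    -- contrary to `hnear`. So nobody asks `x` to linearize `w`.
    have h₁ := h.eventually_never
      (fun y m => ((c 0).node y).mode = .staying ∧ m = .introduce w (some x)) <| by
      filter_upwards [hnear] with t ht y m hs _
      rintro ⟨hy, rfl⟩
      generalize e t = ev at hs
      cases hs with
      | introFar z d' v _ hz hv hp =>
        obtain rfl := hxw.dir_eq (view_nbr_beyond hv)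
        exact ht y hy (view_nbr_beyond (pred_mem hp)) (pred_beyond hp)
          ((mem_view_stored h.inj).mp (mem_stored_of_nbr (pred_mem hp))).1
    have h₂ := h.eventually_never (fun y m => y = x ∧ m = .linearize w) <| by
      filter_upwards [h₁] with t ht y m hs _
      rintro ⟨rfl, rfl⟩
      generalize he : e t = ev at hs
      cases hs with
      | introLin z v _ hz hv => exact ht z _ (h.mem_ch he) ⟨h.staying_of hz, rfl⟩
    refine eventually_of_frequently ?_ hfw
    filter_upwards [h₂, h.eventually_rev] with t h₂ hrev hst
    by_contra hst'
    rw [h.comp.step] at hst'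
    obtain ⟨m, he, hl⟩ := lose_of_notMem_exec h.inj (h.not_exit t)
      (fun hwx => hxw.ne (by rw [hwx])) hst' hst
    cases hl with
    | linearize => exact h₂ x _ (h.mem_ch he) ⟨rfl, rfl⟩
    -- The key in the message belongs to a leaving node, but `w` is staying.
    | rev A k _ d' hk hd hx =>
      obtain ⟨l, hl, hkey⟩ := hrev _ _ _ (h.mem_ch he)
      obtain rfl := hkey.2 _ (sanitize_value (matching_mem hk).2).1
      rw [hws] at hl
      cases hl

end Regime

namespace Regime

variable {c : ℕ → State V I} {e : ℕ → Event V I} {d : Dir} {u x : V}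

theorem mem_view_nbr (h : Regime ident c e) {t : ℕ} {v : V}
    (hx : ((c 0).node x).mode = .staying) :
    v ∈ (view ident (c t) x).nbr d ↔ v ∈ ((c t).node x).stored ∧ Beyond d (ident x) (ident v) :=
  sanitize_nbr_staying ((h.mode t x).trans hx)

/-- If `x` keeps a reference `w` closer than `u` for good, it eventually drops `u`. -/
theorem eventually_notMem_of_permanent [Finite V] (h : Regime ident c e)
    (hS : Shielded ident c d u)
    (hux : Beyond d (ident u) (ident x)) (hx : ((c 0).node x).mode = .staying)
    (hfar : ∀ᶠ t in atTop, ∀ z, Beyond d (ident x) (ident z) → Clear u (c t) z)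
    (hpred : ∀ᶠ t in atTop, e t = .timeout x → ∀ w, u ∈ (view ident (c t) x).nbr d.opp →
      pred ident d.opp ((view ident (c t) x).nbr d.opp) u = some w →
      ((c 0).node w).mode = .staying)
    {w : V} (hxw : Beyond d.opp (ident x) (ident w)) (hwu : Beyond d.opp (ident w) (ident u))
    (hw : ∀ᶠ t in atTop, w ∈ ((c t).node x).stored) :
    ∀ᶠ t in atTop, u ∉ ((c t).node x).stored := by
  have hxu : Beyond d.opp (ident x) (ident u) := beyond_opp.mpr hux
  refine (stored_dichotomy (c := c) ?_).resolve_right fun hu => ?_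
  -- With `w` in place, `x` does not regain `u`: delegated references are passed on, since `u` is
  -- not closer than `w`, and a probe would take `w` or something closer as its next hop.
  · filter_upwards [h.eventually_calm hS, hfar, hw] with t hc hfar hw hu hu'
    have hwn : w ∈ (view ident (c t) x).nbr d.opp := (h.mem_view_nbr hx).mpr ⟨hw, hxw⟩
    have hmode : ¬ (view ident (c t) x).mode = .leaving := fun h' => h.mode_ne' h' hx
    rw [h.comp.step] at hu'
    obtain ⟨m, he, hg⟩ := gain_of_mem_exec h.inj hu' hu
    have ht := hc.1.tame x hux m (h.mem_ch he) hg.mem_refs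
    cases hg with
    | introduce v w' =>
      cases ht with
      | introduce _ hb => exact (hfar _ hb).intro _ (h.mem_ch he)
    | introduceLeaving v w' u hl => exact hmode hl
    | linearize v hl => exact hmode hl
    | tempDelegate v d' hd' hf =>
      obtain rfl := hxu.dir_eq hd'
      cases hfst : first ident d.opp ((view ident (c t) x).nbr d.opp) with
      | none =>
        rw [first_eq_none hfst] at hwn
        exact Finset.notMem_empty w hwn
      | some f => exact not_beyond_first hfst hwn (hwu.trans (hf f hfst))
    | ack v k hl => exact hmode hl
    | rev => cases ht
    | probe source dest next n d' z hd' hz hn =>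
      obtain ⟨h₁, h₂⟩ := (hc.1.between _ _ _ _ _ (h.mem_ch he)).probeNext hd' (first_mem hz)
      obtain rfl := hxu.dir_eq h₁
      refine not_beyond_first hz ?_ hwu
      exact Finset.mem_union_right _ (Finset.mem_filter.mpr ⟨hwn, fun h' => h₂ (h'.trans hwu)⟩)
  -- Were `u` kept for good, it would always have a predecessor at `x`. The one at the next
  -- `Timeout` is staying and answers the introduction with `Linearize u`, and `x` drops `u`.
  · obtain ⟨T, hT⟩ := eventually_atTop.mp (hu.and (hw.and hpred))
    have hmem : ∀ t ≥ T, u ∈ (view ident (c t) x).nbr d.opp := fun t ht =>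
      (h.mem_view_nbr hx).mpr ⟨(hT t ht).1, hxu⟩
    have hp : ∀ t ≥ T, ∃ y, pred ident d.opp ((view ident (c t) x).nbr d.opp) u = some y := by
      intro t ht
      cases hp : pred ident d.opp ((view ident (c t) x).nbr d.opp) u with
      | none =>
        exact absurd hwu (pred_eq_none hp ((h.mem_view_nbr hx).mpr ⟨(hT t ht).2.1, hxw⟩))
      | some y => exact ⟨y, rfl⟩
    obtain ⟨t, ht, he⟩ := h.exists_timeout (h.present x hx) T
    obtain ⟨y, hy⟩ := hp t ht
    have hys := (hT t ht).2.2 he y (hmem t ht) hy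
    have hm := mem_outbox_introFar ((h.mode t x).trans hx) (hmem t ht) hy
    rw [← he] at hm
    obtain ⟨j, hj, hej⟩ := h.exists_receive hm
    have hm := mem_outbox_introLin (s := c j) (w := x) ((h.mode j y).trans hys) (pred_beyond hy)
    rw [← hej] at hm
    obtain ⟨j', hj', hej'⟩ := h.exists_receive hm
    obtain ⟨y', hy'⟩ := hp j' (by omega)
    refine absurd (hT (j' + 1) (by omega)).1 ?_
    rw [h.node_actor (x := x) (by rw [hej']; rfl), hej']
    exact notMem_onLinearize ((h.mode j' x).trans hx) hxu hy'

/-- If `u` is eventually the closest reference of `x` on its side whenever it is stored there,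
then `x` introduces itself to `u`, and `u` makes `x` drop it. -/
theorem eventually_notMem_of_closest [Finite V] (h : Regime ident c e)
    (hS : Shielded ident c d u)
    (hux : Beyond d (ident u) (ident x)) (hx : ((c 0).node x).mode = .staying)
    (hch : ∀ᶠ t in atTop, ∀ m ∈ (c t).ch x, u ∉ m.refs)
    (hno : ∀ᶠ t in atTop, ∀ w, e t = .timeout x → u ∈ (view ident (c t) x).nbr d.opp →
      pred ident d.opp ((view ident (c t) x).nbr d.opp) u ≠ some w)
    (hkeep : ∀ᶠ t in atTop, x ∈ ((c t).node u).stored → x ∈ ((c (t + 1)).node u).stored) :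
    ∀ᶠ t in atTop, u ∉ ((c t).node x).stored := by
  have hxu : Beyond d.opp (ident x) (ident u) := beyond_opp.mpr hux
  refine (stored_dichotomy (c := c) ?_).resolve_right fun hu => ?_
  · filter_upwards [hch] with t ht hu
    exact h.notMem_stored_succ ht hu
  -- At late `Timeout`s `u` has no predecessor and is therefore the closest reference, the one to
  -- which `x` introduces itself. Combined with `hkeep`, `u` knows `x` forever and keeps requesting.
  have hknow : ∃ᶠ t in atTop, x ∈ ((c t).node u).stored := by
    obtain ⟨T, hT⟩ := eventually_atTop.mp (hu.and hno)
    refine frequently_atTop.mpr fun T' => ?_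
    obtain ⟨t, ht, he⟩ := h.exists_timeout (h.present x hx) (max T T')
    obtain ⟨hst, hno⟩ := hT t ((le_max_left _ _).trans ht)
    have hun : u ∈ (view ident (c t) x).nbr d.opp := (h.mem_view_nbr hx).mpr ⟨hst, hxu⟩
    have hfst : first ident d.opp ((view ident (c t) x).nbr d.opp) = some u := by
      cases hf : first ident d.opp ((view ident (c t) x).nbr d.opp) with
      | none =>
        rw [first_eq_none hf] at hun
        exact absurd hun (Finset.notMem_empty u)
      | some f =>
        rcases eq_or_beyond_of_not_beyond (not_beyond_first hf hun) with hfu | hfu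
        · rw [h.inj hfu]
        · exfalso
          cases hp : pred ident d.opp ((view ident (c t) x).nbr d.opp) u with
          | none => exact pred_eq_none hp (first_mem hf) hfu
          | some w => exact hno w he hun hp
    have hm := mem_outbox_introNear ((h.mode t x).trans hx) hfst
    rw [← he] at hm
    obtain ⟨j, hj, hej⟩ := h.exists_receive hm
    refine ⟨j + 1, by have := le_max_right T T'; omega, ?_⟩
    rw [h.node_actor (x := u) (by rw [hej]; rfl), hej]
    simp only [after, onMessage, onIntroduce, dirOf_eq_some.mpr hux, sanitize_mode,
      (h.mode j u).trans hS.leaving]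
    rw [mem_stored_addTemp]
    by_cases hxn : x ∈ (view ident (c j) u).nbr d
    · exact .inl (mem_stored_of_nbr hxn)
    · exact .inr (Finset.mem_sdiff.mpr ⟨Finset.mem_insert_self _ _, hxn⟩)
  have hknow := eventually_of_frequently hkeep hknow
  have hreq : ∃ᶠ t in atTop, e t = .receive x (.revAndLinReq d.opp) := by
    obtain ⟨T, hT⟩ := eventually_atTop.mp hknow
    refine frequently_atTop.mpr fun T' => ?_
    obtain ⟨t, ht, he⟩ := h.exists_timeout hS.present (max T T')
    have hl := (h.mode t u).trans hS.leaving
    have hm := mem_outbox_request hl (fun hn => h.not_exit t ⟨u, he, hl, hn⟩)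
      (hT t ((le_max_left _ _).trans ht)) hux
    rw [← he] at hm
    obtain ⟨j, hj, hej⟩ := h.exists_receive hm
    exact ⟨j, by have := le_max_right T T'; omega, hej⟩
  obtain ⟨t, ⟨A, k, he, hk, hA⟩, hst⟩ := ((h.frequently_matching hS hux hu (.inr hx) hreq).and_eventually
    ((tendsto_add_atTop_nat 1).eventually hu)).exists
  exact h.not_stored_of_matching_staying hx hux he hk hA hst

/-- The two cases exclude each other's obstacle. If staying nodes between `x` and `u` recur, one
becomes permanent and removes `u` from the memory, after which the channel clears. Otherwise `u` has
no predecessor at `x`, so no introductions are made, the channel clears first, and then the memory.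
-/
theorem eventually_clear_of_staying [Finite V] (h : Regime ident c e)
    (hS : Shielded ident c d u)
    (hux : Beyond d (ident u) (ident x)) (hx : ((c 0).node x).mode = .staying)
    (hfar : ∀ᶠ t in atTop, ∀ z, Beyond d (ident x) (ident z) → Clear u (c t) z)
    (hpred : ∀ᶠ t in atTop, e t = .timeout x → ∀ w, u ∈ (view ident (c t) x).nbr d.opp →
      pred ident d.opp ((view ident (c t) x).nbr d.opp) u = some w →
      ((c 0).node w).mode = .staying)
    (hkeep : ∀ᶠ t in atTop, x ∈ ((c t).node u).stored → x ∈ ((c (t + 1)).node u).stored) :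
    ∀ᶠ t in atTop, Clear u (c t) x := by
  by_cases hf : ∃ᶠ t in atTop, ∃ w, ((c 0).node w).mode = .staying ∧
      Beyond d.opp (ident x) (ident w) ∧ Beyond d.opp (ident w) (ident u) ∧
      w ∈ ((c t).node x).stored
  · obtain ⟨w, hxw, hwu, hw⟩ := h.exists_permanent hx hf
    have hst := h.eventually_notMem_of_permanent hS hux hx hfar hpred hxw hwu hw
    have hch := h.eventually_ch_clear hS hux hfar <| by
      filter_upwards [hst] with t ht _ _ _ hu
      exact absurd ((h.mem_view_nbr hx).mp hu).1 ht
    filter_upwards [hst, hch] with t h₁ h₂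
    exact ⟨h₁, h₂.1, h₂.2⟩
  · have hno : ∀ᶠ t in atTop, ∀ w, e t = .timeout x → u ∈ (view ident (c t) x).nbr d.opp →
        pred ident d.opp ((view ident (c t) x).nbr d.opp) u ≠ some w := by
      filter_upwards [hpred, Filter.not_frequently.mp hf] with t hpred hf w he hu hp
      have hw := (h.mem_view_nbr hx).mp (pred_mem hp)
      exact hf ⟨w, hpred he w hu hp, hw.2, pred_beyond hp, hw.1⟩
    have hch := h.eventually_ch_clear hS hux hfar <| by
      filter_upwards [hno] with t ht w he _
      exact ht w he
    have hst := h.eventually_notMem_of_closest hS hux hx (hch.mono fun t ht => ht.1) hno hkeep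
    filter_upwards [hst, hch] with t h₁ h₂
    exact ⟨h₁, h₂.1, h₂.2⟩

/-- On a shielded side of a leaving node `u`, all references of `u` eventually vanish. -/
theorem eventually_clear [Finite V] (h : Regime ident c e) (hS : Shielded ident c d u)
    (hpred : ∀ x, ((c 0).node x).mode = .staying → Beyond d (ident u) (ident x) →
      ∀ᶠ t in atTop, e t = .timeout x → ∀ w, u ∈ (view ident (c t) x).nbr d.opp →
      pred ident d.opp ((view ident (c t) x).nbr d.opp) u = some w →
      ((c 0).node w).mode = .staying)
    (hleaving : ∀ x, ((c 0).node x).mode = .leaving → Beyond d (ident u) (ident x) →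
      (∀ᶠ t in atTop, u ∉ ((c t).node x).stored) ∨
      (d = .left ∧ ∃ᶠ t in atTop, e t = .receive x (.revAndLinReq .right)))
    (hkeep : ∀ x, Beyond d (ident u) (ident x) →
      ∀ᶠ t in atTop, x ∈ ((c t).node u).stored → x ∈ ((c (t + 1)).node u).stored) :
    ∀ᶠ t in atTop, ∀ x, Beyond d (ident u) (ident x) → Clear u (c t) x := by
  refine eventually_all.mpr fun x => ?_
  have : IsTrans V fun y z => Beyond d (ident z) (ident y) := ⟨fun _ _ _ h h' => h'.trans h⟩
  have : Std.Irrefl fun y z : V => Beyond d (ident z) (ident y) := ⟨fun _ => not_beyond_self _ _⟩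
  -- Smaller means farther from `u`: the side is cleaned from the end of the line inwards.
  have hwf : WellFounded fun y z : V => Beyond d (ident z) (ident y) :=
    Finite.wellFounded_of_trans_of_irrefl _
  induction x using hwf.induction with
  | _ x ih =>
    by_cases hux : Beyond d (ident u) (ident x)
    swap
    · exact .of_forall fun t h' => absurd h' hux
    have hfar : ∀ᶠ t in atTop, ∀ z, Beyond d (ident x) (ident z) → Clear u (c t) z := by
      refine eventually_all.mpr fun z => ?_
      by_cases hxz : Beyond d (ident x) (ident z)
      · exact (ih z hxz).mono fun t ht _ => ht (hux.trans hxz)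
      · exact .of_forall fun t h' => absurd h' hxz
    cases hx : ((c 0).node x).mode with
    | staying =>
      exact (h.eventually_clear_of_staying hS hux hx hfar (hpred x hx hux) (hkeep x hux)).mono
        fun t ht _ => ht
    | leaving =>
      have hch := h.eventually_ch_clear hS hux hfar <| .of_forall fun t w _ hs =>
        (h.mode_ne hs hx).elim
      have hst : ∀ᶠ t in atTop, u ∉ ((c t).node x).stored := by
        rcases hleaving x hx hux with hst | ⟨rfl, hreq⟩
        · exact hst
        · exact h.clear_of_leaving hS hux hx (hch.mono fun t ht => ht.1) hreq
      filter_upwards [hst, hch] with t h₁ h₂ _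
      exact ⟨h₁, h₂.1, h₂.2⟩

end Regime

/-! ### No leaving node stays present forever -/

/-- At some time a leaving node on the right of `u` stores `u`. -/
def Requested (ident : V → I) (c : ℕ → State V I) (u : V) : Prop :=
  ∃ v t, ((c 0).node v).mode = .leaving ∧ Beyond .left (ident v) (ident u) ∧
    u ∈ ((c t).node v).stored

namespace Regime

variable {c : ℕ → State V I} {e : ℕ → Event V I} {u : V}

/-- Leaving nodes never drop references of nodes on their left. -/
theorem left_stored_mono (h : Regime ident c e) {v z : V} {t t' : ℕ} (ht : t ≤ t')
    (hv : ((c 0).node v).mode = .leaving) (hz : Beyond .left (ident v) (ident z))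
    (hs : z ∈ ((c t).node v).stored) : z ∈ ((c t').node v).stored := by
  induction t', ht using Nat.le_induction with
  | base => exact hs
  | succ i _ ih =>
    by_contra hn
    rw [h.comp.step] at hn
    obtain ⟨m, he, hl⟩ := lose_of_notMem_exec h.inj (h.not_exit i)
      (fun h' => hz.ne (by rw [h'])) hn ih
    cases hl with
    | linearize _ d w hx => exact h.mode_ne hx hv
    | rev A k _ d hk hd hx =>
      obtain rfl := hx ((h.mode i v).trans hv)
      exact hz.asymm hd

theorem not_gone_of_stored (h : Regime ident c e) {v z : V} {t : ℕ}
    (hs : z ∈ ((c t).node v).stored) : ¬ (c 0).gone v ∧ ¬ (c 0).gone z := by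
  rw [← h.gone t, ← h.gone t]
  exact h.live t v z (.inl hs)

/-- A requested node keeps receiving requests from its right. -/
theorem frequently_request (h : Regime ident c e) (hu : Requested ident c u) :
    ∃ᶠ t in atTop, e t = .receive u (.revAndLinReq .right) := by
  obtain ⟨v, t₀, hv, hvu, hs⟩ := hu
  refine frequently_atTop.mpr fun T => ?_
  obtain ⟨t, ht, he⟩ := h.exists_timeout (h.not_gone_of_stored hs).1 (max t₀ T)
  have hl := (h.mode t v).trans hv
  have hm := mem_outbox_request hl (fun hn => h.not_exit t ⟨v, he, hl, hn⟩)
    (h.left_stored_mono ((le_max_left _ _).trans ht) hv hvu hs) hvu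
  rw [← he] at hm
  obtain ⟨j, hj, hej⟩ := h.exists_receive hm
  exact ⟨j, by have := le_max_right t₀ T; omega, hej⟩

/-- A node that is not requested eventually issues no references of itself. -/
theorem eventually_silent [Finite V] (h : Regime ident c e)
    (hu : ((c 0).node u).mode = .leaving) (hr : ¬ Requested ident c u) :
    ∀ᶠ t in atTop, (∀ y k, .revAndLinAck u k ∉ (c t).ch y) ∧
      (∀ A k, .revAndLin A k ∉ (c t).ch u) ∧ ∀ y, .introduce u none ∉ (c t).ch y := by
  -- A chain of causes dries up: without a requesting leaving node on the right, no `right` request;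
  -- as a leaving node ignores the others, no acknowledgement; hence no list in return; hence no
  -- self-introduction.
  have h₁ := h.eventually_never (fun y m => y = u ∧ m = .revAndLinReq .right) <| by
    refine .of_forall fun t y m hs _ ⟨hy, hm⟩ => ?_
    subst hy
    generalize e t = ev at hs
    cases hs with
    | request x d v hx hn hv =>
      obtain ⟨hst, hd⟩ := sanitize_side.mp hv
      cases d
      · exact hr ⟨x, t, (h.mode t x).symm.trans hx, hd, hst⟩
      · cases hm
    | _ => cases hm
  have h₂ := h.eventually_never (fun _ m => ∃ k, m = .revAndLinAck u k) <| by
    filter_upwards [h₁] with t ht y m hs _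
    rintro ⟨k, rfl⟩
    generalize he : e t = ev at hs
    cases hs with
    | ack x d v k hx hv hk =>
      rcases hx with rfl | hx
      · exact ht _ _ (h.mem_ch he) ⟨rfl, rfl⟩
      · exact h.mode_ne hx hu
  have h₃ := h.eventually_never (fun y m => y = u ∧ ∃ A k, m = .revAndLin A k) <| by
    filter_upwards [h₂] with t ht y m hs _
    rintro ⟨rfl, A, k, rfl⟩
    generalize he : e t = ev at hs
    cases hs with
    | rev x v d k hx hv => exact ht _ _ (h.mem_ch he) ⟨_, rfl⟩
  have h₄ := h.eventually_never (fun _ m => m = .introduce u none) <| by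
    filter_upwards [h₃] with t ht y m hs _
    rintro rfl
    have hE := h.not_exit t
    generalize he : e t = ev at hs
    cases hs with
    | introNear x d w hx => exact h.mode_ne hx hu
    | exitIntro x v w hx hn => exact hE ⟨x, he, hx, hn⟩
    | revIntro x A k v d hv hd hx => exact ht _ _ (h.mem_ch he) ⟨rfl, _, _, rfl⟩
  filter_upwards [h₂, h₃, h₄] with t h₂ h₃ h₄
  exact ⟨fun y k hm => h₂ y _ hm ⟨k, rfl⟩, fun A k hm => h₃ u _ hm ⟨rfl, A, k, rfl⟩,
    fun y hm => h₄ y _ hm rfl⟩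

/-- Acknowledgements and self-introductions have ceased. A list with `u` that goes to the right of
`u` must come from a leaving node on the right of `u` that stores it, so `u` would be requested. -/
theorem shielded_right [Finite V] (h : Regime ident c e) (hu : ((c 0).node u).mode = .leaving)
    (hp : ¬ (c 0).gone u) (hr : ¬ Requested ident c u) : Shielded ident c .right u := by
  have hs := h.eventually_silent hu hr
  refine ⟨hu, hp, hs.mono fun t ht y _ k => ht.1 y k, hs.mono fun t ht y _ => ht.2.2 y, ?_⟩
  have := h.eventually_never (fun y m => Beyond .right (ident u) (ident y) ∧
      ∃ A k, m = .revAndLin A k ∧ u ∈ A) <| by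
    refine .of_forall fun t y m hs _ => ?_
    rintro ⟨huy, A, k, rfl, hA⟩
    generalize e t = ev at hs
    cases hs with
    | rev x v d k hx hv =>
      have hxu := view_nbr_beyond hA
      cases d
      · exact (hxu.trans huy).asymm hv
      · exact hr ⟨x, t, (h.mode t x).symm.trans hx, hxu,
          ((mem_view_stored h.inj).mp (mem_stored_of_nbr hA)).1⟩
  filter_upwards [this] with t ht y hy A k hm hA
  exact ht y _ hm ⟨hy, A, k, rfl, hA⟩

theorem eventually_clear_right [Finite V] (h : Regime ident c e)
    (hu : ((c 0).node u).mode = .leaving) (hp : ¬ (c 0).gone u) (hr : ¬ Requested ident c u) :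
    ∀ᶠ t in atTop, ∀ x, Beyond .right (ident u) (ident x) → Clear u (c t) x := by
  refine h.eventually_clear (h.shielded_right hu hp hr) ?_ ?_ ?_
  · intro x hx hux
    refine .of_forall fun t he w hun hw => ?_
    cases hm : ((c 0).node w).mode with
    | staying => rfl
    | leaving =>
      -- A leaving addressee would store `u` upon the introduction; as it lies on the right of `u`,
      -- this makes `u` requested.
      exfalso
      have hmem := mem_outbox_introFar ((h.mode t x).trans hx) hun hw
      rw [← he] at hmem
      obtain ⟨j, hj, hej⟩ := h.exists_receive hmem
      have hwu : Beyond .left (ident w) (ident u) := pred_beyond hw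
      refine hr ⟨w, j + 1, hm, hwu, ?_⟩
      rw [h.node_actor (x := w) (by rw [hej]; rfl), hej]
      simp only [after, onMessage, onIntroduce, dirOf_eq_some.mpr hwu, sanitize_mode,
        (h.mode j w).trans hm]
      rw [mem_stored_addTemp]
      by_cases hn : u ∈ (view ident (c j) w).nbr .left
      · exact .inl (mem_stored_of_nbr hn)
      · exact .inr (Finset.mem_sdiff.mpr ⟨Finset.mem_insert_self _ _, hn⟩)
  · exact fun x hx hux => .inl (.of_forall fun t hs => hr ⟨x, t, hx, hux, hs⟩)
  · intro x hux
    filter_upwards [h.eventually_silent hu hr] with t ht hs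
    by_contra hn
    rw [h.comp.step] at hn
    obtain ⟨m, he, hl⟩ := lose_of_notMem_exec h.inj (h.not_exit t)
      (fun h' => hux.ne (by rw [h'])) hn hs
    cases hl with
    | linearize _ d w hx => exact h.mode_ne hx hu
    | rev A k => exact ht.2.1 _ _ (h.mem_ch he)

/-- The leaving node `u` sends its own references only to the right. Lists with `u` that go left
come from leaving nodes `l` on the left of `u`, in answer to an acknowledgement from the left of
`l`; by `hsmall` no node there stores `l` and could acknowledge. -/
theorem shielded_left [Finite V] (h : Regime ident c e) (hu : ((c 0).node u).mode = .leaving)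
    (hp : ¬ (c 0).gone u)
    (hsmall : ∀ᶠ t in atTop, ∀ l, ((c 0).node l).mode = .leaving → ¬ (c 0).gone l →
      Beyond .left (ident u) (ident l) → ∀ x, Beyond .left (ident l) (ident x) →
      Clear l (c t) x) : Shielded ident c .left u := by
  refine ⟨hu, hp, ?_, ?_, ?_⟩
  · have := h.eventually_never (fun y m => Beyond .left (ident u) (ident y) ∧
        ∃ k, m = .revAndLinAck u k) <| by
      refine .of_forall fun t y m hs _ => ?_
      rintro ⟨huy, k, rfl⟩
      generalize e t = ev at hs
      cases hs with
      | ack x d v k hx hv hk =>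
        obtain rfl := hx.resolve_right fun hx => h.mode_ne hx hu
        exact (sanitize_side.mp hv).2.asymm huy
    filter_upwards [this] with t ht y hy k hm
    exact ht y _ hm ⟨hy, k, rfl⟩
  · have := h.eventually_never (fun y m => Beyond .left (ident u) (ident y) ∧
        m = .introduce u none) <| by
      refine .of_forall fun t y m hs _ => ?_
      rintro ⟨huy, rfl⟩
      have hE := h.not_exit t
      generalize he : e t = ev at hs
      cases hs with
      | introNear x d w hx => exact h.mode_ne hx hu
      | exitIntro x v w hx hn => exact hE ⟨x, he, hx, hn⟩
      | revIntro x A k v d hv hd hx =>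
        obtain rfl := hx ((h.mode t u).trans hu)
        exact hd.asymm huy
    filter_upwards [this] with t ht y hy hm
    exact ht y _ hm ⟨hy, rfl⟩
  · have h₁ := h.eventually_never (fun l m => ((c 0).node l).mode = .leaving ∧ ¬ (c 0).gone l ∧
        Beyond .left (ident u) (ident l) ∧
        ∃ x k, Beyond .left (ident l) (ident x) ∧ m = .revAndLinAck x k) <| by
      filter_upwards [hsmall] with t ht l m hs _
      rintro ⟨hl, hg, hul, x, k, hlx, rfl⟩
      generalize e t = ev at hs
      cases hs with
      | ack x d v k hx hv hk => exact (ht l hl hg hul x hlx).stored (sanitize_side.mp hv).1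
    have h₂ := h.eventually_never (fun y m => Beyond .left (ident u) (ident y) ∧
        ∃ A k, m = .revAndLin A k ∧ u ∈ A) <| by
      filter_upwards [h₁] with t ht y m hs _
      rintro ⟨huy, A, k, rfl, hA⟩
      have hE := h.comp.enabled t
      generalize he : e t = ev at hs hE
      cases hs with
      | rev x v d k hx hv =>
        have hxu := view_nbr_beyond hA
        cases d
        · exact ht x _ (h.mem_ch he) ⟨(h.mode t x).symm.trans hx,
            fun hg => hE.1 ((h.gone t x).mpr hg), hxu, _, _, hv, rfl⟩
        · exact (hxu.trans huy).asymm hv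
    filter_upwards [h₂] with t ht y hy A k hm hA
    exact ht y _ hm ⟨hy, A, k, rfl, hA⟩

/-- Induction along the line from its left end. The smaller leaving nodes, already forgotten on
their left, provide the shield and guarantee that predecessors are staying; being requested, they
also drop `u`. Whether `u` itself is requested plays no role, so the statement applies to them as
well. -/
theorem eventually_clear_left [Finite V] (h : Regime ident c e)
    (hu : ((c 0).node u).mode = .leaving) (hp : ¬ (c 0).gone u)
    (hr : ∀ l, ((c 0).node l).mode = .leaving → ¬ (c 0).gone l →
      Beyond .left (ident u) (ident l) → Requested ident c l) :
    ∀ᶠ t in atTop, ∀ x, Beyond .left (ident u) (ident x) → Clear u (c t) x := by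
  have : IsTrans V fun y z => Beyond .left (ident z) (ident y) := ⟨fun _ _ _ h h' => h'.trans h⟩
  have : Std.Irrefl fun y z : V => Beyond .left (ident z) (ident y) :=
    ⟨fun _ => not_beyond_self _ _⟩
  have hwf : WellFounded fun y z : V => Beyond .left (ident z) (ident y) :=
    Finite.wellFounded_of_trans_of_irrefl _
  induction u using hwf.induction with
  | _ u ih =>
    have hsmall : ∀ᶠ t in atTop, ∀ l, ((c 0).node l).mode = .leaving → ¬ (c 0).gone l →
        Beyond .left (ident u) (ident l) → ∀ x, Beyond .left (ident l) (ident x) →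
        Clear l (c t) x := by
      refine eventually_all.mpr fun l => ?_
      by_cases hl : ((c 0).node l).mode = .leaving ∧ ¬ (c 0).gone l ∧
          Beyond .left (ident u) (ident l)
      · obtain ⟨h₁, h₂, h₃⟩ := hl
        exact (ih l h₃ h₁ h₂ fun l' h₁' h₂' h₃' => hr l' h₁' h₂' (h₃.trans h₃')).mono
          fun t ht _ _ _ => ht
      · exact .of_forall fun t h₁ h₂ h₃ => absurd ⟨h₁, h₂, h₃⟩ hl
    refine h.eventually_clear (h.shielded_left hu hp hsmall) ?_ ?_ ?_
    · intro x hx hux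
      filter_upwards [hsmall] with t ht he w hun hw
      cases hm : ((c 0).node w).mode with
      | staying => rfl
      | leaving =>
        obtain ⟨hws, hxw⟩ := (h.mem_view_nbr hx).mp (pred_mem hw)
        exact absurd hws (ht w hm (h.not_gone_of_stored hws).2 (beyond_opp.mp (pred_beyond hw)) x
          (beyond_opp.mp hxw)).stored
    · intro x hx hux
      by_cases hg : (c 0).gone x
      · exact .inl (.of_forall fun t hs => (h.not_gone_of_stored hs).1 hg)
      · exact .inr ⟨rfl, h.frequently_request (hr x hx hg hux)⟩
    · exact fun x hux => .of_forall fun t hs => h.left_stored_mono t.le_succ hu hux hs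

/-- A leaving node of which no other node has references eventually has an empty channel. -/
theorem eventually_ch_eq_zero [Finite V] (h : Regime ident c e)
    (hu : ((c 0).node u).mode = .leaving)
    (hclear : ∀ᶠ t in atTop, ∀ x, x ≠ u → Clear u (c t) x) :
    ∀ᶠ t in atTop, (c t).ch u = 0 := by
  have hact : ∀ᶠ t in atTop, ∀ m, Sent ident (c t) (e t) u m → (e t).actor = some u := by
    filter_upwards [hclear] with t ht m hs
    obtain ⟨x, hx, hk, -⟩ := hs.known h.inj
    by_cases hxu : x = u
    · rw [← hxu]; exact hx
    · exfalso
      rcases hk with hk | hk | hk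
      · exact hxu hk.symm
      · exact (ht x hxu).stored hk
      · generalize he : e t = ev at hx hk
        cases ev with
        | receive y m => cases hx; exact (ht x hxu).ch m (h.mem_ch he) hk
        | _ => exact hk
  -- Now only `u` writes into its channel, and all it eventually sends to itself are delegations.
  -- For `ProbeFail` this uses that sources of probes are staying. A received delegation is stored,
  -- dropped or passed to another node, so delegations die out next.
  have h₁ := h.eventually_never (fun y m => y = u ∧ ∀ v, m ≠ .tempDelegate v) <| by
    filter_upwards [hact, h.eventually_probe_source] with t ht hsrc y m hs _
    rintro ⟨rfl, hm⟩
    have ha := ht m hs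
    have hE := h.not_exit t
    generalize he : e t = ev at hs ha
    cases hs with
    | probeStart x dest n hx => exact h.mode_ne hx hu
    | introFar x d v w hx => cases ha; exact h.mode_ne hx hu
    | introNear x d w hx => cases ha; exact h.mode_ne hx hu
    | exitIntro x v w hx hn => exact hE ⟨x, he, hx, hn⟩
    | request x d v hx hn hv => cases ha; exact not_beyond_self _ _ (sanitize_side.mp hv).2
    | introLin x v w hx => cases ha; exact h.mode_ne hx hu
    | ack x d v k hx hv => cases ha; exact not_beyond_self _ _ (sanitize_side.mp hv).2
    | rev x v d k hx hv => cases ha; exact not_beyond_self _ _ hv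
    | revIntro x A k v d hv hd => cases ha; exact not_beyond_self _ _ hd
    | probeSuccess x source dest next n hx => cases ha; exact h.mode_ne hx hu
    | probeFail x source dest next n =>
      have := hsrc _ _ _ _ _ (h.mem_ch he)
      rw [hu] at this
      cases this
    | probeForward x source dest next n d z hd hz =>
      cases ha
      rcases mem_probeNext (first_mem hz) with hz | hz
      · exact hz.1 rfl
      · exact not_beyond_self _ _ hz.1
    | searchSend x dest n v r hx => cases ha; exact h.mode_ne hx hu
    | _ => exact hm _ rfl
  have h₂ := h.eventually_never (fun y _ => y = u) <| by
    filter_upwards [hact, h₁, (tendsto_add_atTop_nat 1).eventually h₁] with t ht h₁ h₁' y m hs hm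
    rintro rfl
    have ha := ht m hs
    have htd : ∃ v, m = .tempDelegate v := by
      by_contra hc
      exact h₁' y m hm ⟨rfl, fun v hv => hc ⟨v, hv⟩⟩
    have hrec : ∀ {m'}, e t = .receive y m' → ∃ v, m' = .tempDelegate v := fun he => by
      by_contra hc
      exact h₁ y _ (h.mem_ch he) ⟨rfl, fun v hv => hc ⟨v, hv⟩⟩
    obtain ⟨v, rfl⟩ := htd
    generalize he : e t = ev at hs ha
    cases hs with
    | delegate x v d w hv hw hb =>
      cases ha
      exact not_beyond_self _ _ (view_nbr_beyond (first_mem hw))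
    | _ => cases ha; obtain ⟨v, hv⟩ := hrec he; cases hv
  filter_upwards [h₂] with t ht
  exact Multiset.eq_zero_of_forall_notMem fun m hm => ht u m hm rfl

theorem gone_of_leaving [Finite V] (h : Regime ident c e) (hu : ((c 0).node u).mode = .leaving) :
    (c 0).gone u := by
  have := Fintype.ofFinite V
  by_contra hp
  -- the smallest leaving node that is not requested
  let P : Finset V := Finset.univ.filter fun v => ((c 0).node v).mode = .leaving ∧ ¬ (c 0).gone v
  have hP : ∀ {v}, v ∈ P ↔ ((c 0).node v).mode = .leaving ∧ ¬ (c 0).gone v := by simp [P]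
  let N : Finset V := P.filter fun v => ¬ Requested ident c v
  cases hN : first ident .right N with
  | none =>
    -- If all were requested, so would be the largest; but the requesting node would be present,
    -- leaving and larger.
    cases hm : first ident .left P with
    | none => exact Finset.notMem_empty u (first_eq_none hm ▸ hP.mpr ⟨hu, hp⟩)
    | some m =>
      have hr : Requested ident c m := by
        by_contra hr
        exact Finset.notMem_empty m
          (first_eq_none hN ▸ Finset.mem_filter.mpr ⟨first_mem hm, hr⟩)
      obtain ⟨v, t, hv, hvm, hs⟩ := hr
      exact not_beyond_first hm (hP.mpr ⟨hv, (h.not_gone_of_stored hs).1⟩) hvm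
  | some w =>
    obtain ⟨hw, hr⟩ := Finset.mem_filter.mp (first_mem hN)
    obtain ⟨hw, hg⟩ := hP.mp hw
    have hright := h.eventually_clear_right hw hg hr
    have hleft := h.eventually_clear_left hw hg fun l hl hgl hwl => by
      by_contra hrl
      exact not_beyond_first hN (Finset.mem_filter.mpr ⟨hP.mpr ⟨hl, hgl⟩, hrl⟩) hwl
    have hclear : ∀ᶠ t in atTop, ∀ x, x ≠ w → Clear w (c t) x := by
      filter_upwards [hright, hleft] with t h₁ h₂ x hx
      obtain ⟨d, hd⟩ := exists_beyond (h.inj.ne hx.symm)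
      cases d
      exacts [h₂ x hd, h₁ x hd]
    obtain ⟨T, hT⟩ := eventually_atTop.mp (hclear.and (h.eventually_ch_eq_zero hw hclear))
    obtain ⟨t, ht, he⟩ := h.exists_timeout hg T
    obtain ⟨hc, hz⟩ := hT t ht
    -- The oracle is true for `w` at this `Timeout`, which would thus be an exit.
    refine h.not_exit t ⟨w, he, (h.mode t w).trans hw, fun v hv hedge => ?_, hz⟩
    rcases hedge with hs | ⟨m, hm, hr⟩
    · exact (hc v hv).stored hs
    · exact (hc v hv).ch m hm hr

end Regime

/-! ### From regimes to arbitrary computations. -/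

theorem IsComputation.shift {c : ℕ → State V I} {e : ℕ → Event V I}
    (h : IsComputation ident c e) (T : ℕ) :
    IsComputation ident (fun i => c (T + i)) fun i => e (T + i) where
  enabled i := h.enabled _
  step i := h.step _
  timeout_fair u hu i := by
    obtain ⟨i₀, hi₀⟩ := hu
    obtain ⟨j, hj, he⟩ := h.timeout_fair u ⟨T + i₀, fun j hj hg => hi₀ (j - T) (by omega) (by
      rwa [Nat.add_sub_cancel' (by omega)])⟩ (T + i)
    exact ⟨j - T, by omega, by rwa [Nat.add_sub_cancel' (by omega)]⟩
  receipt_fair i u m hm := by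
    obtain ⟨j, hj, he⟩ := h.receipt_fair (T + i) u m hm
    exact ⟨j - T, by omega, by rwa [Nat.add_sub_cancel' (by omega)]⟩

/-- A property of nodes that is never lost is eventually constant. -/
theorem eventually_const [Finite V] {p : ℕ → V → Prop}
    (hp : ∀ t t' u, t ≤ t' → p t u → p t' u) :
    ∃ T, ∀ t ≥ T, ∀ u, p t u ↔ p T u := by
  have : ∀ᶠ T in atTop, ∀ u, ∀ t ≥ T, p t u → p T u := by
    refine eventually_all.mpr fun u => ?_
    by_cases hu : ∃ t, p t u
    · obtain ⟨t, ht⟩ := hu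
      filter_upwards [eventually_ge_atTop t] with T hT _ _ _
      exact hp _ _ _ hT ht
    · exact .of_forall fun T t _ h => absurd ⟨t, h⟩ hu
  obtain ⟨T, hT⟩ := this.exists
  exact ⟨T, fun t ht u => ⟨hT u t ht, hp _ _ _ ht⟩⟩

/-- From some time on, all leaving nodes are gone. -/
theorem IsComputation.liveness [Finite V] (hi : Function.Injective ident)
    {c : ℕ → State V I} {e : ℕ → Event V I} (hc : IsComputation ident c e)
    (hinit : IsInitial (c 0)) :
    ∃ T, ∀ t ≥ T, ∀ u, ((c t).node u).mode = .leaving → (c t).gone u := by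
  obtain ⟨T₁, h₁⟩ := eventually_const (p := fun t u => ((c t).node u).mode = .leaving)
    fun t t' u ht => hc.leaving_mono ht
  obtain ⟨T₂, h₂⟩ := eventually_const (p := fun t u => (c t).gone u)
    fun t t' u ht => hc.gone_mono ht
  have hlive : Live (c 0) := fun a b _ => ⟨hinit a, hinit b⟩
  refine ⟨max T₁ T₂, fun t ht u hu => ?_⟩
  have hmode : ∀ i u, ((c (t + i)).node u).mode = ((c t).node u).mode := fun i u => by
    have := (h₁ (t + i) (by omega) u).trans (h₁ t (by omega) u).symm
    cases h : ((c (t + i)).node u).mode <;> cases h' : ((c t).node u).mode <;> simp_all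
  -- The computation from `t` on is a regime, and in a regime leaving nodes are gone from the start,
  -- that is, at `t`.
  have hreg : Regime ident (fun i => c (t + i)) fun i => e (t + i) :=
    { inj := hi
      comp := hc.shift t
      mode := hmode
      gone := fun i u => (h₂ (t + i) (by omega) u).trans (h₂ t (by omega) u).symm
      live := fun i => hc.live hi hlive _
      present := fun u hs hg => by
        have := hc.leaving_of_gone hinit _ hg
        rw [hs] at this
        cases this }
  exact hreg.gone_of_leaving hu

end BuildListStar

end

theorem mainTheorem4 {V I : Type*} [Finite V] [LinearOrder I] (ident : V → I)
    (hident : Function.Injective ident)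
    (c : ℕ → BuildListStar.State V I) (e : ℕ → BuildListStar.Event V I)
    (hinit : BuildListStar.IsInitial (c 0))
    (hc : BuildListStar.IsComputation ident c e) :
    -- safety: present nodes stay weakly connected exactly as in the initial state
    (∀ t u v, ¬ (c t).gone u → ¬ (c t).gone v →
      (BuildListStar.SameComponent (c t) u v ↔ BuildListStar.SameComponent (c 0) u v)) ∧
    -- only leaving nodes are ever gone
    (∀ t u, (c t).gone u → ((c t).node u).mode = .leaving) ∧
    -- liveness: from some time on all leaving nodes are gone
    (∃ t₀, ∀ t ≥ t₀, ∀ u, ((c t).node u).mode = .leaving → (c t).gone u) ∧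
    -- convergence to the legitimate states
    (∃ t₀, ∀ t ≥ t₀, BuildListStar.FDPLegitimate (c 0) (c t)) ∧
    -- closure: only the decision of a further node to leave ends a legitimate state
    (∀ t, BuildListStar.FDPLegitimate (c 0) (c t) → (∀ u, e t ≠ .leave u) →
      BuildListStar.FDPLegitimate (c 0) (c (t + 1))) := by
  have hlive : BuildListStar.Live (c 0) := fun a b _ => ⟨hinit a, hinit b⟩
  have hsafe := fun t u v => hc.safety hident hlive t (u := u) (v := v)
  have hgone := fun t u => hc.leaving_of_gone hinit t (u := u)
  obtain ⟨T, hT⟩ := hc.liveness hident hinit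
  have hstay : ∀ t u, ((c t).node u).mode = .staying → ¬ (c t).gone u := fun t u hs hg => by
    rw [hgone t u hg] at hs
    cases hs
  refine ⟨hsafe, hgone, ⟨T, hT⟩, ⟨T, fun t ht => ⟨hstay t, hT t ht, fun u v hu hv =>
    hsafe t u v (hstay t u hu) (hstay t v hv)⟩⟩, fun t hleg hne => ⟨hstay _, fun u hu => ?_,
    fun u v hu hv => hsafe _ u v (hstay _ u hu) (hstay _ v hv)⟩⟩
  rw [hc.step] at hu
  -- No other step changes a mode, so a node that is leaving now was leaving, and hence gone,
  -- before.
  rw [BuildListStar.exec_mode (hne u)] at hu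
  exact hc.gone_mono t.le_succ (hleg.leaving_gone u hu)
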